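/- Let $n\ge 1$ and $k\ge 0$ be integers, let $M^n$ be a compact smooth manifold with nonempty boundary $\partial M$, and let $x:M\to\mathbb{R}^{n+k}$ be a smooth immersion with image in the closed unit ball $\mathbb{B}^{n+k}$. Assume that $M$ is free boundary, that is, $x^{-1}(\partial\mathbb{B}^{n+k})=\partial M$ and $M$ meets the unit sphere $\partial\mathbb{B}^{n+k}$ orthogonally along $\partial M$. Equip $M$ and $\partial M$ with the induced Riemannian metrics and their volume measures, let $A$ be the second fundamental form of $M$, and let $H=\frac1n\operatorname{Tr}A$ be its mean curvature vector. Let $H_1^2(M)$ be the completion of $C^\infty(M)$ for the norm $\big(\int_M v^2+\int_M|\nabla v|^2\big)^{1/2}$. Then, for every real $s>0$ and every continuous function $u$ on $M$ that belongs to $H_1^2(M)$, $$s(2-s)\int_M u^2-\int_M |H|^2u^2\le \frac{4}{n^2}\int_M|\nabla u|^2+\frac{2s}{n}\int_{\partial M}u^2,$$ $$-s(2+s)\int_M u^2-\int_M |H|^2u^2\le \frac{4}{n^2}\int_M|\nabla u|^2-\frac{2s}{n}\int_{\partial M}u^2.$$ Moreover, in each of the two inequalities, equality holds if and only if $u\equiv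 0$. -/

import Mathlib

open MeasureTheory Set Filter Topology
open scoped Manifold ContDiff ENNReal

noncomputable section

namespace FreeBoundary

/-- The inclusion of `ℝ^{n-1}` into `ℝ^n` as the hyperplane `{y₀ = 0}`, the bounding hyperplane of
the model half-space `{0 ≤ y₀}`. -/
def face (n : ℕ) [NeZero n] :
    EuclideanSpace ℝ {i : Fin n // i ≠ 0} →L[ℝ] EuclideanSpace ℝ (Fin n) :=
  LinearMap.toContinuousLinearMap
    { toFun := fun z => WithLp.toLp 2 fun i => if h : i ≠ 0 then z ⟨i, h⟩ else 0
      map_add' := by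
        intro a b
        ext i
        by_cases h : i = 0 <;> simp [h]
      map_smul' := by
        intro c a
        ext i
        by_cases h : i = 0 <;> simp [h] }

/-! ### Geometry of an immersion `F : M → ℝ^N` of an `n`-manifold with boundary

All metric notions on `M` are those of the Riemannian metric induced by `F`. -/

section Immersion

variable {n N : ℕ} [NeZero n] {M : Type*} [TopologicalSpace M]
  [ChartedSpace (EuclideanHalfSpace n) M]

/-- The differential `dF_p : T_pM → ℝ^N`. In Mathlib, `T_pM` is the model space `ℝ^n`, through the
preferred chart at `p`. -/
def differential (F : M → EuclideanSpace ℝ (Fin N)) (p : M) :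
    EuclideanSpace ℝ (Fin n) →L[ℝ] EuclideanSpace ℝ (Fin N) :=
  mfderiv (𝓡∂ n) 𝓘(ℝ, EuclideanSpace ℝ (Fin N)) F p

/-- The differential of a real function `v` on `M` at `p`. -/
def differentialFun (v : M → ℝ) (p : M) : EuclideanSpace ℝ (Fin n) →L[ℝ] ℝ :=
  mfderiv (𝓡∂ n) 𝓘(ℝ, ℝ) v p

/-- The matrix `gᵢⱼ = ⟪dF_p eᵢ, dF_p eⱼ⟫` of the induced metric at `p`, in the basis of `T_pM` given
by the chart at `p`. -/
def metricMatrix (F : M → EuclideanSpace ℝ (Fin N)) (p : M) : Matrix (Fin n) (Fin n) ℝ :=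
  Matrix.gram ℝ fun i => differential (n := n) F p (EuclideanSpace.single i 1)

/-- The derivative, at the coordinate point `y`, of the local parametrization `F ∘ φ⁻¹`, where `φ`
is the preferred chart at `x` (one-sided at the boundary of the half-space). -/
def coordDeriv (F : M → EuclideanSpace ℝ (Fin N)) (x : M) (y : EuclideanSpace ℝ (Fin n)) :
    EuclideanSpace ℝ (Fin n) →L[ℝ] EuclideanSpace ℝ (Fin N) :=
  fderivWithin ℝ (F ∘ (extChartAt (𝓡∂ n) x).symm) (range (𝓡∂ n)) y

/-- The Riemannian volume of the domain of the chart `φ` at `x`, as a measure on `M`: the image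
under `φ⁻¹` of the measure `√(det gᵢⱼ) dy` on the range of `φ`. (The number `L.normDet` is
`√(det (Lᵀ L))`.) -/
def chartVolume [MeasurableSpace M] (F : M → EuclideanSpace ℝ (Fin N)) (x : M) : Measure M :=
  ((volume.restrict (extChartAt (𝓡∂ n) x).target).withDensity
    fun y => ENNReal.ofReal ((coordDeriv F x y).toLinearMap.normDet)).map (extChartAt (𝓡∂ n) x).symm

/-- The Riemannian volume measure of `M`: the smallest measure that dominates the volume of every
chart domain. (The chart volumes agree on overlaps, so this is the measure on `M` obtained by
glueing them.) -/
def volumeM [MeasurableSpace M] (F : M → EuclideanSpace ℝ (Fin N)) : Measure M :=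
  ⨆ x : M, chartVolume (n := n) F x

/-- The `(n-1)`-dimensional Riemannian volume of the part of `∂M` in the domain of the chart `φ` at
`x`, as a measure on `M`: in the chart, `∂M` is `{y₀ = 0}`, and the density is `√(det gᵢⱼ)` with
`i, j ≠ 0`. -/
def chartBoundaryVolume [MeasurableSpace M] (F : M → EuclideanSpace ℝ (Fin N)) (x : M) :
    Measure M :=
  ((volume.restrict (face n ⁻¹' (extChartAt (𝓡∂ n) x).target)).withDensity
    fun z => ENNReal.ofReal (((coordDeriv F x (face n z)).comp (face n)).toLinearMap.normDet)).map
      fun z => (extChartAt (𝓡∂ n) x).symm (face n z)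

/-- The `(n-1)`-dimensional Riemannian volume measure of `∂M`, regarded as a measure on `M` that is
carried by `∂M`; it is glued from the charts as `volumeM` is. (For `n = 1` it counts the points of
`∂M`.) -/
def boundaryVolume [MeasurableSpace M] (F : M → EuclideanSpace ℝ (Fin N)) : Measure M :=
  ⨆ x : M, chartBoundaryVolume (n := n) F x

/-- The second fundamental form `A_p(v, w) = (∇̄_V W)^⊥` for `v, w ∈ T_pM`. Extending `v, w` to
vector fields `V, W` with constant coefficients in the chart `φ` at `p`, one has
`∇̄_V W = D²(F ∘ φ⁻¹)(v, w)`; the induced connection `∇_V W` is its part tangent to `M`, so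
`∇̄_V W - ∇_V W` is its component normal to `dF_p(T_pM)`. -/
def secondFundamentalForm (F : M → EuclideanSpace ℝ (Fin N)) (p : M)
    (v w : EuclideanSpace ℝ (Fin n)) : EuclideanSpace ℝ (Fin N) :=
  ((LinearMap.range (differential (n := n) F p).toLinearMap)ᗮ).starProjection
    (fderivWithin ℝ (coordDeriv F p) (range (𝓡∂ n)) (extChartAt (𝓡∂ n) p p) v w)

/-- The mean curvature vector `H = (1/n) Tr A = (1/n) ∑ gⁱʲ A(eᵢ, eⱼ)`. -/
def meanCurvature (F : M → EuclideanSpace ℝ (Fin N)) (p : M) : EuclideanSpace ℝ (Fin N) :=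
  (n : ℝ)⁻¹ • ∑ i : Fin n, ∑ j : Fin n,
    (metricMatrix (n := n) F p)⁻¹ i j •
      secondFundamentalForm F p (EuclideanSpace.single i 1) (EuclideanSpace.single j 1)

/-- The Riemannian gradient `∇v = ∑ gⁱʲ (∂ⱼv) eᵢ` of a differentiable function `v`, as the vector
`dF_p(∇v)` of `ℝ^N`. -/
def riemannianGradient (F : M → EuclideanSpace ℝ (Fin N)) (v : M → ℝ) (p : M) :
    EuclideanSpace ℝ (Fin N) :=
  ∑ i : Fin n, ∑ j : Fin n,
    ((metricMatrix (n := n) F p)⁻¹ i j *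
        differentialFun (n := n) v p (EuclideanSpace.single j 1)) •
      differential (n := n) F p (EuclideanSpace.single i 1)

/-- `u` belongs to the Sobolev space `H₁²(M)`, the completion of `C^∞(M)` for the norm
`(∫ v² + ∫ |∇v|²)^{1/2}`, and `X` is its gradient: there are `vⱼ ∈ C^∞(M)` with `vⱼ → u` and
`∇vⱼ → X` in `L²`. (Such an `X` is determined by `u` up to a null set.) -/
structure HasSobolevGradient [MeasurableSpace M] (F : M → EuclideanSpace ℝ (Fin N))
    (u : M → ℝ) (X : M → EuclideanSpace ℝ (Fin N)) : Prop where
  memLp : MemLp u 2 (volumeM (n := n) F)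
  memLp_gradient : MemLp X 2 (volumeM (n := n) F)
  approx : ∃ v : ℕ → M → ℝ, (∀ j, ContMDiff (𝓡∂ n) 𝓘(ℝ, ℝ) ∞ (v j)) ∧
    Tendsto (fun j => eLpNorm (v j - u) 2 (volumeM (n := n) F)) atTop (𝓝 0) ∧
    Tendsto (fun j => eLpNorm (riemannianGradient (n := n) F (v j) - X) 2 (volumeM (n := n) F))
      atTop (𝓝 0)

/-- `F` is a smooth immersion of `M`, a manifold with nonempty boundary, into the closed unit ball;
exactly the points of `∂M` are mapped to the unit sphere; and along `∂M` the immersed manifold meets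
the sphere orthogonally, that is, the normal `F p` of the sphere is tangent to `M`. -/
structure IsFreeBoundaryImmersion (F : M → EuclideanSpace ℝ (Fin N)) : Prop where
  contMDiff : ContMDiff (𝓡∂ n) 𝓘(ℝ, EuclideanSpace ℝ (Fin N)) ∞ F
  injective_differential : ∀ p, Function.Injective (differential (n := n) F p)
  boundary_nonempty : ((𝓡∂ n).boundary M).Nonempty
  mem_ball : ∀ p, F p ∈ Metric.closedBall (0 : EuclideanSpace ℝ (Fin N)) 1
  preimage_sphere :
    F ⁻¹' Metric.sphere (0 : EuclideanSpace ℝ (Fin N)) 1 = (𝓡∂ n).boundary M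
  orthogonal : ∀ p ∈ (𝓡∂ n).boundary M, F p ∈ range (differential (n := n) F p)

end Immersion

end FreeBoundary

end

noncomputable section

namespace FreeBoundary

set_option linter.unusedSectionVars false

/-! ### Linear algebra of an injective linear map `L : ℝ^n → V` -/

section LinearAlgebra

variable {n : ℕ} {V : Type*} [NormedAddCommGroup V] [InnerProductSpace ℝ V]

/-- The Gram matrix of the images of the standard basis. -/
def gramOf (L : EuclideanSpace ℝ (Fin n) →L[ℝ] V) : Matrix (Fin n) (Fin n) ℝ :=
  Matrix.gram ℝ fun i => L (EuclideanSpace.single i 1)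

/-- The vector of `range L` that represents the functional `a` for the metric induced by `L`. -/
def gradientOf (L : EuclideanSpace ℝ (Fin n) →L[ℝ] V) (a : EuclideanSpace ℝ (Fin n) →L[ℝ] ℝ) : V :=
  ∑ i : Fin n, ∑ j : Fin n,
    ((gramOf L)⁻¹ i j * a (EuclideanSpace.single j 1)) • L (EuclideanSpace.single i 1)

/-- The normalized trace of the normal part of a bilinear form, for the metric induced by `L`. -/
def meanCurvatureOf (L : EuclideanSpace ℝ (Fin n) →L[ℝ] V)
    (B : EuclideanSpace ℝ (Fin n) →L[ℝ] EuclideanSpace ℝ (Fin n) →L[ℝ] V) : V :=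
  (n : ℝ)⁻¹ • ∑ i : Fin n, ∑ j : Fin n, (gramOf L)⁻¹ i j •
    ((LinearMap.range L.toLinearMap)ᗮ).starProjection
      (B (EuclideanSpace.single i 1) (EuclideanSpace.single j 1))

variable (L : EuclideanSpace ℝ (Fin n) →L[ℝ] V)

theorem clm_apply_eq_sum {W : Type*} [NormedAddCommGroup W] [NormedSpace ℝ W]
    (T : EuclideanSpace ℝ (Fin n) →L[ℝ] W) (v : EuclideanSpace ℝ (Fin n)) :
    T v = ∑ i, v i • T (EuclideanSpace.single i 1) := by
  conv_lhs => rw [← (EuclideanSpace.basisFun (Fin n) ℝ).sum_repr v]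
  simp [map_sum]

theorem gramOf_apply (i j : Fin n) : gramOf L i j =
    inner ℝ (L (EuclideanSpace.single i 1)) (L (EuclideanSpace.single j 1)) := rfl

theorem gramOf_symm (i j : Fin n) : gramOf L i j = gramOf L j i := by
  rw [gramOf_apply, gramOf_apply, real_inner_comm]

theorem gramOf_transpose : (gramOf L).transpose = gramOf L := by
  ext i j; exact gramOf_symm L j i

theorem gramOf_inv_symm (i j : Fin n) : (gramOf L)⁻¹ i j = (gramOf L)⁻¹ j i := by
  conv_lhs => rw [← gramOf_transpose L, ← Matrix.transpose_nonsing_inv]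
  rfl

variable {L}

theorem gramOf_posDef (hL : Function.Injective L) : (gramOf L).PosDef := by
  apply Matrix.posDef_gram_of_linearIndependent
  have h := (EuclideanSpace.basisFun (Fin n) ℝ).toBasis.linearIndependent.map'
    L.toLinearMap (LinearMap.ker_eq_bot.2 hL)
  convert! h using 1
  ext i; simp

theorem gramOf_det_pos (hL : Function.Injective L) : 0 < (gramOf L).det :=
  (gramOf_posDef hL).det_pos

theorem gramOf_inv_mul (hL : Function.Injective L) : (gramOf L)⁻¹ * gramOf L = 1 :=
  Matrix.nonsing_inv_mul _ (gramOf_det_pos hL).ne'.isUnit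

theorem sum_gramOf_inv_mul (hL : Function.Injective L) (i l : Fin n) :
    ∑ j, (gramOf L)⁻¹ i j * gramOf L j l = if i = l then 1 else 0 := by
  have := congrFun (congrFun (gramOf_inv_mul hL) i) l
  rwa [Matrix.mul_apply, Matrix.one_apply] at this

theorem normDet_eq_sqrt (L : EuclideanSpace ℝ (Fin n) →L[ℝ] V) :
    L.toLinearMap.normDet = √(gramOf L).det := by
  have h := L.toLinearMap.normDet_sq_eq_det_gram (EuclideanSpace.basisFun (Fin n) ℝ)
  have h2 : (gramOf L).det = L.toLinearMap.normDet ^ 2 := by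
    rw [gramOf]; simpa using h.symm
  rw [h2, Real.sqrt_sq (LinearMap.normDet_nonneg _)]

theorem gradientOf_mem_range (L : EuclideanSpace ℝ (Fin n) →L[ℝ] V)
    (a : EuclideanSpace ℝ (Fin n) →L[ℝ] ℝ) : gradientOf L a ∈ LinearMap.range L.toLinearMap :=
  Submodule.sum_mem _ fun _ _ => Submodule.sum_mem _ fun _ _ => Submodule.smul_mem _ _ ⟨_, rfl⟩

theorem inner_gradientOf (hL : Function.Injective L) (a : EuclideanSpace ℝ (Fin n) →L[ℝ] ℝ)
    (v : EuclideanSpace ℝ (Fin n)) : inner ℝ (gradientOf L a) (L v) = a v := by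
  have key : ∀ l, inner ℝ (gradientOf L a) (L (EuclideanSpace.single l 1)) =
      a (EuclideanSpace.single l 1) := by
    intro l
    simp only [gradientOf, sum_inner, inner_smul_left, conj_trivial, ← gramOf_apply]
    rw [Finset.sum_comm]
    have : ∀ j, ∑ i, (gramOf L)⁻¹ i j * a (EuclideanSpace.single j 1) * gramOf L i l =
        (if j = l then 1 else 0) * a (EuclideanSpace.single j 1) := by
      intro j
      rw [← sum_gramOf_inv_mul hL, Finset.sum_mul]
      refine Finset.sum_congr rfl fun i _ => ?_
      rw [gramOf_inv_symm L i j]; ring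
    simp [this]
  rw [clm_apply_eq_sum L v, clm_apply_eq_sum a v, inner_sum]
  simp [inner_smul_right, key]

theorem eq_of_mem_range_of_inner_eq {v w : V}
    (hv : v ∈ LinearMap.range L.toLinearMap) (hw : w ∈ LinearMap.range L.toLinearMap)
    (h : ∀ i, inner ℝ v (L (EuclideanSpace.single i 1)) =
      inner ℝ w (L (EuclideanSpace.single i 1))) : v = w := by
  obtain ⟨z, hz⟩ := Submodule.sub_mem _ hv hw
  have h0 : inner ℝ (v - w) (L z) = 0 := by
    rw [clm_apply_eq_sum L z, inner_sum]
    refine Finset.sum_eq_zero fun i _ => ?_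
    rw [inner_smul_right, inner_sub_left, h i, sub_self, mul_zero]
  rw [ContinuousLinearMap.coe_coe] at hz
  rw [hz, inner_self_eq_zero] at h0
  exact sub_eq_zero.1 h0

theorem eq_gradientOf (hL : Function.Injective L) {a : EuclideanSpace ℝ (Fin n) →L[ℝ] ℝ} {v : V}
    (hv : v ∈ LinearMap.range L.toLinearMap) (h : ∀ w, inner ℝ v (L w) = a w) :
    v = gradientOf L a :=
  eq_of_mem_range_of_inner_eq hv (gradientOf_mem_range L a) fun i => by
    rw [h, inner_gradientOf hL]

theorem gradientOf_add (a b : EuclideanSpace ℝ (Fin n) →L[ℝ] ℝ) :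
    gradientOf L (a + b) = gradientOf L a + gradientOf L b := by
  simp only [gradientOf, ← Finset.sum_add_distrib, ← add_smul, add_apply,
    mul_add]

theorem gradientOf_smul (c : ℝ) (a : EuclideanSpace ℝ (Fin n) →L[ℝ] ℝ) :
    gradientOf L (c • a) = c • gradientOf L a := by
  simp only [gradientOf, Finset.smul_sum, smul_smul, smul_apply, smul_eq_mul]
  refine Finset.sum_congr rfl fun i _ => Finset.sum_congr rfl fun j _ => ?_
  ring_nf

theorem gradientOf_comp (hL : Function.Injective L)
    {T : EuclideanSpace ℝ (Fin n) →L[ℝ] EuclideanSpace ℝ (Fin n)} (hT : Function.Bijective T)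
    (a : EuclideanSpace ℝ (Fin n) →L[ℝ] ℝ) :
    gradientOf (L.comp T) (a.comp T) = gradientOf L a := by
  refine (eq_gradientOf (L := L.comp T) (hL.comp hT.1) ?_ fun w => ?_).symm
  · obtain ⟨w, hw⟩ := gradientOf_mem_range L a
    obtain ⟨z, rfl⟩ := hT.2 w
    exact ⟨z, hw⟩
  · exact inner_gradientOf hL a (T w)

/-- The matrix of an endomorphism in the standard basis. -/
def matrixOf (T : EuclideanSpace ℝ (Fin n) →L[ℝ] EuclideanSpace ℝ (Fin n)) :
    Matrix (Fin n) (Fin n) ℝ :=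
  Matrix.of fun i j => T (EuclideanSpace.single j 1) i

theorem matrixOf_mul (T T' : EuclideanSpace ℝ (Fin n) →L[ℝ] EuclideanSpace ℝ (Fin n)) :
    matrixOf (T.comp T') = matrixOf T * matrixOf T' := by
  ext i j
  rw [Matrix.mul_apply]
  simp only [matrixOf, Matrix.of_apply, ContinuousLinearMap.comp_apply]
  rw [clm_apply_eq_sum T (T' _)]
  simp [mul_comm]

theorem matrixOf_id : matrixOf (ContinuousLinearMap.id ℝ (EuclideanSpace ℝ (Fin n))) = 1 := by
  ext i j
  simp [matrixOf, Matrix.one_apply]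

theorem clm_single_eq_sum {W : Type*} [NormedAddCommGroup W] [NormedSpace ℝ W]
    (S : EuclideanSpace ℝ (Fin n) →L[ℝ] W)
    (T : EuclideanSpace ℝ (Fin n) →L[ℝ] EuclideanSpace ℝ (Fin n)) (j : Fin n) :
    S (T (EuclideanSpace.single j 1)) = ∑ i, matrixOf T i j • S (EuclideanSpace.single i 1) :=
  clm_apply_eq_sum S _

theorem gramOf_comp (T : EuclideanSpace ℝ (Fin n) →L[ℝ] EuclideanSpace ℝ (Fin n)) :
    gramOf (L.comp T) = (matrixOf T).transpose * gramOf L * matrixOf T := by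
  ext i j
  simp only [gramOf_apply, ContinuousLinearMap.comp_apply, clm_single_eq_sum L T,
    Matrix.mul_apply, Matrix.transpose_apply, sum_inner, inner_sum, inner_smul_left,
    inner_smul_right, conj_trivial, Finset.sum_mul]
  refine Finset.sum_congr rfl fun k _ => ?_
  rw [Finset.mul_sum]
  exact Finset.sum_congr rfl fun l _ => by rw [real_inner_comm]; ring

theorem sum_gramOf_inv_comp {W : Type*} [NormedAddCommGroup W] [NormedSpace ℝ W]
    {T T' : EuclideanSpace ℝ (Fin n) →L[ℝ] EuclideanSpace ℝ (Fin n)}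
    (hT : T.comp T' = ContinuousLinearMap.id ℝ _)
    (B : EuclideanSpace ℝ (Fin n) →L[ℝ] EuclideanSpace ℝ (Fin n) →L[ℝ] W) :
    ∑ i, ∑ j, (gramOf (L.comp T))⁻¹ i j •
        B (T (EuclideanSpace.single i 1)) (T (EuclideanSpace.single j 1)) =
      ∑ i, ∑ j, (gramOf L)⁻¹ i j • B (EuclideanSpace.single i 1) (EuclideanSpace.single j 1) := by
  have hm : matrixOf T * matrixOf T' = 1 := by rw [← matrixOf_mul, hT, matrixOf_id]
  have hinv : (matrixOf T)⁻¹ = matrixOf T' := Matrix.inv_eq_right_inv hm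
  have hg : matrixOf T * (gramOf (L.comp T))⁻¹ * (matrixOf T).transpose = (gramOf L)⁻¹ := by
    rw [gramOf_comp, Matrix.mul_inv_rev, Matrix.mul_inv_rev, hinv, ← Matrix.mul_assoc,
      ← Matrix.mul_assoc, hm, Matrix.one_mul, Matrix.mul_assoc, ← Matrix.transpose_nonsing_inv,
      hinv, ← Matrix.transpose_mul, hm, Matrix.transpose_one, Matrix.mul_one]
  have hB : ∀ i j, B (T (EuclideanSpace.single i 1)) (T (EuclideanSpace.single j 1)) =
      ∑ k, ∑ l, (matrixOf T k i * matrixOf T l j) •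
        B (EuclideanSpace.single k 1) (EuclideanSpace.single l 1) := by
    intro i j
    rw [clm_single_eq_sum B T i]
    simp only [sum_apply, smul_apply,
      clm_single_eq_sum _ T j, Finset.smul_sum, smul_smul]
    rw [Finset.sum_comm]
    refine Finset.sum_congr rfl fun k _ => Finset.sum_congr rfl fun l _ => ?_
    rw [mul_comm]
  rw [← hg]
  simp only [hB, Matrix.mul_apply, Matrix.transpose_apply, Finset.smul_sum, Finset.sum_smul,
    Finset.sum_mul, smul_smul]
  have e1 : ∀ f : Fin n → Fin n → Fin n → Fin n → W,
      ∑ i, ∑ j, ∑ k, ∑ l, f i j k l = ∑ k, ∑ l, ∑ j, ∑ i, f i j k l := by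
    intro f
    rw [Finset.sum_congr rfl fun i _ => Finset.sum_comm, Finset.sum_comm]
    refine Finset.sum_congr rfl fun k _ => ?_
    rw [Finset.sum_congr rfl fun i _ => Finset.sum_comm, Finset.sum_comm]
    exact Finset.sum_congr rfl fun l _ => Finset.sum_comm
  rw [e1]
  refine Finset.sum_congr rfl fun k _ => Finset.sum_congr rfl fun l _ =>
    Finset.sum_congr rfl fun j _ => Finset.sum_congr rfl fun i _ => ?_
  congr 1
  ring

theorem starProjection_range_orthogonal (hL : Function.Injective L) (v : V) :
    ((LinearMap.range L.toLinearMap)ᗮ).starProjection v =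
      v - gradientOf L ((innerSL ℝ v).comp L) := by
  rw [Submodule.starProjection_orthogonal_val]
  congr 1
  refine Submodule.eq_starProjection_of_mem_of_inner_eq_zero (gradientOf_mem_range _ _) ?_
  rintro _ ⟨w, rfl⟩
  rw [inner_sub_left, ContinuousLinearMap.coe_coe, inner_gradientOf hL]
  simp

theorem meanCurvatureOf_eq (B : EuclideanSpace ℝ (Fin n) →L[ℝ] EuclideanSpace ℝ (Fin n) →L[ℝ] V) :
    meanCurvatureOf L B = (n : ℝ)⁻¹ • ((LinearMap.range L.toLinearMap)ᗮ).starProjection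
      (∑ i : Fin n, ∑ j : Fin n, (gramOf L)⁻¹ i j •
        B (EuclideanSpace.single i 1) (EuclideanSpace.single j 1)) := by
  simp only [meanCurvatureOf, map_sum, map_smul]

theorem inner_meanCurvatureOf
    (B : EuclideanSpace ℝ (Fin n) →L[ℝ] EuclideanSpace ℝ (Fin n) →L[ℝ] V) {v : V}
    (hv : v ∈ LinearMap.range L.toLinearMap) : inner ℝ v (meanCurvatureOf L B) = 0 := by
  rw [meanCurvatureOf_eq, inner_smul_right,
    (Submodule.mem_orthogonal _ _).1 (Submodule.starProjection_apply_mem _ _) v hv, mul_zero]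

/-- The mean curvature vector does not depend on the choice of coordinates. -/
theorem meanCurvatureOf_comp {T T' : EuclideanSpace ℝ (Fin n) →L[ℝ] EuclideanSpace ℝ (Fin n)}
    (hT : T.comp T' = ContinuousLinearMap.id ℝ _)
    {B B' : EuclideanSpace ℝ (Fin n) →L[ℝ] EuclideanSpace ℝ (Fin n) →L[ℝ] V}
    (hB : ∀ v w, B' v w - B (T v) (T w) ∈ LinearMap.range L.toLinearMap) :
    meanCurvatureOf (L.comp T) B' = meanCurvatureOf L B := by
  have hr : LinearMap.range (L.comp T).toLinearMap = LinearMap.range L.toLinearMap := by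
    apply le_antisymm
    · rintro _ ⟨w, rfl⟩; exact ⟨T w, rfl⟩
    · rintro _ ⟨w, rfl⟩
      refine ⟨T' w, ?_⟩
      exact congrArg L (DFunLike.congr_fun hT w)
  rw [meanCurvatureOf_eq, meanCurvatureOf_eq, ← sum_gramOf_inv_comp (L := L) hT B]
  congr 1
  simp only [map_sum, map_smul, hr]
  refine Finset.sum_congr rfl fun i _ => Finset.sum_congr rfl fun j _ => ?_
  congr 1
  rw [← sub_eq_zero, ← map_sub]
  exact (Submodule.starProjection_apply_eq_zero_iff _).2
    (Submodule.le_orthogonal_orthogonal _ (hB _ _))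

/-- The vectors `W i = √g ∑ gⁱʲ L eⱼ`. -/
def coWeighted (L : EuclideanSpace ℝ (Fin n) →L[ℝ] V) (i : Fin n) : V :=
  √(gramOf L).det • ∑ j, (gramOf L)⁻¹ i j • L (EuclideanSpace.single j 1)

theorem coWeighted_mem_range (i : Fin n) : coWeighted L i ∈ LinearMap.range L.toLinearMap :=
  Submodule.smul_mem _ _ (Submodule.sum_mem _ fun _ _ => Submodule.smul_mem _ _ ⟨_, rfl⟩)

theorem inner_coWeighted (hL : Function.Injective L) (i l : Fin n) :
    inner ℝ (coWeighted L i) (L (EuclideanSpace.single l 1)) =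
      if i = l then √(gramOf L).det else 0 := by
  simp only [coWeighted, inner_smul_left, sum_inner, conj_trivial, ← gramOf_apply,
    sum_gramOf_inv_mul hL]
  simp

section Boundary

variable [NeZero n]

theorem face_single (i : {i : Fin n // i ≠ 0}) :
    face n (EuclideanSpace.single i 1) = EuclideanSpace.single (i : Fin n) 1 := by
  ext j
  by_cases h : j = 0
  · have := i.2
    simp [face, h, Ne.symm this]
  · simp [face, h, Subtype.ext_iff]

theorem normDet_face_sq (hL : Function.Injective L) :
    (L.comp (face n)).toLinearMap.normDet ^ 2 = (gramOf L).det * (gramOf L)⁻¹ 0 0 := by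
  obtain ⟨m, rfl⟩ : ∃ m, n = m + 1 := Nat.exists_eq_succ_of_ne_zero (NeZero.ne n)
  have h := (L.comp (face (m + 1))).toLinearMap.normDet_sq_eq_det_gram
    (EuclideanSpace.basisFun {i : Fin (m + 1) // i ≠ 0} ℝ)
  have h1 : (L.comp (face (m + 1))).toLinearMap.normDet ^ 2 =
      ((gramOf L).submatrix (fun i : {i : Fin (m + 1) // i ≠ 0} => (i : Fin (m + 1)))
        (fun i : {i : Fin (m + 1) // i ≠ 0} => (i : Fin (m + 1)))).det := by
    rw [RCLike.ofReal_real_eq_id, id] at h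
    rw [h]
    congr 1
    ext i j
    simp [Matrix.gram_apply, gramOf_apply, face_single]
  rw [h1, Matrix.inv_def, Matrix.smul_apply, Matrix.adjugate_fin_succ_eq_det_submatrix,
    Ring.inverse_eq_inv', smul_eq_mul, mul_inv_cancel_left₀ (gramOf_det_pos hL).ne',
    ← Matrix.det_submatrix_equiv_self (finSuccAboveEquiv (0 : Fin (m + 1)))]
  simp only [Fin.val_zero, add_zero, pow_zero, one_mul, Matrix.submatrix_submatrix]
  rfl

/-- If `P` is a unit vector tangent to `M`, orthogonal to the boundary hyperplane and pointing
outwards, then the conormal `W 0` is `-P` times the volume density of the boundary. -/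
theorem coWeighted_zero_eq (hL : Function.Injective L) {P : V}
    (hP : P ∈ LinearMap.range L.toLinearMap) (hP1 : ‖P‖ = 1)
    (horth : ∀ i : Fin n, i ≠ 0 → inner ℝ P (L (EuclideanSpace.single i 1)) = 0)
    (hneg : inner ℝ P (L (EuclideanSpace.single 0 1)) ≤ 0) :
    coWeighted L 0 = -((L.comp (face n)).toLinearMap.normDet • P) := by
  set β := inner ℝ P (L (EuclideanSpace.single 0 1)) with hβ
  set w0 := √(gramOf L).det with hw
  set d := (L.comp (face n)).toLinearMap.normDet with hd
  have hwpos : 0 < w0 := Real.sqrt_pos.2 (gramOf_det_pos hL)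
  have hwsq : w0 ^ 2 = (gramOf L).det := Real.sq_sqrt (gramOf_det_pos hL).le
  have h1 : w0 • P = β • coWeighted L 0 := by
    refine eq_of_mem_range_of_inner_eq (Submodule.smul_mem _ _ hP)
      (Submodule.smul_mem _ _ (coWeighted_mem_range 0)) fun i => ?_
    rw [inner_smul_left, inner_smul_left, inner_coWeighted hL]
    by_cases h : i = 0
    · subst h; simp [hβ, hw]; ring
    · simp [horth i h, Ne.symm h]
  have h2 : ‖coWeighted L 0‖ = d := by
    have : ‖coWeighted L 0‖ ^ 2 = d ^ 2 := by
      rw [normDet_face_sq hL, ← hwsq, ← real_inner_self_eq_norm_sq]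
      have expand : ∀ v, inner ℝ (coWeighted L 0) v =
          w0 * ∑ j, (gramOf L)⁻¹ 0 j * inner ℝ (L (EuclideanSpace.single j 1)) v := fun v => by
        simp only [coWeighted, inner_smul_left, sum_inner, conj_trivial, hw]
      rw [expand]
      simp only [real_inner_comm (coWeighted L 0), inner_coWeighted hL]
      simp
      ring
    exact (sq_eq_sq₀ (norm_nonneg _) (LinearMap.normDet_nonneg _)).1 this
  have h3 : w0 = -β * d := by
    have := congrArg norm h1
    rw [norm_smul, norm_smul, hP1, h2, Real.norm_of_nonneg hwpos.le, Real.norm_of_nonpos hneg]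
      at this
    linarith
  have hβ0 : β ≠ 0 := by rintro h; rw [h] at h3; simp at h3; exact hwpos.ne' h3
  rw [h3, mul_comm, mul_smul] at h1
  have h4 : β • coWeighted L 0 = β • (-(d • P)) := by
    rw [← h1]; module
  exact smul_right_injective _ hβ0 h4

end Boundary

end LinearAlgebra

/-! ### Smoothness of the metric, and the divergence of the conormal fields -/

section Calculus

open Matrix in
theorem hasFDerivAt_det {n : ℕ} {E : Type*} [NormedAddCommGroup E] [NormedSpace ℝ E]
    {A : E → Matrix (Fin n) (Fin n) ℝ} {A' : Fin n → Fin n → E →L[ℝ] ℝ} {y : E}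
    (hA : ∀ i j, HasFDerivAt (fun z => A z i j) (A' i j) y) :
    HasFDerivAt (fun z => (A z).det) (∑ i, ∑ j, (A y).adjugate j i • A' i j) y := by
  let D : ContinuousMultilinearMap ℝ (fun _ : Fin n => Fin n → ℝ) ℝ :=
    { (Matrix.detRowAlternating (R := ℝ) (n := Fin n)).toMultilinearMap with
      cont := Continuous.matrix_det continuous_id }
  have hrow : ∀ i, HasFDerivAt (fun z => A z i) (ContinuousLinearMap.pi fun j => A' i j) y :=
    fun i => hasFDerivAt_pi.2 fun j => hA i j
  have h := HasFDerivAt.multilinear_comp D hrow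
  refine h.congr_fderiv ?_
  ext v
  simp only [_root_.sum_apply, ContinuousLinearMap.comp_apply, _root_.smul_apply, smul_eq_mul]
  refine Finset.sum_congr rfl fun i _ => ?_
  have e : D.toContinuousLinearMap (fun j => A y j) i ((ContinuousLinearMap.pi fun j => A' i j) v) =
      ((A y).updateRow i fun j => A' i j v).det := rfl
  rw [e, ← cramer_transpose_apply, cramer_eq_adjugate_mulVec, ← adjugate_transpose]
  simp [mulVec, dotProduct]

variable {n : ℕ} {V : Type*} [NormedAddCommGroup V] [InnerProductSpace ℝ V]
  {E : Type*} [NormedAddCommGroup E] [NormedSpace ℝ E]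
  {L : E → EuclideanSpace ℝ (Fin n) →L[ℝ] V} {S : Set E} {y : E} {m : WithTop ℕ∞}

theorem contDiffWithinAt_gramOf (hL : ContDiffWithinAt ℝ m L S y) (i j : Fin n) :
    ContDiffWithinAt ℝ m (fun z => gramOf (L z) i j) S y :=
  (hL.clm_apply contDiffWithinAt_const).inner ℝ (hL.clm_apply contDiffWithinAt_const)

theorem contDiffWithinAt_det {A : E → Matrix (Fin n) (Fin n) ℝ}
    (hA : ∀ i j, ContDiffWithinAt ℝ m (fun z => A z i j) S y) :
    ContDiffWithinAt ℝ m (fun z => (A z).det) S y := by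
  simp only [Matrix.det_apply]
  exact ContDiffWithinAt.sum fun σ _ => (contDiffWithinAt_prod fun i _ => hA _ _).const_smul _

theorem contDiffWithinAt_gramOf_det (hL : ContDiffWithinAt ℝ m L S y) :
    ContDiffWithinAt ℝ m (fun z => (gramOf (L z)).det) S y :=
  contDiffWithinAt_det fun i j => contDiffWithinAt_gramOf hL i j

theorem contDiffWithinAt_gramOf_inv (hL : ContDiffWithinAt ℝ m L S y)
    (hinj : Function.Injective (L y)) (i j : Fin n) :
    ContDiffWithinAt ℝ m (fun z => (gramOf (L z))⁻¹ i j) S y := by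
  simp only [Matrix.inv_def, Matrix.smul_apply, Ring.inverse_eq_inv', smul_eq_mul,
    Matrix.adjugate_apply]
  refine ((contDiffWithinAt_gramOf_det hL).inv (gramOf_det_pos hinj).ne').mul
    (contDiffWithinAt_det fun k l => ?_)
  by_cases hk : k = j
  · subst hk; simpa using contDiffWithinAt_const
  · simpa [Matrix.updateRow_ne hk] using contDiffWithinAt_gramOf hL k l

theorem contDiffWithinAt_sqrt_gramOf_det (hL : ContDiffWithinAt ℝ m L S y)
    (hinj : Function.Injective (L y)) :
    ContDiffWithinAt ℝ m (fun z => √(gramOf (L z)).det) S y :=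
  (contDiffWithinAt_gramOf_det hL).sqrt (gramOf_det_pos hinj).ne'

theorem contDiffWithinAt_coWeighted (hL : ContDiffWithinAt ℝ m L S y)
    (hinj : Function.Injective (L y)) (i : Fin n) :
    ContDiffWithinAt ℝ m (fun z => coWeighted (L z) i) S y :=
  (contDiffWithinAt_sqrt_gramOf_det hL hinj).smul <| ContDiffWithinAt.sum fun j _ =>
    (contDiffWithinAt_gramOf_inv hL hinj i j).smul (hL.clm_apply contDiffWithinAt_const)

theorem contDiffWithinAt_gradientOf {a : E → EuclideanSpace ℝ (Fin n) →L[ℝ] ℝ}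
    (hL : ContDiffWithinAt ℝ m L S y) (hinj : Function.Injective (L y))
    (ha : ContDiffWithinAt ℝ m a S y) :
    ContDiffWithinAt ℝ m (fun z => gradientOf (L z) (a z)) S y :=
  ContDiffWithinAt.sum fun i _ => ContDiffWithinAt.sum fun j _ =>
    ((contDiffWithinAt_gramOf_inv hL hinj i j).mul (ha.clm_apply contDiffWithinAt_const)).smul
      (hL.clm_apply contDiffWithinAt_const)

omit [NormedSpace ℝ E] in
theorem eventually_injective (hL : ContinuousWithinAt L S y) (hinj : Function.Injective (L y)) :
    ∀ᶠ z in 𝓝[S] y, Function.Injective (L z) := by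
  have h0 : ContinuousWithinAt (fun z => (gramOf (L z)).det) S y :=
    (contDiffWithinAt_gramOf_det (m := 0) (L := fun T => T) (S := univ)
      contDiffWithinAt_id).continuousWithinAt.continuousAt univ_mem
      |>.comp_continuousWithinAt (f := L) hL
  filter_upwards [h0.eventually_ne (gramOf_det_pos hinj).ne'] with z hz
  have hli := Matrix.linearIndependent_of_det_gram_ne_zero hz
  rw [injective_iff_map_eq_zero]
  intro v hv
  rw [clm_apply_eq_sum] at hv
  ext i
  exact Fintype.linearIndependent_iff.1 hli _ hv i

theorem contDiffWithinAt_meanCurvatureOf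
    {B : E → EuclideanSpace ℝ (Fin n) →L[ℝ] EuclideanSpace ℝ (Fin n) →L[ℝ] V}
    (hL : ContDiffWithinAt ℝ m L S y) (hinj : Function.Injective (L y)) (hyS : y ∈ S)
    (hB : ContDiffWithinAt ℝ m B S y) :
    ContDiffWithinAt ℝ m (fun z => meanCurvatureOf (L z) (B z)) S y := by
  have h : ContDiffWithinAt ℝ m (fun z => (n : ℝ)⁻¹ • ∑ i : Fin n, ∑ j : Fin n,
      (gramOf (L z))⁻¹ i j •
        (B z (EuclideanSpace.single i 1) (EuclideanSpace.single j 1) - gradientOf (L z)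
          ((innerSL ℝ (B z (EuclideanSpace.single i 1) (EuclideanSpace.single j 1))).comp (L z))))
      S y := by
    refine (ContDiffWithinAt.sum fun i _ => ContDiffWithinAt.sum fun j _ =>
      (contDiffWithinAt_gramOf_inv hL hinj i j).smul ?_).const_smul _
    have hb : ContDiffWithinAt ℝ m
        (fun z => B z (EuclideanSpace.single i 1) (EuclideanSpace.single j 1)) S y :=
      (hB.clm_apply contDiffWithinAt_const).clm_apply contDiffWithinAt_const
    exact hb.sub (contDiffWithinAt_gradientOf hL hinj
      (((innerSL ℝ (E := V)).contDiff.comp_contDiffWithinAt hb).clm_comp hL))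
  refine h.congr_of_eventuallyEq_of_mem ?_ hyS
  filter_upwards [eventually_injective hL.continuousWithinAt hinj] with z hz
  simp only [meanCurvatureOf, starProjection_range_orthogonal hz]

end Calculus

section Divergence

variable {n : ℕ} {V : Type*} [NormedAddCommGroup V] [InnerProductSpace ℝ V]
  {L : EuclideanSpace ℝ (Fin n) → EuclideanSpace ℝ (Fin n) →L[ℝ] V} {y : EuclideanSpace ℝ (Fin n)}

theorem fderiv_sqrt_gramOf_det (hL : DifferentiableAt ℝ L y) (hinj : Function.Injective (L y))
    (v : EuclideanSpace ℝ (Fin n)) :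
    fderiv ℝ (fun z => √(gramOf (L z)).det) y v = √(gramOf (L y)).det *
      ∑ i, ∑ j, (gramOf (L y))⁻¹ i j * inner ℝ (L y (EuclideanSpace.single j 1))
        (fderiv ℝ L y v (EuclideanSpace.single i 1)) := by
  have hLe : ∀ i : Fin n, HasFDerivAt (fun z => L z (EuclideanSpace.single i 1))
      ((fderiv ℝ L y).flip (EuclideanSpace.single i 1)) y := fun i =>
    (hL.hasFDerivAt.clm_apply (hasFDerivAt_const _ _)).congr_fderiv (by ext; simp)
  have hg : ∀ i j, HasFDerivAt (fun z => gramOf (L z) i j) _ y := fun i j =>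
    (hLe i).inner ℝ (hLe j)
  have hpos := gramOf_det_pos hinj
  have hw := ((hasFDerivAt_det hg).sqrt hpos.ne').fderiv
  rw [hw]
  have hadj : (gramOf (L y)).adjugate = (gramOf (L y)).det • (gramOf (L y))⁻¹ := by
    rw [Matrix.inv_def, smul_smul, Ring.inverse_eq_inv', mul_inv_cancel₀ hpos.ne', one_smul]
  simp only [hadj, Matrix.smul_apply, smul_apply, sum_apply, ContinuousLinearMap.comp_apply,
    smul_eq_mul, ContinuousLinearMap.prod_apply, fderivInnerCLM_apply,
    ContinuousLinearMap.flip_apply, mul_add, Finset.sum_add_distrib]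
  set w := √(gramOf (L y)).det with hwdef
  have hw2 : (gramOf (L y)).det = w * w := (Real.mul_self_sqrt hpos.le).symm
  have hw0 : w ≠ 0 := (Real.sqrt_pos.2 hpos).ne'
  set Q := ∑ i, ∑ j, (gramOf (L y))⁻¹ i j * inner ℝ (L y (EuclideanSpace.single j 1))
        (fderiv ℝ L y v (EuclideanSpace.single i 1)) with hQ
  have e1 : ∑ i, ∑ j, (gramOf (L y)).det * (gramOf (L y))⁻¹ j i *
      inner ℝ (L y (EuclideanSpace.single i 1)) (fderiv ℝ L y v (EuclideanSpace.single j 1)) =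
      w * w * Q := by
    rw [hQ, Finset.sum_comm, hw2]
    simp only [Finset.mul_sum, mul_assoc]
  have e2 : ∑ i, ∑ j, (gramOf (L y)).det * (gramOf (L y))⁻¹ j i *
      inner ℝ (fderiv ℝ L y v (EuclideanSpace.single i 1)) (L y (EuclideanSpace.single j 1)) =
      w * w * Q := by
    rw [hQ, hw2]
    simp only [Finset.mul_sum, mul_assoc, gramOf_inv_symm (L y)]
    refine Finset.sum_congr rfl fun i _ => Finset.sum_congr rfl fun j _ => ?_
    rw [real_inner_comm, gramOf_inv_symm]
  rw [e1, e2]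
  field_simp
  ring

theorem differentiableAt_of_contDiffWithinAt {E W : Type*} [NormedAddCommGroup E] [NormedSpace ℝ E]
    [NormedAddCommGroup W] [NormedSpace ℝ W] {f : E → W} {y : E}
    (h : ContDiffWithinAt ℝ 1 f univ y) : DifferentiableAt ℝ f y :=
  (contDiffWithinAt_univ.1 h).differentiableAt one_ne_zero

/-- `∑ ∂ᵢ(√g gⁱʲ ∂ⱼG) = √g n H` for a parametrization `G` with differential `L`. -/
theorem sum_fderiv_coWeighted (hL : ContDiffAt ℝ 1 L y) (hinj : Function.Injective (L y))
    (hsymm : ∀ v w, fderiv ℝ L y v w = fderiv ℝ L y w v) :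
    ∑ i, fderiv ℝ (fun z => coWeighted (L z) i) y (EuclideanSpace.single i 1) =
      (√(gramOf (L y)).det * n) • meanCurvatureOf (L y) (fderiv ℝ L y) := by
  have hd : DifferentiableAt ℝ L y := hL.differentiableAt one_ne_zero
  have hcd : ContDiffWithinAt ℝ 1 L univ y := hL
  have hLe : ∀ i : Fin n, HasFDerivAt (fun z => L z (EuclideanSpace.single i 1))
      ((fderiv ℝ L y).flip (EuclideanSpace.single i 1)) y := fun i =>
    (hd.hasFDerivAt.clm_apply (hasFDerivAt_const _ _)).congr_fderiv (by ext; simp)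
  have hW : ∀ i, DifferentiableAt ℝ (fun z => coWeighted (L z) i) y := fun i =>
    differentiableAt_of_contDiffWithinAt (contDiffWithinAt_coWeighted hcd hinj i)
  set w := √(gramOf (L y)).det with hw
  set R := ∑ i, fderiv ℝ (fun z => coWeighted (L z) i) y (EuclideanSpace.single i 1) with hR
  have hev : ∀ᶠ z in 𝓝 y, Function.Injective (L z) := by
    simpa using eventually_injective hcd.continuousWithinAt hinj
  -- the tangential part of the divergence vanishes
  have htan : ∀ l, inner ℝ R (L y (EuclideanSpace.single l 1)) = 0 := by
    intro l
    have hi : ∀ i, inner ℝ (fderiv ℝ (fun z => coWeighted (L z) i) y (EuclideanSpace.single i 1))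
        (L y (EuclideanSpace.single l 1)) =
        (if i = l then fderiv ℝ (fun z => √(gramOf (L z)).det) y (EuclideanSpace.single l 1) else 0)
        - inner ℝ (coWeighted (L y) i)
          (fderiv ℝ L y (EuclideanSpace.single l 1) (EuclideanSpace.single i 1)) := by
      intro i
      have h1 := ((hW i).hasFDerivAt.inner ℝ (hLe l)).fderiv
      have h2 : (fun z => inner ℝ (coWeighted (L z) i) (L z (EuclideanSpace.single l 1))) =ᶠ[𝓝 y]
          fun z => if i = l then √(gramOf (L z)).det else 0 := by
        filter_upwards [hev] with z hz using inner_coWeighted hz i l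
      rw [h2.fderiv_eq] at h1
      have h3 := DFunLike.congr_fun h1 (EuclideanSpace.single i 1)
      simp only [ContinuousLinearMap.comp_apply, ContinuousLinearMap.prod_apply,
        fderivInnerCLM_apply, ContinuousLinearMap.flip_apply] at h3
      rw [hsymm (EuclideanSpace.single l 1)]
      by_cases hil : i = l
      · subst hil; simp only [if_true] at h3 ⊢; linarith
      · simp only [hil, if_false] at h3 ⊢
        simp at h3; linarith
    rw [hR, sum_inner, Finset.sum_congr rfl fun i _ => hi i, Finset.sum_sub_distrib]
    simp only [Finset.sum_ite_eq', Finset.mem_univ, if_true]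
    rw [fderiv_sqrt_gramOf_det hd hinj, sub_eq_zero, Finset.mul_sum]
    refine Finset.sum_congr rfl fun i _ => ?_
    simp only [coWeighted, inner_smul_left, sum_inner, conj_trivial]
  -- its normal part comes from the second derivatives only
  have hWi : ∀ i, ∃ t ∈ LinearMap.range (L y).toLinearMap,
      fderiv ℝ (fun z => coWeighted (L z) i) y (EuclideanSpace.single i 1) = t +
        w • ∑ j, (gramOf (L y))⁻¹ i j •
          fderiv ℝ L y (EuclideanSpace.single i 1) (EuclideanSpace.single j 1) := by
    intro i
    have hs : HasFDerivAt (fun z => ∑ j, (gramOf (L z))⁻¹ i j • L z (EuclideanSpace.single j 1))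
        _ y := HasFDerivAt.fun_sum fun j _ =>
      (differentiableAt_of_contDiffWithinAt
        (contDiffWithinAt_gramOf_inv hcd hinj i j)).hasFDerivAt.smul (hLe j)
    have ht := ((differentiableAt_of_contDiffWithinAt
      (contDiffWithinAt_sqrt_gramOf_det hcd hinj)).hasFDerivAt.smul hs).fderiv
    refine ⟨fderiv ℝ (fun z => coWeighted (L z) i) y (EuclideanSpace.single i 1) - w • ∑ j,
      (gramOf (L y))⁻¹ i j • fderiv ℝ L y (EuclideanSpace.single i 1) (EuclideanSpace.single j 1),
      ?_, by abel⟩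
    have hrange : ∀ v, L y v ∈ LinearMap.range (L y).toLinearMap := fun v => ⟨v, rfl⟩
    simp only [coWeighted]
    change fderiv ℝ ((fun z => √(gramOf (L z)).det) • fun z =>
      ∑ j, (gramOf (L z))⁻¹ i j • L z (EuclideanSpace.single j 1)) y _ - _ ∈ _
    rw [ht]
    simp only [add_apply, smul_apply, sum_apply, ContinuousLinearMap.smulRight_apply,
      ContinuousLinearMap.flip_apply, Finset.sum_add_distrib, smul_add]
    rw [← hw, add_assoc, add_sub_cancel_left]
    exact Submodule.add_mem _
      (Submodule.smul_mem _ _ (Submodule.sum_mem _ fun _ _ => Submodule.smul_mem _ _ (hrange _)))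
      (Submodule.smul_mem _ _ (Submodule.sum_mem _ fun _ _ => Submodule.smul_mem _ _ (hrange _)))
  choose t ht hWt using hWi
  have hperp : ((LinearMap.range (L y).toLinearMap)ᗮ).starProjection R = R := by
    apply Submodule.starProjection_eq_self_iff.2
    rw [Submodule.mem_orthogonal']
    rintro _ ⟨v, rfl⟩
    rw [ContinuousLinearMap.coe_coe, clm_apply_eq_sum, inner_sum]
    simp [inner_smul_right, htan]
  have hn : (n : ℝ) * (n : ℝ)⁻¹ = 1 ∨ n = 0 := by
    rcases eq_or_ne n 0 with h | h
    · exact Or.inr h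
    · exact Or.inl (mul_inv_cancel₀ (by exact_mod_cast h))
  rcases hn with hn | rfl
  · rw [← hperp, meanCurvatureOf_eq, smul_smul, mul_assoc, hn, mul_one, hR,
      Finset.sum_congr rfl fun i _ => hWt i, Finset.sum_add_distrib, map_add,
      (Submodule.starProjection_apply_eq_zero_iff _).2
        (Submodule.le_orthogonal_orthogonal _ (Submodule.sum_mem _ fun i _ => ht i)), zero_add,
      ← Finset.smul_sum, map_smul]
  · simp [hR]

end Divergence

/-! ### The divergence theorem in the half-space -/

section HalfSpace

variable {n : ℕ} [NeZero n]

theorem mem_range_model {y : EuclideanSpace ℝ (Fin n)} : y ∈ range (𝓡∂ n) ↔ 0 ≤ y 0 := by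
  rw [range_modelWithCornersEuclideanHalfSpace]; rfl

theorem isClosed_range_model : IsClosed (range (𝓡∂ n)) := (𝓡∂ n).isClosed_range

theorem face_apply_zero (z : EuclideanSpace ℝ {i : Fin n // i ≠ 0}) : face n z 0 = 0 := by
  simp [face]

theorem face_apply_of_ne (z : EuclideanSpace ℝ {i : Fin n // i ≠ 0}) (i : {i : Fin n // i ≠ 0}) :
    face n z i = z i := by
  have := i.2
  simp [face, this]

theorem integral_comp_face {m : ℕ} (h : EuclideanSpace ℝ (Fin (m + 1)) → ℝ) :
    ∫ z, h (face (m + 1) z) = ∫ x : Fin m → ℝ, h (WithLp.toLp 2 (Fin.cons 0 x)) := by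
  let e : {i : Fin (m + 1) // i ≠ 0} ≃ Fin m := (finSuccAboveEquiv (0 : Fin (m + 1))).symm
  have h1 := EuclideanSpace.volume_preserving_symm_measurableEquiv_toLp
    {i : Fin (m + 1) // i ≠ 0}
  have h2 := volume_measurePreserving_piCongrLeft (fun _ : Fin m => ℝ) e
  rw [← (h2.comp h1).integral_comp
    ((MeasurableEquiv.measurableEmbedding _).comp (MeasurableEquiv.measurableEmbedding _))]
  refine integral_congr_ae (Eventually.of_forall fun z => ?_)
  simp only
  congr 1
  ext j
  refine Fin.cases ?_ (fun j => ?_) j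
  · rw [face_apply_zero]; rfl
  · have h3 := face_apply_of_ne z ⟨j.succ, Fin.succ_ne_zero j⟩
    simp only at h3
    rw [h3]
    simp only [Function.comp_apply, Fin.cons_succ]
    have : j = e ⟨j.succ, Fin.succ_ne_zero j⟩ := by
      rw [Equiv.eq_symm_apply]; rfl
    conv_rhs => rw [this]
    exact (Equiv.piCongrLeft_apply_apply (fun _ : Fin m => ℝ) e z.ofLp _).symm

theorem fderiv_eq_zero_of_notMem {E : Type*} [NormedAddCommGroup E] [NormedSpace ℝ E]
    {f : E → ℝ} {K : Set E} (hK : IsClosed K) (hf : ∀ y, y ∉ K → f y = 0) {y : E} (hy : y ∉ K) :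
    fderiv ℝ f y = 0 := by
  have : f =ᶠ[𝓝 y] fun _ => 0 := by
    filter_upwards [hK.isOpen_compl.mem_nhds hy] with z hz using hf z hz
  rw [this.fderiv_eq]; simp

theorem interior_range_model_subset {y : EuclideanSpace ℝ (Fin n)} (hy : 0 < y 0) :
    y ∈ interior (range (𝓡∂ n)) := by
  refine mem_interior.2 ⟨{y | 0 < y 0}, fun z hz => mem_range_model.2 (le_of_lt hz), ?_, hy⟩
  exact isOpen_lt continuous_const (by fun_prop)

theorem integral_halfSpace_divergence {f : Fin n → EuclideanSpace ℝ (Fin n) → ℝ}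
    {K : Set (EuclideanSpace ℝ (Fin n))} (hK : IsCompact K)
    (hcont : ∀ i, ContinuousOn (f i) (range (𝓡∂ n)))
    (hdiff : ∀ i, ∀ y ∈ interior (range (𝓡∂ n)), DifferentiableAt ℝ (f i) y)
    (hsupp : ∀ i y, y ∉ K → f i y = 0)
    (hint : IntegrableOn (fun y => ∑ i, fderiv ℝ (f i) y (EuclideanSpace.single i 1))
      (range (𝓡∂ n))) :
    ∫ y in range (𝓡∂ n), ∑ i, fderiv ℝ (f i) y (EuclideanSpace.single i 1) =
      -∫ z, f 0 (face n z) := by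
  obtain ⟨m, rfl⟩ : ∃ m, n = m + 1 := Nat.exists_eq_succ_of_ne_zero (NeZero.ne n)
  obtain ⟨R, hR0, hR⟩ : ∃ R : ℝ, 0 < R ∧ ∀ y ∈ K, ∀ i, |y i| < R := by
    obtain ⟨r, hr⟩ := hK.isBounded.exists_norm_le
    refine ⟨|r| + 1, by positivity, fun y hy i => ?_⟩
    have := (PiLp.norm_apply_le y i).trans ((hr y hy).trans (le_abs_self r))
    rw [Real.norm_eq_abs] at this
    linarith
  set T := (EuclideanSpace.equiv (Fin (m + 1)) ℝ).symm with hT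
  have hTapp : ∀ x, T x = WithLp.toLp 2 x := fun x => rfl
  set a : Fin (m + 1) → ℝ := Fin.cons 0 fun _ => -R with ha
  set b : Fin (m + 1) → ℝ := fun _ => R with hb
  set D : EuclideanSpace ℝ (Fin (m + 1)) → ℝ :=
    fun y => ∑ i, fderiv ℝ (f i) y (EuclideanSpace.single i 1) with hD
  have hab : a ≤ b := by
    intro i
    refine Fin.cases ?_ (fun j => ?_) i
    · simp [ha, hb, hR0.le]
    · simp only [ha, hb, Fin.cons_succ]; linarith
  have hmap : ∀ x ∈ Icc a b, T x ∈ range (𝓡∂ (m + 1)) := fun x hx =>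
    mem_range_model.2 (by have h := hx.1 0; rw [ha, Fin.cons_zero] at h; exact h)
  have hD0 : ∀ y, y ∉ K → D y = 0 := fun y hy => by
    refine Finset.sum_eq_zero fun i _ => ?_
    rw [fderiv_eq_zero_of_notMem hK.isClosed (hsupp i) hy]; rfl
  have hmp := EuclideanSpace.volume_preserving_symm_measurableEquiv_toLp (Fin (m + 1))
  have hemb := (MeasurableEquiv.toLp 2 (Fin (m + 1) → ℝ)).symm.measurableEmbedding
  have hsub : Icc a b ⊆ T ⁻¹' range (𝓡∂ (m + 1)) := hmap
  have hmp' := (EuclideanSpace.volume_preserving_symm_measurableEquiv_toLp (Fin (m + 1))).symm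
  have hemb' := (MeasurableEquiv.toLp 2 (Fin (m + 1) → ℝ)).measurableEmbedding
  have hTm : MeasurePreserving (T : (Fin (m + 1) → ℝ) → _) volume volume := hmp'
  have hTe : MeasurableEmbedding (T : (Fin (m + 1) → ℝ) → _) := hemb'
  have hbox := integral_divergence_of_hasFDerivAt_off_countable a b hab
    (fun x i => f i (T x))
    (fun x => ContinuousLinearMap.pi fun i => (fderiv ℝ (f i) (T x)).comp T.toContinuousLinearMap)
    ∅ countable_empty ?_ ?_ ?_
  rotate_left
  · exact continuousOn_pi.2 fun i => (hcont i).comp T.continuous.continuousOn hmap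
  · rintro x ⟨hx, -⟩
    refine hasFDerivAt_pi.2 fun i => ?_
    have hy : T x ∈ interior (range (𝓡∂ (m + 1))) :=
      interior_range_model_subset (by
        have h := (hx 0 trivial).1; rw [ha, Fin.cons_zero] at h; exact h)
    exact (hdiff i _ hy).hasFDerivAt.comp x T.hasFDerivAt
  · have := (hTm.integrableOn_comp_preimage hTe).2 hint
    exact this.mono_set hsub
  have hL : ∫ x in Icc a b, D (T x) = ∫ y in range (𝓡∂ (m + 1)), D y := by
    rw [← hTm.setIntegral_preimage_emb hTe]
    symm
    refine setIntegral_eq_of_subset_of_forall_sdiff_eq_zero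
      (T.continuous.measurable isClosed_range_model.measurableSet) hsub ?_
    rintro x ⟨hx1, hx2⟩
    refine hD0 _ fun hxK => hx2 ⟨fun i => ?_, fun i => ?_⟩
    · refine Fin.cases ?_ (fun j => ?_) i
      · rw [ha, Fin.cons_zero]; exact mem_range_model.1 hx1
      · exact (abs_lt.1 (hR _ hxK j.succ)).1.le
    · exact (abs_lt.1 (hR _ hxK i)).2.le
  have hz : ∀ (i : Fin (m + 1)) (c : ℝ), |c| = R → ∀ (x : Fin m → ℝ),
      f i (T (i.insertNth (α := fun _ => ℝ) c x)) = 0 := by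
    intro i c hc x
    refine hsupp _ _ fun hK' => ?_
    have := hR _ hK' i
    rw [hTapp] at this
    simp only [Fin.insertNth_apply_same] at this
    linarith
  have hLbox : ∫ x in Icc a b, D (T x) = -∫ z, f 0 (face (m + 1) z) := by
    refine (Eq.trans ?_ hbox).trans ?_
    · rfl
    · rw [Fin.sum_univ_succ]
      have h1 : ∀ j : Fin m, a j.succ = -R := fun j => by simp [ha]
      have hbR : ∀ j, b j = R := fun j => rfl
      simp only [hbR, hz _ R (abs_of_pos hR0), h1, hz _ (-R) (by rw [abs_neg, abs_of_pos hR0]),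
        integral_zero, sub_zero, zero_sub, Finset.sum_const_zero, add_zero]
      rw [integral_comp_face, setIntegral_eq_integral_of_forall_compl_eq_zero]
      · simp [ha, hTapp, Fin.insertNth_zero']
      · intro x hx
        refine hsupp _ _ fun hK' => hx ⟨fun i => ?_, fun i => ?_⟩
        · have := (abs_lt.1 (hR _ hK' i.succ)).1.le
          rw [hTapp] at this
          simpa [ha, Fin.insertNth_zero'] using this
        · have := (abs_lt.1 (hR _ hK' i.succ)).2.le
          rw [hTapp] at this
          simpa [hb, Fin.insertNth_zero'] using this
  rw [← hL, hLbox]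

end HalfSpace

/-! ### Coordinate expressions on a manifold with boundary -/

section Charts

variable {n : ℕ} [NeZero n] {M : Type*} [TopologicalSpace M]
  [ChartedSpace (EuclideanHalfSpace n) M] [IsManifold (𝓡∂ n) ∞ M]
  {W : Type*} [NormedAddCommGroup W] [NormedSpace ℝ W]

/-- The derivative of a function on `M` in the chart at `x`. -/
def chartDeriv (f : M → W) (x : M) (y : EuclideanSpace ℝ (Fin n)) :
    EuclideanSpace ℝ (Fin n) →L[ℝ] W :=
  fderivWithin ℝ (f ∘ (extChartAt (𝓡∂ n) x).symm) (range (𝓡∂ n)) y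

/-- The coordinate change from the chart at `x'` to the chart at `x`. -/
def coordChange (x' x : M) : EuclideanSpace ℝ (Fin n) → EuclideanSpace ℝ (Fin n) :=
  extChartAt (𝓡∂ n) x ∘ (extChartAt (𝓡∂ n) x').symm

/-- The derivative of `coordChange`. -/
def coordChangeDeriv (x' x : M) (y : EuclideanSpace ℝ (Fin n)) :
    EuclideanSpace ℝ (Fin n) →L[ℝ] EuclideanSpace ℝ (Fin n) :=
  fderivWithin ℝ (coordChange x' x) (range (𝓡∂ n)) y

theorem contDiffWithinAt_chart {f : M → W} (hf : ContMDiff (𝓡∂ n) 𝓘(ℝ, W) ∞ f) (x : M)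
    {y : EuclideanSpace ℝ (Fin n)} (hy : y ∈ (extChartAt (𝓡∂ n) x).target) :
    ContDiffWithinAt ℝ ∞ (f ∘ (extChartAt (𝓡∂ n) x).symm) (range (𝓡∂ n)) y := by
  have h1 : ContMDiffOn 𝓘(ℝ, EuclideanSpace ℝ (Fin n)) 𝓘(ℝ, W) ∞
      (f ∘ (extChartAt (𝓡∂ n) x).symm) (extChartAt (𝓡∂ n) x).target :=
    hf.comp_contMDiffOn (contMDiffOn_extChartAt_symm x)
  exact ((contMDiffOn_iff_contDiffOn.1 h1).contDiffWithinAt hy).mono_of_mem_nhdsWithin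
    (extChartAt_target_mem_nhdsWithin_of_mem hy)

theorem uniqueDiffWithinAt_of_mem_target {x : M} {y : EuclideanSpace ℝ (Fin n)}
    (hy : y ∈ (extChartAt (𝓡∂ n) x).target) : UniqueDiffWithinAt ℝ (range (𝓡∂ n)) y :=
  (𝓡∂ n).uniqueDiffOn y (extChartAt_target_subset_range x hy)

theorem hasFDerivWithinAt_chart {f : M → W} (hf : ContMDiff (𝓡∂ n) 𝓘(ℝ, W) ∞ f) (x : M)
    {y : EuclideanSpace ℝ (Fin n)} (hy : y ∈ (extChartAt (𝓡∂ n) x).target) :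
    HasFDerivWithinAt (f ∘ (extChartAt (𝓡∂ n) x).symm) (chartDeriv f x y) (range (𝓡∂ n)) y :=
  ((contDiffWithinAt_chart hf x hy).differentiableWithinAt (by simp)).hasFDerivWithinAt

theorem contDiffWithinAt_chartDeriv {f : M → W} (hf : ContMDiff (𝓡∂ n) 𝓘(ℝ, W) ∞ f) (x : M)
    {y : EuclideanSpace ℝ (Fin n)} (hy : y ∈ (extChartAt (𝓡∂ n) x).target) :
    ContDiffWithinAt ℝ ∞ (chartDeriv f x) (range (𝓡∂ n)) y :=
  (contDiffWithinAt_chart hf x hy).fderivWithin_right (𝓡∂ n).uniqueDiffOn (by simp)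
    (extChartAt_target_subset_range x hy)

theorem mfderiv_eq_chartDeriv {f : M → W} (hf : ContMDiff (𝓡∂ n) 𝓘(ℝ, W) ∞ f) (p : M) :
    mfderiv (𝓡∂ n) 𝓘(ℝ, W) f p = chartDeriv f p (extChartAt (𝓡∂ n) p p) := by
  have h : MDifferentiableAt (𝓡∂ n) 𝓘(ℝ, W) f p := hf.mdifferentiableAt (by simp)
  simp only [mfderiv, h]
  rfl

theorem mem_coordChange_source {x' x : M} {p : M}
    (hp : p ∈ (extChartAt (𝓡∂ n) x').source ∩ (extChartAt (𝓡∂ n) x).source) :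
    extChartAt (𝓡∂ n) x' p ∈
      ((extChartAt (𝓡∂ n) x').symm.trans (extChartAt (𝓡∂ n) x)).source := by
  rw [PartialEquiv.trans_source'', PartialEquiv.symm_symm, PartialEquiv.symm_target]
  exact mem_image_of_mem _ hp

theorem contDiffWithinAt_coordChange {x' x : M} {p : M}
    (hp : p ∈ (extChartAt (𝓡∂ n) x').source ∩ (extChartAt (𝓡∂ n) x).source) :
    ContDiffWithinAt ℝ ∞ (coordChange x' x) (range (𝓡∂ n)) (extChartAt (𝓡∂ n) x' p) :=
  contDiffWithinAt_ext_coord_change x x' (mem_coordChange_source hp)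

theorem hasFDerivWithinAt_coordChange {x' x : M} {p : M}
    (hp : p ∈ (extChartAt (𝓡∂ n) x').source ∩ (extChartAt (𝓡∂ n) x).source) :
    HasFDerivWithinAt (coordChange x' x) (coordChangeDeriv x' x (extChartAt (𝓡∂ n) x' p))
      (range (𝓡∂ n)) (extChartAt (𝓡∂ n) x' p) :=
  ((contDiffWithinAt_coordChange hp).differentiableWithinAt (by simp)).hasFDerivWithinAt

theorem coordChangeDeriv_comp {x' x : M} {p : M}
    (hp : p ∈ (extChartAt (𝓡∂ n) x').source ∩ (extChartAt (𝓡∂ n) x).source) :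
    (coordChangeDeriv x' x (extChartAt (𝓡∂ n) x' p)).comp
      (coordChangeDeriv x x' (extChartAt (𝓡∂ n) x p)) = ContinuousLinearMap.id ℝ _ := by
  ext1 v
  have h1 := tangentCoordChange_comp (I := 𝓡∂ n) (w := x) (x := x') (y := x) (z := p) (v := v)
    ⟨⟨hp.2, hp.1⟩, hp.2⟩
  rw [tangentCoordChange_self hp.2] at h1
  exact h1

theorem bijective_coordChangeDeriv {x' x : M} {p : M}
    (hp : p ∈ (extChartAt (𝓡∂ n) x').source ∩ (extChartAt (𝓡∂ n) x).source) :
    Function.Bijective (coordChangeDeriv x' x (extChartAt (𝓡∂ n) x' p)) :=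
  ⟨Function.LeftInverse.injective (DFunLike.congr_fun (coordChangeDeriv_comp hp.symm)),
    Function.RightInverse.surjective (DFunLike.congr_fun (coordChangeDeriv_comp hp))⟩

theorem coordChange_extChartAt {x' x : M} {p : M} (hp : p ∈ (extChartAt (𝓡∂ n) x').source) :
    coordChange x' x (extChartAt (𝓡∂ n) x' p) = extChartAt (𝓡∂ n) x p := by
  simp only [coordChange, Function.comp_apply, (extChartAt (𝓡∂ n) x').left_inv hp]

theorem eventually_mem_source {x' x : M} {p : M}
    (hp : p ∈ (extChartAt (𝓡∂ n) x').source ∩ (extChartAt (𝓡∂ n) x).source) :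
    ∀ᶠ z in 𝓝[range (𝓡∂ n)] (extChartAt (𝓡∂ n) x' p), z ∈ (extChartAt (𝓡∂ n) x').target ∧
      (extChartAt (𝓡∂ n) x').symm z ∈ (extChartAt (𝓡∂ n) x).source := by
  have hy := (extChartAt (𝓡∂ n) x').map_source hp.1
  refine Filter.Eventually.and (extChartAt_target_mem_nhdsWithin_of_mem hy) ?_
  rw [← nhdsWithin_extChartAt_target_eq_of_mem hy]
  refine (continuousOn_extChartAt_symm x' _ hy).eventually ?_
  rw [(extChartAt (𝓡∂ n) x').left_inv hp.1]
  exact extChartAt_source_mem_nhds' hp.2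

theorem mapsTo_coordChange (x' x : M) {z : EuclideanSpace ℝ (Fin n)} :
    coordChange x' x z ∈ range (𝓡∂ n) := by
  simp only [coordChange, Function.comp_apply, extChartAt_coe]
  exact mem_range_self _

theorem chartDeriv_eq_comp {f : M → W} (hf : ContMDiff (𝓡∂ n) 𝓘(ℝ, W) ∞ f) {x' x : M} {p : M}
    (hp : p ∈ (extChartAt (𝓡∂ n) x').source ∩ (extChartAt (𝓡∂ n) x).source) :
    chartDeriv f x' (extChartAt (𝓡∂ n) x' p) =
      (chartDeriv f x (extChartAt (𝓡∂ n) x p)).comp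
        (coordChangeDeriv x' x (extChartAt (𝓡∂ n) x' p)) := by
  have hy := (extChartAt (𝓡∂ n) x').map_source hp.1
  have h1 := hasFDerivWithinAt_chart hf x ((extChartAt (𝓡∂ n) x).map_source hp.2)
  rw [← coordChange_extChartAt hp.1] at h1
  have h2 := h1.comp _ (hasFDerivWithinAt_coordChange hp) fun z _ => mapsTo_coordChange x' x
  rw [coordChange_extChartAt hp.1] at h2
  refine (h2.congr_of_eventuallyEq ?_ ?_).fderivWithin (uniqueDiffWithinAt_of_mem_target hy)
  · filter_upwards [eventually_mem_source hp] with z hz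
    simp only [coordChange, Function.comp_apply, (extChartAt (𝓡∂ n) x).left_inv hz.2]
  · simp only [coordChange, Function.comp_apply, (extChartAt (𝓡∂ n) x').left_inv hp.1,
      (extChartAt (𝓡∂ n) x).left_inv hp.2]

variable {N : ℕ} {F : M → EuclideanSpace ℝ (Fin N)}

/-- `F` is a smooth immersion. -/
structure IsSmoothImmersion (F : M → EuclideanSpace ℝ (Fin N)) : Prop where
  contMDiff : ContMDiff (𝓡∂ n) 𝓘(ℝ, EuclideanSpace ℝ (Fin N)) ∞ F
  injective_differential : ∀ p, Function.Injective (differential (n := n) F p)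

theorem coordDeriv_eq (F : M → EuclideanSpace ℝ (Fin N)) : coordDeriv (n := n) F = chartDeriv F :=
  rfl

theorem differential_eq (hF : IsSmoothImmersion (n := n) F) {x p : M}
    (hp : p ∈ (extChartAt (𝓡∂ n) x).source) :
    differential F p = (coordDeriv F x (extChartAt (𝓡∂ n) x p)).comp
      (coordChangeDeriv p x (extChartAt (𝓡∂ n) p p)) := by
  rw [differential, mfderiv_eq_chartDeriv hF.contMDiff]
  exact chartDeriv_eq_comp hF.contMDiff ⟨mem_extChartAt_source p, hp⟩

theorem IsSmoothImmersion.injective_coordDeriv (hF : IsSmoothImmersion (n := n) F) (x : M)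
    {y : EuclideanSpace ℝ (Fin n)} (hy : y ∈ (extChartAt (𝓡∂ n) x).target) :
    Function.Injective (coordDeriv F x y) := by
  have hp := (extChartAt (𝓡∂ n) x).map_target hy
  have h := hF.injective_differential ((extChartAt (𝓡∂ n) x).symm y)
  rw [differential_eq hF hp, (extChartAt (𝓡∂ n) x).right_inv hy] at h
  intro v w hvw
  have hb := bijective_coordChangeDeriv (n := n) (x' := (extChartAt (𝓡∂ n) x).symm y) (x := x)
    ⟨mem_extChartAt_source _, hp⟩
  obtain ⟨v, rfl⟩ := hb.2 v
  obtain ⟨w, rfl⟩ := hb.2 w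
  exact congrArg _ (h hvw)

theorem range_differential (hF : IsSmoothImmersion (n := n) F) {x p : M}
    (hp : p ∈ (extChartAt (𝓡∂ n) x).source) :
    range (differential (n := n) F p) = range (coordDeriv F x (extChartAt (𝓡∂ n) x p)) := by
  rw [differential_eq hF hp, ContinuousLinearMap.coe_comp, range_comp,
    (bijective_coordChangeDeriv (n := n) ⟨mem_extChartAt_source p, hp⟩).2.range_eq, image_univ]

theorem contDiffWithinAt_coordDeriv (hF : IsSmoothImmersion (n := n) F) (x : M)
    {y : EuclideanSpace ℝ (Fin n)} (hy : y ∈ (extChartAt (𝓡∂ n) x).target) :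
    ContDiffWithinAt ℝ ∞ (coordDeriv F x) (range (𝓡∂ n)) y :=
  contDiffWithinAt_chartDeriv hF.contMDiff x hy

theorem contDiffWithinAt_fderivWithin_coordDeriv (hF : IsSmoothImmersion (n := n) F) (x : M)
    {y : EuclideanSpace ℝ (Fin n)} (hy : y ∈ (extChartAt (𝓡∂ n) x).target) :
    ContDiffWithinAt ℝ ∞ (fderivWithin ℝ (coordDeriv F x) (range (𝓡∂ n))) (range (𝓡∂ n)) y :=
  (contDiffWithinAt_coordDeriv hF x hy).fderivWithin_right (𝓡∂ n).uniqueDiffOn (by simp)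
    (extChartAt_target_subset_range x hy)

theorem riemannianGradient_eq_gradientOf (v : M → ℝ) (p : M) :
    riemannianGradient (n := n) F v p =
      gradientOf (differential (n := n) F p) (differentialFun v p) := rfl

theorem riemannianGradient_eq (hF : IsSmoothImmersion (n := n) F) {v : M → ℝ}
    (hv : ContMDiff (𝓡∂ n) 𝓘(ℝ, ℝ) ∞ v) {x p : M} (hp : p ∈ (extChartAt (𝓡∂ n) x).source) :
    riemannianGradient (n := n) F v p = gradientOf (coordDeriv F x (extChartAt (𝓡∂ n) x p))
      (chartDeriv v x (extChartAt (𝓡∂ n) x p)) := by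
  rw [riemannianGradient_eq_gradientOf, differential_eq hF hp, differentialFun,
    mfderiv_eq_chartDeriv hv, chartDeriv_eq_comp hv ⟨mem_extChartAt_source p, hp⟩]
  exact gradientOf_comp (hF.injective_coordDeriv x ((extChartAt (𝓡∂ n) x).map_source hp))
    (bijective_coordChangeDeriv ⟨mem_extChartAt_source p, hp⟩) _

theorem meanCurvature_eq_meanCurvatureOf (p : M) (F : M → EuclideanSpace ℝ (Fin N)) :
    meanCurvature (n := n) F p = meanCurvatureOf (differential (n := n) F p)
      (fderivWithin ℝ (coordDeriv F p) (range (𝓡∂ n)) (extChartAt (𝓡∂ n) p p)) := rfl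

theorem meanCurvature_eq (hF : IsSmoothImmersion (n := n) F) {x p : M}
    (hp : p ∈ (extChartAt (𝓡∂ n) x).source) :
    meanCurvature (n := n) F p = meanCurvatureOf (coordDeriv F x (extChartAt (𝓡∂ n) x p))
      (fderivWithin ℝ (coordDeriv F x) (range (𝓡∂ n)) (extChartAt (𝓡∂ n) x p)) := by
  have hpp : p ∈ (extChartAt (𝓡∂ n) p).source ∩ (extChartAt (𝓡∂ n) x).source :=
    ⟨mem_extChartAt_source p, hp⟩
  have hy := (extChartAt (𝓡∂ n) p).map_source hpp.1
  rw [meanCurvature_eq_meanCurvatureOf, differential_eq hF hp]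
  refine meanCurvatureOf_comp (coordChangeDeriv_comp hpp) fun v w => ?_
  have h1 : HasFDerivWithinAt (coordDeriv F x) (fderivWithin ℝ (coordDeriv F x) (range (𝓡∂ n))
      (extChartAt (𝓡∂ n) x p)) (range (𝓡∂ n)) (coordChange p x (extChartAt (𝓡∂ n) p p)) := by
    rw [coordChange_extChartAt hpp.1]
    exact ((contDiffWithinAt_coordDeriv hF x
      ((extChartAt (𝓡∂ n) x).map_source hp)).differentiableWithinAt (by simp)).hasFDerivWithinAt
  have h2 := h1.comp _ (hasFDerivWithinAt_coordChange hpp) fun z _ => mapsTo_coordChange p x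
  have h3 : HasFDerivWithinAt (coordChangeDeriv p x) _ (range (𝓡∂ n)) (extChartAt (𝓡∂ n) p p) :=
    (((contDiffWithinAt_coordChange hpp).fderivWithin_right (m := ∞) (𝓡∂ n).uniqueDiffOn (by simp)
      (extChartAt_target_subset_range p hy)).differentiableWithinAt (by simp)).hasFDerivWithinAt
  have h4 := (h2.clm_comp h3).congr_of_eventuallyEq (f₁ := coordDeriv F p) (by
    filter_upwards [eventually_mem_source hpp] with z hz
    have h5 := chartDeriv_eq_comp hF.contMDiff (x' := p) (x := x)
      ⟨(extChartAt (𝓡∂ n) p).map_target hz.1, hz.2⟩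
    rw [(extChartAt (𝓡∂ n) p).right_inv hz.1] at h5
    exact h5) (by
    simp only [Function.comp_apply, coordChange_extChartAt hpp.1]
    exact chartDeriv_eq_comp hF.contMDiff hpp)
  rw [h4.fderivWithin (uniqueDiffWithinAt_of_mem_target hy)]
  simp only [Function.comp_apply, coordChange_extChartAt hpp.1, add_apply,
    ContinuousLinearMap.comp_apply, ContinuousLinearMap.compL_apply,
    ContinuousLinearMap.flip_apply, add_sub_cancel_right]
  exact ⟨_, rfl⟩

theorem continuousAt_of_chart {Z : Type*} [TopologicalSpace Z] {g : M → Z}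
    {h : EuclideanSpace ℝ (Fin n) → Z} {x : M}
    (hgh : ∀ p ∈ (extChartAt (𝓡∂ n) x).source, g p = h (extChartAt (𝓡∂ n) x p))
    (hc : ContinuousWithinAt h (range (𝓡∂ n)) (extChartAt (𝓡∂ n) x x)) : ContinuousAt g x := by
  have h1 : ContinuousAt (h ∘ extChartAt (𝓡∂ n) x) x := by
    refine Tendsto.comp hc (tendsto_nhdsWithin_iff.2 ⟨continuousAt_extChartAt x, ?_⟩)
    exact Eventually.of_forall fun p => by rw [extChartAt_coe]; exact mem_range_self _
  refine h1.congr ?_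
  filter_upwards [extChartAt_source_mem_nhds (I := 𝓡∂ n) x] with p hp using (hgh p hp).symm

theorem continuous_riemannianGradient (hF : IsSmoothImmersion (n := n) F) {v : M → ℝ}
    (hv : ContMDiff (𝓡∂ n) 𝓘(ℝ, ℝ) ∞ v) : Continuous (riemannianGradient (n := n) F v) :=
  continuous_iff_continuousAt.2 fun x =>
    continuousAt_of_chart (h := fun y => gradientOf (coordDeriv F x y) (chartDeriv v x y))
      (fun _ hp => riemannianGradient_eq hF hv hp)
      (contDiffWithinAt_gradientOf (contDiffWithinAt_coordDeriv hF x (mem_extChartAt_target x))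
        (hF.injective_coordDeriv x (mem_extChartAt_target x))
        (contDiffWithinAt_chartDeriv hv x (mem_extChartAt_target x))).continuousWithinAt

theorem continuous_meanCurvature (hF : IsSmoothImmersion (n := n) F) :
    Continuous (meanCurvature (n := n) F) :=
  continuous_iff_continuousAt.2 fun x =>
    continuousAt_of_chart
      (h := fun y => meanCurvatureOf (coordDeriv F x y)
        (fderivWithin ℝ (coordDeriv F x) (range (𝓡∂ n)) y))
      (fun _ hp => meanCurvature_eq hF hp)
      (contDiffWithinAt_meanCurvatureOf
        (contDiffWithinAt_coordDeriv hF x (mem_extChartAt_target x))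
        (hF.injective_coordDeriv x (mem_extChartAt_target x))
        (extChartAt_target_subset_range x (mem_extChartAt_target x))
        (contDiffWithinAt_fderivWithin_coordDeriv hF x
          (mem_extChartAt_target x))).continuousWithinAt

theorem riemannianGradient_mem_range (v : M → ℝ) (p : M) :
    riemannianGradient (n := n) F v p ∈ LinearMap.range (differential (n := n) F p).toLinearMap :=
  gradientOf_mem_range _ _

theorem inner_riemannianGradient (hF : IsSmoothImmersion (n := n) F) (v : M → ℝ) (p : M)
    (w : EuclideanSpace ℝ (Fin n)) :
    inner ℝ (riemannianGradient (n := n) F v p) (differential F p w) = differentialFun v p w :=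
  inner_gradientOf (hF.injective_differential p) _ _

theorem inner_riemannianGradient_meanCurvature (v : M → ℝ) (p : M) :
    inner ℝ (riemannianGradient (n := n) F v p) (meanCurvature (n := n) F p) = 0 :=
  inner_meanCurvatureOf _ (riemannianGradient_mem_range v p)

theorem differentialFun_eq {v : M → ℝ} (hv : ContMDiff (𝓡∂ n) 𝓘(ℝ, ℝ) ∞ v) (p : M) :
    differentialFun (n := n) v p = chartDeriv v p (extChartAt (𝓡∂ n) p p) :=
  mfderiv_eq_chartDeriv hv p

theorem riemannianGradient_add {v w : M → ℝ} (hv : ContMDiff (𝓡∂ n) 𝓘(ℝ, ℝ) ∞ v)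
    (hw : ContMDiff (𝓡∂ n) 𝓘(ℝ, ℝ) ∞ w) (p : M) :
    riemannianGradient (n := n) F (fun q => v q + w q) p =
      riemannianGradient (n := n) F v p + riemannianGradient (n := n) F w p := by
  simp only [riemannianGradient_eq_gradientOf, ← gradientOf_add]
  congr 1
  have hy := mem_extChartAt_target (I := 𝓡∂ n) p
  rw [differentialFun_eq hv, differentialFun_eq hw,
    differentialFun_eq (v := fun q => v q + w q) (hv.add hw)]
  exact ((hasFDerivWithinAt_chart hv p hy).add (hasFDerivWithinAt_chart hw p hy)).fderivWithin
    (uniqueDiffWithinAt_of_mem_target hy)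

theorem riemannianGradient_mul {v w : M → ℝ} (hv : ContMDiff (𝓡∂ n) 𝓘(ℝ, ℝ) ∞ v)
    (hw : ContMDiff (𝓡∂ n) 𝓘(ℝ, ℝ) ∞ w) (p : M) :
    riemannianGradient (n := n) F (fun q => v q * w q) p =
      v p • riemannianGradient (n := n) F w p + w p • riemannianGradient (n := n) F v p := by
  simp only [riemannianGradient_eq_gradientOf, ← gradientOf_add, ← gradientOf_smul]
  congr 1
  have hy := mem_extChartAt_target (I := 𝓡∂ n) p
  rw [differentialFun_eq hv, differentialFun_eq hw,
    differentialFun_eq (v := fun q => v q * w q) (hv.mul hw)]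
  have h := ((hasFDerivWithinAt_chart hv p hy).mul (hasFDerivWithinAt_chart hw p hy)).fderivWithin
    (uniqueDiffWithinAt_of_mem_target hy)
  simp only [Function.comp_apply, extChartAt_to_inv] at h
  exact h

theorem riemannianGradient_comp {v : M → ℝ} (hv : ContMDiff (𝓡∂ n) 𝓘(ℝ, ℝ) ∞ v) {θ : ℝ → ℝ} {p : M}
    {d : ℝ} (hθ : HasDerivAt θ d (v p)) (hθv : ContMDiff (𝓡∂ n) 𝓘(ℝ, ℝ) ∞ (fun q => θ (v q))) :
    riemannianGradient (n := n) F (fun q => θ (v q)) p = d • riemannianGradient (n := n) F v p := by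
  simp only [riemannianGradient_eq_gradientOf, ← gradientOf_smul]
  congr 1
  have hy := mem_extChartAt_target (I := 𝓡∂ n) p
  rw [differentialFun_eq hv, differentialFun_eq hθv]
  rw [← extChartAt_to_inv (I := 𝓡∂ n) p] at hθ
  exact (HasDerivAt.comp_hasFDerivWithinAt (f := v ∘ (extChartAt (𝓡∂ n) p).symm)
    (extChartAt (𝓡∂ n) p p) hθ (hasFDerivWithinAt_chart hv p hy)).fderivWithin
    (uniqueDiffWithinAt_of_mem_target hy)

end Charts

/-! ### The boundary in charts -/

section BoundaryCharts

variable {n : ℕ} [NeZero n]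

/-- The projection of `ℝ^n` onto the coordinates of the bounding hyperplane. -/
def faceProj (n : ℕ) [NeZero n] :
    EuclideanSpace ℝ (Fin n) →L[ℝ] EuclideanSpace ℝ {i : Fin n // i ≠ 0} :=
  LinearMap.toContinuousLinearMap
    { toFun := fun y => WithLp.toLp 2 fun i => y i
      map_add' := fun _ _ => rfl
      map_smul' := fun _ _ => rfl }

theorem faceProj_face (z : EuclideanSpace ℝ {i : Fin n // i ≠ 0}) : faceProj n (face n z) = z := by
  ext i
  exact face_apply_of_ne z i

theorem face_faceProj {y : EuclideanSpace ℝ (Fin n)} (hy : y 0 = 0) :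
    face n (faceProj n y) = y := by
  ext i
  by_cases h : i = 0
  · subst h; rw [face_apply_zero, hy]
  · exact face_apply_of_ne (faceProj n y) ⟨i, h⟩

theorem injective_face : Function.Injective (face n) :=
  Function.LeftInverse.injective faceProj_face

theorem face_mem_range (z : EuclideanSpace ℝ {i : Fin n // i ≠ 0}) :
    face n z ∈ range (𝓡∂ n) := mem_range_model.2 (face_apply_zero z).ge

variable {M : Type*} [TopologicalSpace M] [ChartedSpace (EuclideanHalfSpace n) M]
  [IsManifold (𝓡∂ n) ∞ M]

theorem extChartAt_mem_range (x p : M) : extChartAt (𝓡∂ n) x p ∈ range (𝓡∂ n) := by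
  rw [extChartAt_coe]; exact mem_range_self _

theorem mem_boundary_iff {x p : M} (hp : p ∈ (extChartAt (𝓡∂ n) x).source) :
    p ∈ (𝓡∂ n).boundary M ↔ extChartAt (𝓡∂ n) x p 0 = 0 := by
  have hp' : p ∈ (chartAt (EuclideanHalfSpace n) x).source := by rwa [extChartAt_source] at hp
  have h1 := (𝓡∂ n).isInteriorPoint_iff_of_mem_atlas (n := ∞) (by simp)
    (chart_mem_atlas (EuclideanHalfSpace n) x) hp'
  have h2 : extChartAt (𝓡∂ n) x p ∈ interior (extChartAt (𝓡∂ n) x).target ↔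
      0 < extChartAt (𝓡∂ n) x p 0 := by
    constructor
    · intro h
      have := interior_mono (extChartAt_target_subset_range x) h
      rwa [interior_range_modelWithCornersEuclideanHalfSpace] at this
    · intro h
      have h3 : (extChartAt (𝓡∂ n) x).target ∈ 𝓝[range (𝓡∂ n)] (extChartAt (𝓡∂ n) x p) :=
        extChartAt_target_mem_nhdsWithin_of_mem ((extChartAt (𝓡∂ n) x).map_source hp)
      rw [nhdsWithin_eq_nhds.2 (mem_interior_iff_mem_nhds.1 (interior_range_model_subset h))] at h3
      exact mem_interior_iff_mem_nhds.2 h3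
  have h4 : (𝓡∂ n).IsInteriorPoint p ↔ 0 < extChartAt (𝓡∂ n) x p 0 := h1.trans h2
  have h5 := mem_range_model.1 (extChartAt_mem_range (n := n) x p)
  rw [show p ∈ (𝓡∂ n).boundary M ↔ (𝓡∂ n).IsBoundaryPoint p from Iff.rfl,
    ModelWithCorners.isBoundaryPoint_iff_not_isInteriorPoint, h4, not_lt]
  exact ⟨fun h => le_antisymm h h5, fun h => h.le⟩

theorem coordChange_face {x' x : M} {z : EuclideanSpace ℝ {i : Fin n // i ≠ 0}}
    (hz : face n z ∈ (extChartAt (𝓡∂ n) x').target)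
    (hz' : (extChartAt (𝓡∂ n) x').symm (face n z) ∈ (extChartAt (𝓡∂ n) x).source) :
    coordChange x' x (face n z) 0 = 0 := by
  have h1 : (extChartAt (𝓡∂ n) x').symm (face n z) ∈ (𝓡∂ n).boundary M :=
    (mem_boundary_iff ((extChartAt (𝓡∂ n) x').map_target hz)).2 (by
    rw [(extChartAt (𝓡∂ n) x').right_inv hz, face_apply_zero])
  exact (mem_boundary_iff hz').1 h1

/-- The coordinate change between charts of the boundary. -/
def faceCoordChange (x' x : M) (z : EuclideanSpace ℝ {i : Fin n // i ≠ 0}) :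
    EuclideanSpace ℝ {i : Fin n // i ≠ 0} :=
  faceProj n (coordChange x' x (face n z))

/-- The derivative of `faceCoordChange`. -/
def faceCoordChangeDeriv (x' x : M) (z : EuclideanSpace ℝ {i : Fin n // i ≠ 0}) :
    EuclideanSpace ℝ {i : Fin n // i ≠ 0} →L[ℝ] EuclideanSpace ℝ {i : Fin n // i ≠ 0} :=
  (faceProj n).comp ((coordChangeDeriv x' x (face n z)).comp (face n))

theorem hasFDerivAt_coordChange_comp_face {x' x : M} {z : EuclideanSpace ℝ {i : Fin n // i ≠ 0}}
    (hz : face n z ∈ (extChartAt (𝓡∂ n) x').target)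
    (hz' : (extChartAt (𝓡∂ n) x').symm (face n z) ∈ (extChartAt (𝓡∂ n) x).source) :
    HasFDerivAt (fun z => coordChange x' x (face n z))
      ((coordChangeDeriv x' x (face n z)).comp (face n)) z := by
  have h := hasFDerivWithinAt_coordChange ⟨(extChartAt (𝓡∂ n) x').map_target hz, hz'⟩
  rw [(extChartAt (𝓡∂ n) x').right_inv hz] at h
  exact hasFDerivWithinAt_univ.1
    (h.comp z (face n).hasFDerivAt.hasFDerivWithinAt fun z _ => face_mem_range z)

theorem hasFDerivAt_faceCoordChange {x' x : M} {z : EuclideanSpace ℝ {i : Fin n // i ≠ 0}}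
    (hz : face n z ∈ (extChartAt (𝓡∂ n) x').target)
    (hz' : (extChartAt (𝓡∂ n) x').symm (face n z) ∈ (extChartAt (𝓡∂ n) x).source) :
    HasFDerivAt (faceCoordChange x' x) (faceCoordChangeDeriv x' x z) z :=
  (faceProj n).hasFDerivAt.comp z (hasFDerivAt_coordChange_comp_face hz hz')

theorem face_comp_faceCoordChangeDeriv {x' x : M} {z : EuclideanSpace ℝ {i : Fin n // i ≠ 0}}
    (hz : face n z ∈ (extChartAt (𝓡∂ n) x').target)
    (hz' : (extChartAt (𝓡∂ n) x').symm (face n z) ∈ (extChartAt (𝓡∂ n) x).source) :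
    (face n).comp (faceCoordChangeDeriv x' x z) =
      (coordChangeDeriv x' x (face n z)).comp (face n) := by
  have h := hasFDerivAt_coordChange_comp_face hz hz'
  have h0 := ((EuclideanSpace.proj (𝕜 := ℝ) (0 : Fin n)).hasFDerivAt.comp z h)
  have hev : ∀ᶠ z' in 𝓝 z, face n z' ∈ (extChartAt (𝓡∂ n) x').target ∧
      (extChartAt (𝓡∂ n) x').symm (face n z') ∈ (extChartAt (𝓡∂ n) x).source := by
    have h1 := eventually_mem_source (n := n) ⟨(extChartAt (𝓡∂ n) x').map_target hz, hz'⟩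
    rw [(extChartAt (𝓡∂ n) x').right_inv hz] at h1
    exact (tendsto_nhdsWithin_iff.2 ⟨(face n).continuous.continuousAt,
      Eventually.of_forall face_mem_range⟩).eventually h1
  have h2 : (fun z' => EuclideanSpace.proj (𝕜 := ℝ) (0 : Fin n) (coordChange x' x (face n z')))
      =ᶠ[𝓝 z] fun _ => 0 := by
    filter_upwards [hev] with z' hz'
    exact coordChange_face hz'.1 hz'.2
  have h3 := h0.unique ((hasFDerivAt_const (0 : ℝ) z).congr_of_eventuallyEq h2)
  ext1 w
  exact face_faceProj (DFunLike.congr_fun h3 w)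

variable {N : ℕ} {F : M → EuclideanSpace ℝ (Fin N)}

theorem IsFreeBoundaryImmersion.isSmoothImmersion (hF : IsFreeBoundaryImmersion (n := n) F) :
    IsSmoothImmersion (n := n) F :=
  ⟨hF.contMDiff, hF.injective_differential⟩

theorem posTangentCone_zero {y : EuclideanSpace ℝ (Fin n)} (hy : y ∈ range (𝓡∂ n))
    {v : EuclideanSpace ℝ (Fin n)} (hv : 0 ≤ v 0) : v ∈ posTangentConeAt (range (𝓡∂ n)) y := by
  refine mem_posTangentConeAt_of_segment_subset
    ((𝓡∂ n).convex_range.segment_subset hy (mem_range_model.2 ?_))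
  have := mem_range_model.1 hy
  simpa using add_nonneg this hv

theorem IsFreeBoundaryImmersion.coWeighted_zero (hF : IsFreeBoundaryImmersion (n := n) F) (x : M)
    {y : EuclideanSpace ℝ (Fin n)} (hy : y ∈ (extChartAt (𝓡∂ n) x).target) (hy0 : y 0 = 0) :
    coWeighted (coordDeriv F x y) 0 = -(((coordDeriv F x y).comp (face n)).toLinearMap.normDet •
      F ((extChartAt (𝓡∂ n) x).symm y)) := by
  have hp := (extChartAt (𝓡∂ n) x).map_target hy
  set p := (extChartAt (𝓡∂ n) x).symm y with hpdef
  have hpy : extChartAt (𝓡∂ n) x p = y := (extChartAt (𝓡∂ n) x).right_inv hy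
  have hb : p ∈ (𝓡∂ n).boundary M := (mem_boundary_iff hp).2 (by rw [hpy, hy0])
  have hnorm : ‖F p‖ = 1 := by
    rw [← hF.preimage_sphere] at hb; simpa using hb
  have hyS : y ∈ range (𝓡∂ n) := extChartAt_target_subset_range x hy
  have hder := (hasFDerivWithinAt_chart hF.contMDiff x hy).norm_sq
  have hmax : IsLocalMaxOn
      (fun z => ‖(F ∘ (extChartAt (𝓡∂ n) x).symm) z‖ ^ 2) (range (𝓡∂ n)) y := by
    refine Eventually.of_forall fun z => ?_
    have h1 : ‖F ((extChartAt (𝓡∂ n) x).symm z)‖ ≤ 1 := by simpa using hF.mem_ball _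
    simp only [Function.comp_apply, ← hpdef, hnorm, one_pow]
    exact pow_le_one₀ (norm_nonneg _) h1
  have hle : ∀ v : EuclideanSpace ℝ (Fin n), 0 ≤ v 0 → inner ℝ (F p) (coordDeriv F x y v) ≤ 0 := by
    intro v hv
    have h1 := hmax.hasFDerivWithinAt_nonpos hder (posTangentCone_zero hyS hv)
    simp only [smul_apply, ContinuousLinearMap.comp_apply, innerSL_apply_apply,
      Function.comp_apply, ← hpdef] at h1
    have h2 : (2 : ℝ) * inner ℝ (F p) (coordDeriv F x y v) ≤ 0 := by
      simpa [coordDeriv_eq, two_smul, two_mul] using h1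
    linarith
  refine coWeighted_zero_eq (hF.isSmoothImmersion.injective_coordDeriv x hy) ?_ hnorm ?_ ?_
  · have h1 := hF.orthogonal p hb
    rw [range_differential hF.isSmoothImmersion hp, hpy] at h1
    obtain ⟨v, hv⟩ := h1
    exact ⟨v, hv⟩
  · intro i hi
    refine le_antisymm (hle _ (by simp [Ne.symm hi])) ?_
    have h1 := hle (-EuclideanSpace.single i 1) (by simp [Ne.symm hi])
    rw [map_neg, inner_neg_right] at h1
    linarith
  · exact hle _ (by simp)

end BoundaryCharts

/-! ### The volume measures in charts -/

section Patches

variable {E : Type*} [NormedAddCommGroup E] [NormedSpace ℝ E] [FiniteDimensional ℝ E]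
  [MeasureSpace E] [BorelSpace E] [(volume : Measure E).IsAddHaarMeasure]
  {M : Type*} [TopologicalSpace M] [MeasurableSpace M] [BorelSpace M]

theorem measurableSet_preimage_inter {Ω : Set E} {ψ : E → M} (hΩ : MeasurableSet Ω)
    (hψ : ContinuousOn ψ Ω) {A : Set M} (hA : MeasurableSet A) : MeasurableSet (ψ ⁻¹' A ∩ Ω) := by
  have h := (continuousOn_iff_continuous_domRestrict.1 hψ).measurable hA
  have h2 := hΩ.subtype_image h
  convert! h2 using 1
  ext z
  simp [and_comm]

theorem patch_apply {Ω : Set E} {ψ : E → M} {J : E → ℝ≥0∞} (hΩ : MeasurableSet Ω)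
    (hψ : ContinuousOn ψ Ω) {A : Set M} (hA : MeasurableSet A) :
    (((volume.restrict Ω).withDensity J).map ψ) A = ∫⁻ z in ψ ⁻¹' A ∩ Ω, J z := by
  have h : AEMeasurable ψ ((volume.restrict Ω).withDensity J) :=
    (hψ.aemeasurable hΩ).mono_ac (withDensity_absolutelyContinuous _ _)
  rw [Measure.map_apply_of_aemeasurable h hA, withDensity_apply', Measure.restrict_restrict' hΩ]

/-- Two patches of a measure agree on a common set, by the change of variables formula. -/
theorem patch_apply_eq {Ω₁ Ω₂ : Set E} {ψ₁ ψ₂ : E → M} {J₁ J₂ : E → ℝ≥0∞}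
    (hΩ₁ : MeasurableSet Ω₁) (hψ₁ : ContinuousOn ψ₁ Ω₁)
    (hΩ₂ : MeasurableSet Ω₂) (hψ₂ : ContinuousOn ψ₂ Ω₂) {A : Set M} (hA : MeasurableSet A)
    {τ : E → E} {τ' : E → E →L[ℝ] E}
    (hτ : ∀ z ∈ ψ₁ ⁻¹' A ∩ Ω₁, HasFDerivWithinAt τ (τ' z) (ψ₁ ⁻¹' A ∩ Ω₁) z)
    (hinj : InjOn τ (ψ₁ ⁻¹' A ∩ Ω₁)) (himage : τ '' (ψ₁ ⁻¹' A ∩ Ω₁) = ψ₂ ⁻¹' A ∩ Ω₂)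
    (hJ : ∀ z ∈ ψ₁ ⁻¹' A ∩ Ω₁, J₁ z = ENNReal.ofReal |(τ' z).det| * J₂ (τ z)) :
    (((volume.restrict Ω₁).withDensity J₁).map ψ₁) A =
      (((volume.restrict Ω₂).withDensity J₂).map ψ₂) A := by
  have hm := measurableSet_preimage_inter hΩ₁ hψ₁ hA
  rw [patch_apply hΩ₁ hψ₁ hA, patch_apply hΩ₂ hψ₂ hA, ← himage,
    lintegral_image_eq_lintegral_abs_det_fderiv_mul volume hm hτ hinj]
  exact setLIntegral_congr_fun hm hJ

theorem integral_patch {Ω : Set E} {ψ : E → M} {j : E → ℝ} (hΩ : MeasurableSet Ω)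
    (hψ : ContinuousOn ψ Ω) (hj : ContinuousOn j Ω) (hj0 : ∀ z, 0 ≤ j z) {f : M → ℝ}
    (hf : AEStronglyMeasurable f
      (((volume.restrict Ω).withDensity fun z => ENNReal.ofReal (j z)).map ψ)) :
    ∫ p, f p ∂(((volume.restrict Ω).withDensity fun z => ENNReal.ofReal (j z)).map ψ) =
      ∫ z in Ω, j z * f (ψ z) := by
  have h : AEMeasurable ψ ((volume.restrict Ω).withDensity fun z => ENNReal.ofReal (j z)) :=
    (hψ.aemeasurable hΩ).mono_ac (withDensity_absolutelyContinuous _ _)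
  rw [integral_map h hf, integral_withDensity_eq_integral_toReal_smul₀
    (hj.aemeasurable hΩ).ennreal_ofReal (Eventually.of_forall fun _ => ENNReal.ofReal_lt_top)]
  simp only [ENNReal.toReal_ofReal (hj0 _), smul_eq_mul]

theorem patch_lt_top {Ω : Set E} {ψ : E → M} {j : E → ℝ} (hΩ : MeasurableSet Ω)
    (hψ : ContinuousOn ψ Ω) (hj : ContinuousOn j Ω) {A : Set M} (hA : MeasurableSet A) {K : Set E}
    (hK : IsCompact K) (hKΩ : K ⊆ Ω) (hAK : ψ ⁻¹' A ∩ Ω ⊆ K) :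
    (((volume.restrict Ω).withDensity fun z => ENNReal.ofReal (j z)).map ψ) A < ⊤ := by
  rw [patch_apply hΩ hψ hA]
  obtain ⟨C, hC⟩ := hK.exists_bound_of_continuousOn (hj.mono hKΩ)
  refine lt_of_le_of_lt (setLIntegral_mono' (g := fun _ => ENNReal.ofReal C)
    (measurableSet_preimage_inter hΩ hψ hA)
    fun z hz => ENNReal.ofReal_le_ofReal ((le_abs_self _).trans (hC z (hAK hz)))) ?_
  rw [setLIntegral_const]
  exact ENNReal.mul_lt_top ENNReal.ofReal_lt_top ((measure_mono hAK).trans_lt hK.measure_lt_top)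

theorem iSup_restrict_le {α ι : Type*} [MeasurableSpace α] {ν : ι → Measure α} {m : Measure α}
    {S : Set α} (hS : MeasurableSet S) (h : ∀ i, (ν i).restrict S ≤ m) :
    (⨆ i, ν i).restrict S ≤ m := by
  have h1 : (⨆ i, ν i) ≤ m.restrict S + (⨆ i, ν i).restrict Sᶜ := by
    refine iSup_le fun i => ?_
    rw [← Measure.restrict_add_restrict_compl (μ := ν i) hS]
    refine add_le_add ?_ (Measure.restrict_mono_measure (le_iSup ν i) _)
    have := Measure.restrict_mono_measure (h i) S
    rwa [Measure.restrict_restrict hS, inter_self] at this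
  have h2 := Measure.restrict_mono_measure h1 S
  rw [Measure.restrict_add, Measure.restrict_restrict hS, Measure.restrict_restrict hS,
    inter_self, inter_compl_self, Measure.restrict_empty, add_zero] at h2
  exact h2.trans Measure.restrict_le_self

theorem iSup_restrict_eq {α ι : Type*} [MeasurableSpace α] {ν : ι → Measure α} {i : ι}
    {S : Set α} (hS : MeasurableSet S) (h : ∀ i', ∀ A ⊆ S, MeasurableSet A → ν i' A ≤ ν i A)
    (hi : ν i Sᶜ = 0) : (⨆ i, ν i).restrict S = ν i := by
  have h0 : (ν i).restrict S = ν i := by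
    rw [Measure.restrict_eq_self_of_ae_mem]
    exact hi
  refine le_antisymm (iSup_restrict_le hS fun i' => Measure.le_iff.2 fun A hA => ?_) ?_
  · rw [Measure.restrict_apply hA]
    exact (h i' _ inter_subset_right (hA.inter hS)).trans (measure_mono inter_subset_left)
  · conv_lhs => rw [← h0]
    exact Measure.restrict_mono_measure (le_iSup ν i) S

end Patches

section Volumes

variable {n N : ℕ} [NeZero n] {M : Type*} [TopologicalSpace M]
  [ChartedSpace (EuclideanHalfSpace n) M] [IsManifold (𝓡∂ n) ∞ M]
  {F : M → EuclideanSpace ℝ (Fin N)}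

theorem measurableSet_target (x : M) : MeasurableSet (extChartAt (𝓡∂ n) x).target := by
  rw [extChartAt_target]
  exact ((chartAt _ x).open_target.preimage (𝓡∂ n).continuous_symm).measurableSet.inter
    isClosed_range_model.measurableSet

theorem measurableSet_face_target (x : M) :
    MeasurableSet (face n ⁻¹' (extChartAt (𝓡∂ n) x).target) :=
  (face n).continuous.measurable (measurableSet_target x)

theorem continuousOn_boundary_symm (x : M) :
    ContinuousOn (fun z => (extChartAt (𝓡∂ n) x).symm (face n z))
      (face n ⁻¹' (extChartAt (𝓡∂ n) x).target) :=
  (continuousOn_extChartAt_symm x).comp (face n).continuous.continuousOn fun _ hz => hz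

theorem continuousOn_target_of_contDiffWithinAt {Z : Type*} [NormedAddCommGroup Z]
    [NormedSpace ℝ Z] {f : EuclideanSpace ℝ (Fin n) → Z} {x : M}
    (hf : ∀ y ∈ (extChartAt (𝓡∂ n) x).target, ContDiffWithinAt ℝ ∞ f (range (𝓡∂ n)) y) :
    ContinuousOn f (extChartAt (𝓡∂ n) x).target :=
  fun y hy => (hf y hy).continuousWithinAt.mono (extChartAt_target_subset_range x)

theorem continuousOn_normDet (hF : IsSmoothImmersion (n := n) F) (x : M) :
    ContinuousOn (fun y => (coordDeriv F x y).toLinearMap.normDet)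
      (extChartAt (𝓡∂ n) x).target := by
  simp only [normDet_eq_sqrt]
  exact continuousOn_target_of_contDiffWithinAt fun y hy => contDiffWithinAt_sqrt_gramOf_det
    (contDiffWithinAt_coordDeriv hF x hy) (hF.injective_coordDeriv x hy)

theorem continuousOn_normDet_face (hF : IsSmoothImmersion (n := n) F) (x : M) :
    ContinuousOn (fun z => ((coordDeriv F x (face n z)).comp (face n)).toLinearMap.normDet)
      (face n ⁻¹' (extChartAt (𝓡∂ n) x).target) := by
  have h1 : ContinuousOn (fun y => √((gramOf (coordDeriv F x y)).det *
      (gramOf (coordDeriv F x y))⁻¹ 0 0)) (extChartAt (𝓡∂ n) x).target :=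
    ContinuousOn.sqrt (continuousOn_target_of_contDiffWithinAt fun y hy =>
      (contDiffWithinAt_gramOf_det (contDiffWithinAt_coordDeriv hF x hy)).mul
        (contDiffWithinAt_gramOf_inv (contDiffWithinAt_coordDeriv hF x hy)
          (hF.injective_coordDeriv x hy) 0 0))
  refine (h1.comp (face n).continuous.continuousOn fun z hz => hz).congr fun z hz => ?_
  simp only [Function.comp_apply]
  rw [← normDet_face_sq (hF.injective_coordDeriv x hz), Real.sqrt_sq (LinearMap.normDet_nonneg _)]

theorem coordDeriv_eq_comp (hF : IsSmoothImmersion (n := n) F) {x' x : M}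
    {y : EuclideanSpace ℝ (Fin n)} (hy : y ∈ (extChartAt (𝓡∂ n) x').target)
    (hy' : (extChartAt (𝓡∂ n) x').symm y ∈ (extChartAt (𝓡∂ n) x).source) :
    coordDeriv F x' y = (coordDeriv F x (coordChange x' x y)).comp (coordChangeDeriv x' x y) := by
  have h := chartDeriv_eq_comp hF.contMDiff ⟨(extChartAt (𝓡∂ n) x').map_target hy, hy'⟩
  rw [(extChartAt (𝓡∂ n) x').right_inv hy] at h
  exact h

variable [MeasurableSpace M] [BorelSpace M]

theorem chartVolume_apply_eq (hF : IsSmoothImmersion (n := n) F) {x' x : M} {A : Set M}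
    (hA : MeasurableSet A) (hA' : A ⊆ (extChartAt (𝓡∂ n) x').source)
    (hAx : A ⊆ (extChartAt (𝓡∂ n) x).source) :
    chartVolume (n := n) F x' A = chartVolume (n := n) F x A := by
  refine patch_apply_eq (measurableSet_target x') (continuousOn_extChartAt_symm x')
    (measurableSet_target x) (continuousOn_extChartAt_symm x) hA (τ := coordChange x' x)
    (τ' := coordChangeDeriv x' x) ?_ ?_ ?_ ?_
  · rintro y ⟨hyA, hy⟩
    have h := hasFDerivWithinAt_coordChange (n := n) ⟨hA' hyA, hAx hyA⟩
    rw [(extChartAt (𝓡∂ n) x').right_inv hy] at h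
    exact h.mono fun z hz => extChartAt_target_subset_range x' hz.2
  · rintro y ⟨hyA, hy⟩ z ⟨hzA, hz⟩ h
    have h1 := (extChartAt (𝓡∂ n) x).injOn (hAx hyA) (hAx hzA) h
    exact (extChartAt (𝓡∂ n) x').symm.injOn hy hz h1
  · ext y
    constructor
    · rintro ⟨z, ⟨hzA, hz⟩, rfl⟩
      refine ⟨?_, (extChartAt (𝓡∂ n) x).map_source (hAx hzA)⟩
      simp only [coordChange, Function.comp_apply, mem_preimage,
        (extChartAt (𝓡∂ n) x).left_inv (hAx hzA)]
      exact hzA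
    · rintro ⟨hyA, hy⟩
      refine ⟨extChartAt (𝓡∂ n) x' ((extChartAt (𝓡∂ n) x).symm y), ⟨?_, ?_⟩, ?_⟩
      · rw [mem_preimage, (extChartAt (𝓡∂ n) x').left_inv (hA' hyA)]; exact hyA
      · exact (extChartAt (𝓡∂ n) x').map_source (hA' hyA)
      · rw [coordChange_extChartAt (hA' hyA), (extChartAt (𝓡∂ n) x).right_inv hy]
  · rintro y ⟨hyA, hy⟩
    rw [← ENNReal.ofReal_mul (abs_nonneg _), coordDeriv_eq_comp hF hy (hAx hyA)]
    congr 1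
    rw [ContinuousLinearMap.toLinearMap_comp, LinearMap.normDet_comp_of_finrank_eq _ _ rfl,
      LinearMap.normDet_eq_abs_det, mul_comm]

theorem chartVolume_compl_source (x : M) :
    chartVolume (n := n) F x (extChartAt (𝓡∂ n) x).sourceᶜ = 0 := by
  rw [chartVolume, patch_apply (measurableSet_target x) (continuousOn_extChartAt_symm x)
    (isOpen_extChartAt_source x).measurableSet.compl]
  convert! setLIntegral_empty _
  ext y
  simp only [mem_inter_iff, mem_preimage, mem_compl_iff, mem_empty_iff_false, iff_false, not_and]
  exact fun h hy => h ((extChartAt (𝓡∂ n) x).map_target hy)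

theorem volumeM_restrict_source (hF : IsSmoothImmersion (n := n) F) (x : M) :
    (volumeM (n := n) F).restrict (extChartAt (𝓡∂ n) x).source = chartVolume (n := n) F x := by
  refine iSup_restrict_eq (isOpen_extChartAt_source x).measurableSet (fun x' A hAx hA => ?_)
    (chartVolume_compl_source x)
  have hs := (isOpen_extChartAt_source (I := 𝓡∂ n) x').measurableSet
  calc chartVolume (n := n) F x' A
      = chartVolume (n := n) F x' (A ∩ (extChartAt (𝓡∂ n) x').source) :=
        (measure_inter_conull (chartVolume_compl_source x')).symm
    _ = chartVolume (n := n) F x (A ∩ (extChartAt (𝓡∂ n) x').source) :=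
        chartVolume_apply_eq hF (hA.inter hs) inter_subset_right (inter_subset_left.trans hAx)
    _ ≤ chartVolume (n := n) F x A := measure_mono inter_subset_left

theorem chartBoundaryVolume_apply_eq (hF : IsSmoothImmersion (n := n) F) {x' x : M} {A : Set M}
    (hA : MeasurableSet A) (hA' : A ⊆ (extChartAt (𝓡∂ n) x').source)
    (hAx : A ⊆ (extChartAt (𝓡∂ n) x).source) :
    chartBoundaryVolume (n := n) F x' A = chartBoundaryVolume (n := n) F x A := by
  refine patch_apply_eq (measurableSet_face_target x') (continuousOn_boundary_symm x')
    (measurableSet_face_target x) (continuousOn_boundary_symm x) hA (τ := faceCoordChange x' x)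
    (τ' := faceCoordChangeDeriv x' x) ?_ ?_ ?_ ?_
  · rintro z ⟨hzA, hz⟩
    exact (hasFDerivAt_faceCoordChange hz (hAx hzA)).hasFDerivWithinAt
  · rintro y ⟨hyA, hy⟩ z ⟨hzA, hz⟩ h
    have h0 := congrArg (face n) h
    simp only [faceCoordChange] at h0
    rw [face_faceProj (coordChange_face hy (hAx hyA)),
      face_faceProj (coordChange_face hz (hAx hzA))] at h0
    have h1 := (extChartAt (𝓡∂ n) x).injOn (hAx hyA) (hAx hzA) h0
    exact injective_face ((extChartAt (𝓡∂ n) x').symm.injOn hy hz h1)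
  · ext z
    constructor
    · rintro ⟨z, ⟨hzA, hz⟩, rfl⟩
      have h0 : face n (faceCoordChange x' x z) = coordChange x' x (face n z) :=
        face_faceProj (coordChange_face hz (hAx hzA))
      simp only [mem_inter_iff, mem_preimage, h0]
      refine ⟨?_, (extChartAt (𝓡∂ n) x).map_source (hAx hzA)⟩
      simp only [coordChange, Function.comp_apply, (extChartAt (𝓡∂ n) x).left_inv (hAx hzA)]
      exact hzA
    · rintro ⟨hzA, hz⟩
      obtain ⟨p, hp⟩ : ∃ p, p = (extChartAt (𝓡∂ n) x).symm (face n z) := ⟨_, rfl⟩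
      have hpA : p ∈ A := by rw [hp]; exact hzA
      have hpz : extChartAt (𝓡∂ n) x p = face n z := by
        rw [hp, (extChartAt (𝓡∂ n) x).right_inv hz]
      have hb : p ∈ (𝓡∂ n).boundary M := (mem_boundary_iff (hAx hpA)).2 (by
        rw [hpz, face_apply_zero])
      have h1 : face n (faceProj n (extChartAt (𝓡∂ n) x' p)) = extChartAt (𝓡∂ n) x' p :=
        face_faceProj ((mem_boundary_iff (hA' hpA)).1 hb)
      refine ⟨faceProj n (extChartAt (𝓡∂ n) x' p), ⟨?_, ?_⟩, ?_⟩
      · simp only [mem_preimage, h1, (extChartAt (𝓡∂ n) x').left_inv (hA' hpA)]; exact hpA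
      · simp only [mem_preimage, h1]
        exact (extChartAt (𝓡∂ n) x').map_source (hA' hpA)
      · rw [faceCoordChange, h1, coordChange_extChartAt (hA' hpA), hpz, faceProj_face]
  · rintro z ⟨hzA, hz⟩
    have h0 : face n (faceCoordChange x' x z) = coordChange x' x (face n z) :=
      face_faceProj (coordChange_face hz (hAx hzA))
    simp only [h0]
    rw [← ENNReal.ofReal_mul (abs_nonneg _), coordDeriv_eq_comp hF hz (hAx hzA),
      ContinuousLinearMap.comp_assoc, ← face_comp_faceCoordChangeDeriv hz (hAx hzA),
      ← ContinuousLinearMap.comp_assoc]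
    congr 1
    rw [ContinuousLinearMap.toLinearMap_comp, LinearMap.normDet_comp_of_finrank_eq _ _ rfl,
      LinearMap.normDet_eq_abs_det, mul_comm]

theorem chartBoundaryVolume_compl_source (x : M) :
    chartBoundaryVolume (n := n) F x (extChartAt (𝓡∂ n) x).sourceᶜ = 0 := by
  rw [chartBoundaryVolume, patch_apply (measurableSet_face_target x) (continuousOn_boundary_symm x)
    (isOpen_extChartAt_source x).measurableSet.compl]
  convert! setLIntegral_empty _
  ext z
  simp only [mem_inter_iff, mem_preimage, mem_compl_iff, mem_empty_iff_false, iff_false, not_and]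
  exact fun h hy => h ((extChartAt (𝓡∂ n) x).map_target hy)

theorem boundaryVolume_restrict_source (hF : IsSmoothImmersion (n := n) F) (x : M) :
    (boundaryVolume (n := n) F).restrict (extChartAt (𝓡∂ n) x).source =
      chartBoundaryVolume (n := n) F x := by
  refine iSup_restrict_eq (isOpen_extChartAt_source x).measurableSet (fun x' A hAx hA => ?_)
    (chartBoundaryVolume_compl_source x)
  have hs := (isOpen_extChartAt_source (I := 𝓡∂ n) x').measurableSet
  calc chartBoundaryVolume (n := n) F x' A
      = chartBoundaryVolume (n := n) F x' (A ∩ (extChartAt (𝓡∂ n) x').source) :=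
        (measure_inter_conull (chartBoundaryVolume_compl_source x')).symm
    _ = chartBoundaryVolume (n := n) F x (A ∩ (extChartAt (𝓡∂ n) x').source) :=
        chartBoundaryVolume_apply_eq hF (hA.inter hs) inter_subset_right
          (inter_subset_left.trans hAx)
    _ ≤ chartBoundaryVolume (n := n) F x A := measure_mono inter_subset_left

theorem integral_volumeM_of_support (hF : IsSmoothImmersion (n := n) F) (x : M) {f : M → ℝ}
    (hf : AEStronglyMeasurable f (volumeM (n := n) F))
    (hs : ∀ p ∉ (extChartAt (𝓡∂ n) x).source, f p = 0) :
    ∫ p, f p ∂volumeM (n := n) F = ∫ y in (extChartAt (𝓡∂ n) x).target,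
      √(gramOf (coordDeriv F x y)).det * f ((extChartAt (𝓡∂ n) x).symm y) := by
  rw [← setIntegral_eq_integral_of_forall_compl_eq_zero hs, volumeM_restrict_source hF]
  simp only [← normDet_eq_sqrt]
  refine integral_patch (measurableSet_target x) (continuousOn_extChartAt_symm x)
    (continuousOn_normDet hF x) (fun _ => LinearMap.normDet_nonneg _) ?_
  rw [← chartVolume, ← volumeM_restrict_source hF]
  exact hf.restrict

theorem integral_boundaryVolume_of_support (hF : IsSmoothImmersion (n := n) F) (x : M) {f : M → ℝ}
    (hf : AEStronglyMeasurable f (boundaryVolume (n := n) F))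
    (hs : ∀ p ∉ (extChartAt (𝓡∂ n) x).source, f p = 0) :
    ∫ p, f p ∂boundaryVolume (n := n) F = ∫ z in face n ⁻¹' (extChartAt (𝓡∂ n) x).target,
      ((coordDeriv F x (face n z)).comp (face n)).toLinearMap.normDet *
        f ((extChartAt (𝓡∂ n) x).symm (face n z)) := by
  rw [← setIntegral_eq_integral_of_forall_compl_eq_zero hs, boundaryVolume_restrict_source hF]
  refine integral_patch (measurableSet_face_target x) (continuousOn_boundary_symm x)
    (continuousOn_normDet_face hF x) (fun _ => LinearMap.normDet_nonneg _) ?_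
  rw [← chartBoundaryVolume, ← boundaryVolume_restrict_source hF]
  exact hf.restrict

theorem exists_compact_chart_nhds (p : M) : ∃ K : Set (EuclideanSpace ℝ (Fin n)), IsCompact K ∧
    K ⊆ (extChartAt (𝓡∂ n) p).target ∧ ∃ A ∈ 𝓝 p, MeasurableSet A ∧
      A ⊆ (extChartAt (𝓡∂ n) p).source ∧
      (extChartAt (𝓡∂ n) p).symm ⁻¹' A ∩ (extChartAt (𝓡∂ n) p).target ⊆ K := by
  have h := extChartAt_target_mem_nhdsWithin (I := 𝓡∂ n) p
  obtain ⟨r, hr, hsub⟩ := Metric.mem_nhdsWithin_iff.1 h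
  refine ⟨Metric.closedBall (extChartAt (𝓡∂ n) p p) (r / 2) ∩ range (𝓡∂ n),
    (isCompact_closedBall _ _).inter_right isClosed_range_model, ?_, ?_⟩
  · exact (inter_subset_inter_left _ (Metric.closedBall_subset_ball (by linarith))).trans hsub
  · have ho := isOpen_extChartAt_preimage (I := 𝓡∂ n) p
      (Metric.isOpen_ball (x := extChartAt (𝓡∂ n) p p) (ε := r / 2))
    refine ⟨_, ho.mem_nhds ⟨mem_chart_source _ p, Metric.mem_ball_self (by linarith)⟩,
      ho.measurableSet, ?_, ?_⟩
    · rw [extChartAt_source]; exact inter_subset_left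
    · rintro y ⟨hyA, hy⟩
      have := hyA.2
      rw [mem_preimage, (extChartAt (𝓡∂ n) p).right_inv hy] at this
      exact ⟨Metric.ball_subset_closedBall this, extChartAt_target_subset_range p hy⟩

theorem isFiniteMeasure_volumeM [CompactSpace M] (hF : IsSmoothImmersion (n := n) F) :
    IsFiniteMeasure (volumeM (n := n) F) := by
  refine ⟨isCompact_univ.measure_lt_top_of_nhdsWithin fun p _ => ?_⟩
  obtain ⟨K, hK, hKt, A, hAp, hA, hAs, hAK⟩ := exists_compact_chart_nhds (n := n) p
  refine ⟨A, mem_nhdsWithin_of_mem_nhds hAp, ?_⟩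
  rw [← inter_eq_left.2 hAs, ← Measure.restrict_apply hA, volumeM_restrict_source hF]
  exact patch_lt_top (measurableSet_target p) (continuousOn_extChartAt_symm p)
    (continuousOn_normDet hF p) hA hK hKt hAK

theorem isFiniteMeasure_boundaryVolume [CompactSpace M] (hF : IsSmoothImmersion (n := n) F) :
    IsFiniteMeasure (boundaryVolume (n := n) F) := by
  refine ⟨isCompact_univ.measure_lt_top_of_nhdsWithin fun p _ => ?_⟩
  obtain ⟨K, hK, hKt, A, hAp, hA, hAs, hAK⟩ := exists_compact_chart_nhds (n := n) p
  refine ⟨A, mem_nhdsWithin_of_mem_nhds hAp, ?_⟩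
  rw [← inter_eq_left.2 hAs, ← Measure.restrict_apply hA, boundaryVolume_restrict_source hF]
  have hKb : IsCompact (face n ⁻¹' K) := by
    refine (hK.image (faceProj n).continuous).of_isClosed_subset
      (hK.isClosed.preimage (face n).continuous) fun z hz => ⟨face n z, hz, faceProj_face z⟩
  exact patch_lt_top (measurableSet_face_target p) (continuousOn_boundary_symm p)
    (continuousOn_normDet_face hF p) hA hKb (fun z hz => hKt hz) fun z hz => hAK ⟨hz.1, hz.2⟩

theorem isOpenPosMeasure_volumeM (hF : IsSmoothImmersion (n := n) F) :
    (volumeM (n := n) F).IsOpenPosMeasure := by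
  refine ⟨fun O hO ⟨p, hp⟩ h0 => ?_⟩
  have hs := isOpen_extChartAt_source (I := 𝓡∂ n) p
  have h1 : chartVolume (n := n) F p O = 0 := by
    rw [← volumeM_restrict_source hF]
    exact le_antisymm ((Measure.restrict_le_self O).trans h0.le) bot_le
  rw [chartVolume, patch_apply (measurableSet_target p) (continuousOn_extChartAt_symm p)
    hO.measurableSet] at h1
  have hm := measurableSet_preimage_inter (measurableSet_target (n := n) p)
    (continuousOn_extChartAt_symm p) hO.measurableSet
  have hae := (lintegral_eq_zero_iff' (((continuousOn_normDet hF p).aemeasurable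
    (measurableSet_target p)).ennreal_ofReal.mono_measure
      (Measure.restrict_mono inter_subset_right le_rfl))).1 h1
  have h2 : volume ((extChartAt (𝓡∂ n) p).symm ⁻¹' O ∩ (extChartAt (𝓡∂ n) p).target) = 0 := by
    rw [← Measure.restrict_eq_zero, ← ae_eq_bot, ← empty_mem_iff_bot]
    filter_upwards [hae, ae_restrict_mem hm] with y hy hy2
    simp only [Pi.zero_apply, ENNReal.ofReal_eq_zero] at hy
    have := (LinearMap.normDet_ne_zero_tfae (coordDeriv F p y).toLinearMap).out 4 0 |>.1
      (hF.injective_coordDeriv p hy2.2)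
    exact this (le_antisymm hy (LinearMap.normDet_nonneg _))
  have h3 : (extChartAt (𝓡∂ n) p).symm ⁻¹' O ∩ (extChartAt (𝓡∂ n) p).target ∈
      𝓝[range (𝓡∂ n)] (extChartAt (𝓡∂ n) p p) := by
    refine inter_mem ?_ (extChartAt_target_mem_nhdsWithin p)
    rw [← nhdsWithin_extChartAt_target_eq]
    refine (continuousOn_extChartAt_symm p _ (mem_extChartAt_target p)) ?_
    rw [extChartAt_to_inv]
    exact hO.mem_nhds hp
  obtain ⟨G, hG, hpG, hGsub⟩ := mem_nhdsWithin.1 h3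
  have h4 : (G ∩ interior (range (𝓡∂ n))).Nonempty :=
    mem_closure_iff.1 ((𝓡∂ n).range_subset_closure_interior (extChartAt_mem_range p p)) G hG hpG
  exact (hG.inter isOpen_interior).measure_ne_zero volume h4
    (measure_mono_null ((inter_subset_inter_right _ interior_subset).trans hGsub) h2)

theorem measurableSet_boundary : MeasurableSet ((𝓡∂ n).boundary M) :=
  ((𝓡∂ n).isClosed_boundary (n := ∞) (by simp)).measurableSet

theorem volumeM_boundary : volumeM (n := n) F ((𝓡∂ n).boundary M) = 0 := by
  have h : (volumeM (n := n) F).restrict ((𝓡∂ n).boundary M) ≤ 0 := by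
    refine iSup_restrict_le measurableSet_boundary fun x => ?_
    rw [Measure.restrict_eq_zero.2]
    rw [chartVolume, patch_apply (measurableSet_target x) (continuousOn_extChartAt_symm x)
      measurableSet_boundary]
    refine setLIntegral_measure_zero _ _ ?_
    refine measure_mono_null ?_ ((𝓡∂ n).convex_range.addHaar_frontier volume)
    rintro y ⟨hyb, hy⟩
    rw [frontier_range_modelWithCornersEuclideanHalfSpace]
    have := (mem_boundary_iff ((extChartAt (𝓡∂ n) x).map_target hy)).1 hyb
    rw [(extChartAt (𝓡∂ n) x).right_inv hy] at this
    exact this.symm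
  exact Measure.restrict_eq_zero.1 (le_antisymm h bot_le)

theorem boundaryVolume_compl_boundary :
    boundaryVolume (n := n) F ((𝓡∂ n).boundary M)ᶜ = 0 := by
  have h : (boundaryVolume (n := n) F).restrict ((𝓡∂ n).boundary M)ᶜ ≤ 0 := by
    refine iSup_restrict_le measurableSet_boundary.compl fun x => ?_
    rw [Measure.restrict_eq_zero.2]
    rw [chartBoundaryVolume, patch_apply (measurableSet_face_target x)
      (continuousOn_boundary_symm x) measurableSet_boundary.compl]
    convert! setLIntegral_empty _
    ext z
    simp only [mem_inter_iff, mem_preimage, mem_compl_iff, mem_empty_iff_false, iff_false, not_and]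
    refine fun h hz => h ((mem_boundary_iff ((extChartAt (𝓡∂ n) x).map_target hz)).2 ?_)
    rw [(extChartAt (𝓡∂ n) x).right_inv hz, face_apply_zero]
  exact Measure.restrict_eq_zero.1 (le_antisymm h bot_le)

end Volumes

/-! ### The divergence theorem on `M` for the fields `f (a + c F)` -/

section DivergenceTheorem

variable {n N : ℕ} [NeZero n] {M : Type*} [TopologicalSpace M]
  [ChartedSpace (EuclideanHalfSpace n) M] [IsManifold (𝓡∂ n) ∞ M]
  {F : M → EuclideanSpace ℝ (Fin N)}

theorem sum_smul_coWeighted {V : Type*} [NormedAddCommGroup V] [InnerProductSpace ℝ V]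
    (L : EuclideanSpace ℝ (Fin n) →L[ℝ] V) (b : EuclideanSpace ℝ (Fin n) →L[ℝ] ℝ) :
    ∑ i, b (EuclideanSpace.single i 1) • coWeighted L i =
      √(gramOf L).det • gradientOf L b := by
  simp only [coWeighted, gradientOf, Finset.smul_sum, smul_smul]
  rw [Finset.sum_comm]
  refine Finset.sum_congr rfl fun i _ => Finset.sum_congr rfl fun j _ => ?_
  rw [gramOf_inv_symm L j i]
  congr 1
  ring

/-- The coordinate expression of `√g f ⟨∇yⁱ, a + c F⟩`. -/
def chartField (F : M → EuclideanSpace ℝ (Fin N)) (a : EuclideanSpace ℝ (Fin N)) (c : ℝ)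
    (f : M → ℝ) (x : M) (i : Fin n) (y : EuclideanSpace ℝ (Fin n)) : ℝ :=
  f ((extChartAt (𝓡∂ n) x).symm y) *
    inner ℝ (coWeighted (coordDeriv F x y) i) (a + c • F ((extChartAt (𝓡∂ n) x).symm y))

theorem contDiffWithinAt_chartField (hF : IsSmoothImmersion (n := n) F)
    (a : EuclideanSpace ℝ (Fin N)) (c : ℝ) {f : M → ℝ} (hf : ContMDiff (𝓡∂ n) 𝓘(ℝ, ℝ) ∞ f)
    (x : M) (i : Fin n) {y : EuclideanSpace ℝ (Fin n)}
    (hy : y ∈ (extChartAt (𝓡∂ n) x).target) :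
    ContDiffWithinAt ℝ ∞ (chartField F a c f x i) (range (𝓡∂ n)) y :=
  (contDiffWithinAt_chart hf x hy).mul
    ((contDiffWithinAt_coWeighted (contDiffWithinAt_coordDeriv hF x hy)
      (hF.injective_coordDeriv x hy) i).inner ℝ
      (contDiffWithinAt_const.add ((contDiffWithinAt_chart hF.contMDiff x hy).const_smul c)))

theorem sum_fderiv_chartField (hF : IsSmoothImmersion (n := n) F)
    (a : EuclideanSpace ℝ (Fin N)) (c : ℝ) {f : M → ℝ} (hf : ContMDiff (𝓡∂ n) 𝓘(ℝ, ℝ) ∞ f)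
    (x : M) {y : EuclideanSpace ℝ (Fin n)} (hy : y ∈ (extChartAt (𝓡∂ n) x).target)
    (hyi : y ∈ interior (range (𝓡∂ n))) {p : M} (hp : p = (extChartAt (𝓡∂ n) x).symm y) :
    ∑ i, fderiv ℝ (chartField F a c f x i) y (EuclideanSpace.single i 1) =
      √(gramOf (coordDeriv F x y)).det *
        (inner ℝ (riemannianGradient (n := n) F f p) (a + c • F p) +
          f p * (n * c + n * inner ℝ (meanCurvature (n := n) F p) (a + c • F p))) := by
  have hnhds : range (𝓡∂ n) ∈ 𝓝 y := mem_interior_iff_mem_nhds.1 hyi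
  have hps : p ∈ (extChartAt (𝓡∂ n) x).source := hp ▸ (extChartAt (𝓡∂ n) x).map_target hy
  have hpy : extChartAt (𝓡∂ n) x p = y := by rw [hp, (extChartAt (𝓡∂ n) x).right_inv hy]
  have hinj := hF.injective_coordDeriv x hy
  have hD : ContDiffAt ℝ ∞ (coordDeriv F x) y := (contDiffWithinAt_coordDeriv hF x hy).contDiffAt
    hnhds
  have hG : ContDiffAt ℝ ∞ (F ∘ (extChartAt (𝓡∂ n) x).symm) y :=
    (contDiffWithinAt_chart hF.contMDiff x hy).contDiffAt hnhds
  have hev : coordDeriv F x =ᶠ[𝓝 y] fderiv ℝ (F ∘ (extChartAt (𝓡∂ n) x).symm) := by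
    filter_upwards [isOpen_interior.mem_nhds hyi] with z hz
    exact fderivWithin_of_mem_nhds (mem_interior_iff_mem_nhds.1 hz)
  have hsymm : ∀ v w, fderiv ℝ (coordDeriv F x) y v w = fderiv ℝ (coordDeriv F x) y w v := by
    intro v w
    rw [hev.fderiv_eq]
    exact hG.isSymmSndFDerivAt (by simpa using ENat.LEInfty.out) v w
  have hdiv := sum_fderiv_coWeighted (hD.of_le (by simp)) hinj hsymm
  have hGd : HasFDerivAt (F ∘ (extChartAt (𝓡∂ n) x).symm) (coordDeriv F x y) y :=
    (hasFDerivWithinAt_chart hF.contMDiff x hy).hasFDerivAt hnhds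
  have hfd : HasFDerivAt (f ∘ (extChartAt (𝓡∂ n) x).symm) (chartDeriv f x y) y :=
    (hasFDerivWithinAt_chart hf x hy).hasFDerivAt hnhds
  have hi : ∀ i : Fin n, fderiv ℝ (chartField F a c f x i) y (EuclideanSpace.single i 1) =
      inner ℝ (chartDeriv f x y (EuclideanSpace.single i 1) • coWeighted (coordDeriv F x y) i)
        (a + c • F p) +
      f p * inner ℝ (fderiv ℝ (fun z => coWeighted (coordDeriv F x z) i) y
        (EuclideanSpace.single i 1)) (a + c • F p) +
      f p * (c * √(gramOf (coordDeriv F x y)).det) := by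
    intro i
    have hW : DifferentiableAt ℝ (fun z => coWeighted (coordDeriv F x z) i) y :=
      differentiableAt_of_contDiffWithinAt
        (contDiffWithinAt_coWeighted ((hD.of_le (by simp)).contDiffWithinAt) hinj i)
    have h := (hfd.mul (hW.hasFDerivAt.inner ℝ ((hGd.const_smul c).const_add a))).fderiv
    change fderiv ℝ ((f ∘ (extChartAt (𝓡∂ n) x).symm) * fun z =>
      inner ℝ (coWeighted (coordDeriv F x z) i)
        (a + (c • (F ∘ (extChartAt (𝓡∂ n) x).symm)) z)) y _ = _
    rw [h]
    simp only [add_apply, smul_apply, ContinuousLinearMap.comp_apply, smul_eq_mul,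
      ContinuousLinearMap.prod_apply, fderivInnerCLM_apply, Function.comp_apply, Pi.smul_apply,
      ← hp, inner_smul_left, inner_smul_right, conj_trivial, inner_coWeighted hinj, if_true]
    ring
  rw [Finset.sum_congr rfl fun i _ => hi i, Finset.sum_add_distrib, Finset.sum_add_distrib,
    ← sum_inner, sum_smul_coWeighted, ← Finset.mul_sum, ← sum_inner, hdiv,
    riemannianGradient_eq hF hf hps, meanCurvature_eq hF hps, hpy,
    fderivWithin_of_mem_nhds hnhds, inner_smul_left, inner_smul_left]
  simp only [conj_trivial, Finset.sum_const, Finset.card_univ, Fintype.card_fin, nsmul_eq_mul]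
  ring

variable [MeasurableSpace M] [BorelSpace M] [CompactSpace M] [T2Space M]

theorem integrable_of_continuous {Z : Type*} [NormedAddCommGroup Z]
    [SecondCountableTopology Z] {μ : Measure M} [IsFiniteMeasure μ] {g : M → Z}
    (hg : Continuous g) : Integrable g μ := by
  obtain ⟨C, hC⟩ := isCompact_univ.exists_bound_of_continuousOn hg.continuousOn
  exact Integrable.of_bound hg.aestronglyMeasurable C
    (Eventually.of_forall fun p => hC p (mem_univ p))

theorem continuous_divergence (hF : IsSmoothImmersion (n := n) F)
    (a : EuclideanSpace ℝ (Fin N)) (c : ℝ) {f : M → ℝ} (hf : ContMDiff (𝓡∂ n) 𝓘(ℝ, ℝ) ∞ f) :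
    Continuous fun p => inner ℝ (riemannianGradient (n := n) F f p) (a + c • F p) +
      f p * (n * c + n * inner ℝ (meanCurvature (n := n) F p) (a + c • F p)) := by
  have h1 := continuous_riemannianGradient hF hf
  have h2 := continuous_meanCurvature hF
  have h3 := hF.contMDiff.continuous
  have h4 := hf.continuous
  fun_prop

theorem divergence_theorem_of_tsupport (hF : IsFreeBoundaryImmersion (n := n) F)
    (a : EuclideanSpace ℝ (Fin N)) (c : ℝ) {f : M → ℝ} (hf : ContMDiff (𝓡∂ n) 𝓘(ℝ, ℝ) ∞ f)
    (x : M) (hs : tsupport f ⊆ (extChartAt (𝓡∂ n) x).source) :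
    ∫ p, (inner ℝ (riemannianGradient (n := n) F f p) (a + c • F p) +
      f p * (n * c + n * inner ℝ (meanCurvature (n := n) F p) (a + c • F p)))
        ∂volumeM (n := n) F =
      ∫ p, f p * inner ℝ (F p) (a + c • F p) ∂boundaryVolume (n := n) F := by
  have hF' := hF.isSmoothImmersion
  set K := extChartAt (𝓡∂ n) x '' tsupport f with hK
  have hKc : IsCompact K :=
    (isClosed_tsupport f).isCompact.image_of_continuousOn ((continuousOn_extChartAt x).mono hs)
  have hKt : K ⊆ (extChartAt (𝓡∂ n) x).target := by
    rintro _ ⟨p, hp, rfl⟩; exact (extChartAt (𝓡∂ n) x).map_source (hs hp)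
  have hmemK : ∀ y ∈ (extChartAt (𝓡∂ n) x).target, y ∉ K →
      (extChartAt (𝓡∂ n) x).symm y ∉ tsupport f := fun y hy hyK h =>
    hyK ⟨_, h, (extChartAt (𝓡∂ n) x).right_inv hy⟩
  classical
  set V : Fin n → EuclideanSpace ℝ (Fin n) → ℝ := fun i =>
    (extChartAt (𝓡∂ n) x).target.indicator (chartField F a c f x i) with hV
  have hV0 : ∀ i, ∀ y ∉ K, V i y = 0 := by
    intro i y hy
    by_cases hyt : y ∈ (extChartAt (𝓡∂ n) x).target
    · rw [hV]
      simp only [indicator_of_mem hyt, chartField,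
        image_eq_zero_of_notMem_tsupport (hmemK y hyt hy), zero_mul]
    · exact indicator_of_notMem hyt _
  have hVev : ∀ i, ∀ y ∈ (extChartAt (𝓡∂ n) x).target,
      V i =ᶠ[𝓝[range (𝓡∂ n)] y] chartField F a c f x i := fun i y hy => by
    filter_upwards [extChartAt_target_mem_nhdsWithin_of_mem hy] with z hz
      using indicator_of_mem hz _
  have hVd : ∀ i, ∀ y ∈ range (𝓡∂ n), ContDiffWithinAt ℝ ∞ (V i) (range (𝓡∂ n)) y := by
    intro i y hyr
    by_cases hy : y ∈ K
    · exact (contDiffWithinAt_chartField hF' a c hf x i (hKt hy)).congr_of_eventuallyEq_of_mem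
        (hVev i y (hKt hy)) hyr
    · refine (contDiffWithinAt_const (c := (0 : ℝ))).congr_of_eventuallyEq_of_mem ?_ hyr
      filter_upwards [mem_nhdsWithin_of_mem_nhds (hKc.isClosed.isOpen_compl.mem_nhds hy)] with z hz
        using hV0 i z hz
  have hVi : ∀ i, ∀ y ∈ interior (range (𝓡∂ n)), DifferentiableAt ℝ (V i) y := fun i y hy =>
    ((hVd i y (interior_subset hy)).contDiffAt
      (mem_interior_iff_mem_nhds.1 hy)).differentiableAt (by simp)
  have hint_ae : ∀ᵐ y ∂(volume.restrict (range (𝓡∂ n))), y ∈ interior (range (𝓡∂ n)) := by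
    rw [ae_restrict_iff' isClosed_range_model.measurableSet]
    have h0 := (𝓡∂ n).convex_range.addHaar_frontier volume
    rw [measure_eq_zero_iff_ae_notMem] at h0
    filter_upwards [h0] with y hy hyr
    by_contra hcon
    exact hy ⟨subset_closure hyr, hcon⟩
  have hVint : IntegrableOn (fun y => ∑ i, fderiv ℝ (V i) y (EuclideanSpace.single i 1))
      (range (𝓡∂ n)) := by
    have h1 : IntegrableOn
        (fun y => ∑ i, fderivWithin ℝ (V i) (range (𝓡∂ n)) y (EuclideanSpace.single i 1))
        (range (𝓡∂ n)) := by
      refine IntegrableOn.of_forall_sdiff_eq_zero (s := K) ?_ isClosed_range_model.measurableSet ?_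
      · refine ContinuousOn.integrableOn_compact hKc fun y hy => ?_
        have hyr := extChartAt_target_subset_range x (hKt hy)
        refine ContinuousWithinAt.mono (t := range (𝓡∂ n)) ?_
          (hKt.trans (extChartAt_target_subset_range x))
        exact (ContDiffWithinAt.sum (n := ∞) fun i _ =>
          ((hVd i y hyr).fderivWithin_right (m := ∞) (𝓡∂ n).uniqueDiffOn (by simp) hyr).clm_apply
            contDiffWithinAt_const).continuousWithinAt
      · rintro y ⟨hyr, hyK⟩
        refine Finset.sum_eq_zero fun i _ => ?_
        have h0 : V i =ᶠ[𝓝[range (𝓡∂ n)] y] fun _ => 0 := by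
          filter_upwards [mem_nhdsWithin_of_mem_nhds (hKc.isClosed.isOpen_compl.mem_nhds hyK)]
            with z hz using hV0 i z hz
        rw [h0.fderivWithin_eq (hV0 i y hyK)]
        simp
    refine Integrable.congr h1 ?_
    filter_upwards [hint_ae] with y hy
    refine Finset.sum_congr rfl fun i _ => ?_
    rw [fderivWithin_of_mem_nhds (mem_interior_iff_mem_nhds.1 hy)]
  have key := integral_halfSpace_divergence hKc
    (fun i y hy => (hVd i y hy).continuousWithinAt) hVi hV0 hVint
  have hsupp : ∀ p ∉ (extChartAt (𝓡∂ n) x).source, p ∉ tsupport f := fun p hp h => hp (hs h)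
  have hgrad : ∀ p ∉ tsupport f, riemannianGradient (n := n) F f p = 0 := by
    intro p hp
    have h1 : differentialFun (n := n) f p = 0 := by
      have h2 : f =ᶠ[𝓝 p] fun _ => (0 : ℝ) := notMem_tsupport_iff_eventuallyEq.1 hp
      rw [differentialFun, h2.mfderiv_eq]
      exact mfderiv_const
    simp [riemannianGradient, h1]
  have hL := integral_volumeM_of_support hF' x
    (continuous_divergence hF' a c hf).aestronglyMeasurable (fun p hp => by
      rw [hgrad p (hsupp p hp), image_eq_zero_of_notMem_tsupport (hsupp p hp)]; simp)
  have hR := integral_boundaryVolume_of_support hF' x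
    (f := fun p => f p * inner ℝ (F p) (a + c • F p))
    (by
      have h3 := hF.contMDiff.continuous
      have h4 := hf.continuous
      exact Continuous.aestronglyMeasurable (by fun_prop)) (fun p hp => by
      simp only [image_eq_zero_of_notMem_tsupport (hsupp p hp), zero_mul])
  rw [hL, hR]
  have e1 : ∫ y in range (𝓡∂ n), ∑ i, fderiv ℝ (V i) y (EuclideanSpace.single i 1) =
      ∫ y in (extChartAt (𝓡∂ n) x).target,
        ∑ i, fderiv ℝ (V i) y (EuclideanSpace.single i 1) := by
    refine setIntegral_eq_of_subset_of_forall_sdiff_eq_zero isClosed_range_model.measurableSet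
      (extChartAt_target_subset_range x) ?_
    rintro y ⟨-, hy⟩
    refine Finset.sum_eq_zero fun i _ => ?_
    rw [fderiv_eq_zero_of_notMem hKc.isClosed (hV0 i) fun h => hy (hKt h)]
    rfl
  have e2 : ∫ y in (extChartAt (𝓡∂ n) x).target,
        ∑ i, fderiv ℝ (V i) y (EuclideanSpace.single i 1) = ∫ y in (extChartAt (𝓡∂ n) x).target,
      √(gramOf (coordDeriv F x y)).det *
        (inner ℝ (riemannianGradient (n := n) F f ((extChartAt (𝓡∂ n) x).symm y))
          (a + c • F ((extChartAt (𝓡∂ n) x).symm y)) +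
          f ((extChartAt (𝓡∂ n) x).symm y) * (n * c + n * inner ℝ
            (meanCurvature (n := n) F ((extChartAt (𝓡∂ n) x).symm y))
            (a + c • F ((extChartAt (𝓡∂ n) x).symm y)))) := by
    refine integral_congr_ae ?_
    filter_upwards [ae_restrict_mem (measurableSet_target x),
      ae_restrict_of_ae_restrict_of_subset (extChartAt_target_subset_range x) hint_ae] with y hy hyi
    rw [← sum_fderiv_chartField hF' a c hf x hy hyi rfl]
    refine Finset.sum_congr rfl fun i _ => ?_
    have h0 := hVev i y hy
    rw [nhdsWithin_eq_nhds.2 (mem_interior_iff_mem_nhds.1 hyi)] at h0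
    rw [h0.fderiv_eq]
  rw [← e2, ← e1, key, ← integral_neg, ← setIntegral_eq_integral_of_forall_compl_eq_zero
    (s := face n ⁻¹' (extChartAt (𝓡∂ n) x).target)]
  · refine setIntegral_congr_fun (measurableSet_face_target x) fun z hz => ?_
    simp only [hV]
    rw [indicator_of_mem (by exact hz), chartField,
      hF.coWeighted_zero x hz (face_apply_zero z), inner_neg_left, inner_smul_left]
    simp only [conj_trivial]
    ring
  · intro z hz
    simp only [hV]
    rw [indicator_of_notMem (by exact hz), neg_zero]

theorem riemannianGradient_zero (p : M) :
    riemannianGradient (n := n) F (fun _ => (0 : ℝ)) p = 0 := by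
  have h : differentialFun (n := n) (fun _ : M => (0 : ℝ)) p = 0 := mfderiv_const
  simp [riemannianGradient, h]

/-- The divergence theorem for the vector field `f (a + c F)`. -/
theorem divergence_theorem (hF : IsFreeBoundaryImmersion (n := n) F)
    (a : EuclideanSpace ℝ (Fin N)) (c : ℝ) {f : M → ℝ} (hf : ContMDiff (𝓡∂ n) 𝓘(ℝ, ℝ) ∞ f) :
    ∫ p, (inner ℝ (riemannianGradient (n := n) F f p) (a + c • F p) +
      f p * (n * c + n * inner ℝ (meanCurvature (n := n) F p) (a + c • F p)))
        ∂volumeM (n := n) F =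
      ∫ p, f p * inner ℝ (F p) (a + c • F p) ∂boundaryVolume (n := n) F := by
  have hF' := hF.isSmoothImmersion
  have := isFiniteMeasure_volumeM hF'
  have := isFiniteMeasure_boundaryVolume hF'
  obtain ⟨ρ, hρ⟩ := SmoothPartitionOfUnity.exists_isSubordinate_chartAt_source (𝓡∂ n) M
  have hfin := ρ.locallyFinite.finite_nonempty_of_compact
  have hfs : ∀ p, f p = ∑ i ∈ hfin.toFinset, ρ i p * f p := by
    intro p
    have h1 := ρ.sum_eq_one (mem_univ p)
    rw [finsum_eq_sum_of_support_subset (s := hfin.toFinset)] at h1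
    · rw [← Finset.sum_mul, h1, one_mul]
    · intro i hi
      simp only [Finite.coe_toFinset, mem_ofPred_eq]
      exact ⟨p, hi⟩
  have hsm : ∀ i, ContMDiff (𝓡∂ n) 𝓘(ℝ, ℝ) ∞ fun p => ρ i p * f p := fun i =>
    (ρ i).contMDiff.mul hf
  have main : ∀ t : Finset M, ContMDiff (𝓡∂ n) 𝓘(ℝ, ℝ) ∞ (fun p => ∑ i ∈ t, ρ i p * f p) ∧
      ∫ p, (inner ℝ (riemannianGradient (n := n) F (fun p => ∑ i ∈ t, ρ i p * f p) p)
          (a + c • F p) + (∑ i ∈ t, ρ i p * f p) *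
            (n * c + n * inner ℝ (meanCurvature (n := n) F p) (a + c • F p)))
        ∂volumeM (n := n) F =
      ∫ p, (∑ i ∈ t, ρ i p * f p) * inner ℝ (F p) (a + c • F p) ∂boundaryVolume (n := n) F := by
    classical
    intro t
    induction t using Finset.induction_on with
    | empty =>
      simp only [Finset.sum_empty, riemannianGradient_zero]
      exact ⟨contMDiff_const, by simp⟩
    | insert i t hi ih =>
      simp only [Finset.sum_insert hi]
      refine ⟨(hsm i).add ih.1, ?_⟩
      have h1 := divergence_theorem_of_tsupport hF a c (hsm i) i
        ((tsupport_mul_subset_left.trans (hρ i)).trans (by rw [extChartAt_source]))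
      have e1 := integral_add
        (integrable_of_continuous (continuous_divergence hF' a c (hsm i)))
        (integrable_of_continuous (continuous_divergence hF' a c ih.1))
        (μ := volumeM (n := n) F)
      have hc : ∀ {g : M → ℝ}, ContMDiff (𝓡∂ n) 𝓘(ℝ, ℝ) ∞ g →
          Continuous fun p => g p * inner ℝ (F p) (a + c • F p) := fun hg => by
        have h3 := hF.contMDiff.continuous
        have h4 := hg.continuous
        fun_prop
      have e2 := integral_add (integrable_of_continuous (hc (hsm i)))
        (integrable_of_continuous (hc ih.1)) (μ := boundaryVolume (n := n) F)
      rw [h1, ih.2, ← e2] at e1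
      refine (Eq.trans ?_ e1).trans ?_
      · refine integral_congr_ae (Eventually.of_forall fun p => ?_)
        simp only [riemannianGradient_add (hsm i) ih.1, inner_add_left]
        ring
      · refine integral_congr_ae (Eventually.of_forall fun p => ?_)
        simp only
        ring
  have h := (main hfin.toFinset).2
  simp only [← hfs] at h
  exact h

end DivergenceTheorem

/-! ### Sobolev functions -/

section Sobolev

variable {n N : ℕ} [NeZero n] {M : Type*} [TopologicalSpace M]
  [ChartedSpace (EuclideanHalfSpace n) M] [IsManifold (𝓡∂ n) ∞ M]
  {F : M → EuclideanSpace ℝ (Fin N)}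

theorem tendsto_integral_inner {α Z ι : Type*} [MeasurableSpace α] {μ : Measure α}
    [NormedAddCommGroup Z] [InnerProductSpace ℝ Z] {l : Filter ι} {f g : ι → α → Z} {f₀ g₀ : α → Z}
    (hf : ∀ j, MemLp (f j) 2 μ) (hg : ∀ j, MemLp (g j) 2 μ) (hf₀ : MemLp f₀ 2 μ)
    (hg₀ : MemLp g₀ 2 μ) (hfl : Tendsto (fun j => eLpNorm (f j - f₀) 2 μ) l (𝓝 0))
    (hgl : Tendsto (fun j => eLpNorm (g j - g₀) 2 μ) l (𝓝 0)) :
    Tendsto (fun j => ∫ x, inner ℝ (f j x) (g j x) ∂μ) l (𝓝 (∫ x, inner ℝ (f₀ x) (g₀ x) ∂μ)) := by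
  have h1 := (Lp.tendsto_Lp_iff_tendsto_eLpNorm'' f hf f₀ hf₀).2 hfl
  have h2 := (Lp.tendsto_Lp_iff_tendsto_eLpNorm'' g hg g₀ hg₀).2 hgl
  have e : ∀ {a b : α → Z} (ha : MemLp a 2 μ) (hb : MemLp b 2 μ),
      inner ℝ (ha.toLp a) (hb.toLp b) = ∫ x, inner ℝ (a x) (b x) ∂μ := by
    intro a b ha hb
    rw [L2.inner_def]
    refine integral_congr_ae ?_
    filter_upwards [ha.coeFn_toLp, hb.coeFn_toLp] with x hx hy
    rw [hx, hy]
  have h3 := h1.inner (𝕜 := ℝ) h2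
  simpa only [e] using h3

theorem integrable_inner_of_memLp {α Z : Type*} [MeasurableSpace α] {μ : Measure α}
    [NormedAddCommGroup Z] [InnerProductSpace ℝ Z] {f g : α → Z} (hf : MemLp f 2 μ)
    (hg : MemLp g 2 μ) : Integrable (fun x => inner ℝ (f x) (g x)) μ := by
  refine (L2.integrable_inner (𝕜 := ℝ) (hf.toLp f) (hg.toLp g)).congr ?_
  filter_upwards [hf.coeFn_toLp, hg.coeFn_toLp] with x hx hy
  rw [hx, hy]

theorem tendsto_eLpNorm_of_le {α Z W ι : Type*} [MeasurableSpace α] {μ : Measure α}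
    [NormedAddCommGroup Z] [NormedAddCommGroup W] {l : Filter ι} {f : ι → α → Z} {f₀ : α → Z}
    {g : ι → α → W} {g₀ : α → W} {C : ℝ}
    (hfl : Tendsto (fun j => eLpNorm (f j - f₀) 2 μ) l (𝓝 0))
    (h : ∀ j x, ‖g j x - g₀ x‖ ≤ C * ‖f j x - f₀ x‖) :
    Tendsto (fun j => eLpNorm (g j - g₀) 2 μ) l (𝓝 0) := by
  have h1 : Tendsto (fun j => ENNReal.ofReal C * eLpNorm (f j - f₀) 2 μ) l (𝓝 0) := by
    simpa using ENNReal.Tendsto.const_mul hfl (Or.inr ENNReal.ofReal_ne_top)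
  exact tendsto_of_tendsto_of_tendsto_of_le_of_le tendsto_const_nhds h1 (fun _ => zero_le)
    fun j => eLpNorm_le_mul_eLpNorm_of_ae_le_mul (Eventually.of_forall fun x => h j x) 2

variable [MeasurableSpace M] [BorelSpace M] [CompactSpace M] [T2Space M]

theorem memLp_of_continuous {Z : Type*} [NormedAddCommGroup Z] [SecondCountableTopology Z]
    {μ : Measure M} [IsFiniteMeasure μ] {g : M → Z} (hg : Continuous g) : MemLp g 2 μ := by
  obtain ⟨C, hC⟩ := isCompact_univ.exists_bound_of_continuousOn hg.continuousOn
  exact MemLp.of_bound hg.aestronglyMeasurable C (Eventually.of_forall fun p => hC p (mem_univ p))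

theorem memLp_continuous_smul {Z : Type*} [NormedAddCommGroup Z] [NormedSpace ℝ Z]
    [SecondCountableTopology Z] {μ : Measure M} {g : M → ℝ} (hg : MemLp g 2 μ) {b : M → Z}
    (hb : Continuous b) : MemLp (fun p => g p • b p) 2 μ := by
  obtain ⟨C, hC⟩ := isCompact_univ.exists_bound_of_continuousOn hb.continuousOn
  refine MemLp.of_le_mul (c := C) hg (hg.1.smul hb.aestronglyMeasurable)
    (Eventually.of_forall fun p => ?_)
  rw [norm_smul, mul_comm]
  exact mul_le_mul_of_nonneg_right (hC p (mem_univ p)) (norm_nonneg _)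

theorem tendsto_eLpNorm_smul {Z : Type*} [NormedAddCommGroup Z] [NormedSpace ℝ Z]
    {μ : Measure M} {g : ℕ → M → ℝ} {g₀ : M → ℝ} {b : M → Z} (hb : Continuous b)
    (h : Tendsto (fun j => eLpNorm (g j - g₀) 2 μ) atTop (𝓝 0)) :
    Tendsto (fun j => eLpNorm ((fun p => g j p • b p) - fun p => g₀ p • b p) 2 μ) atTop
      (𝓝 0) := by
  obtain ⟨C, hC⟩ := isCompact_univ.exists_bound_of_continuousOn hb.continuousOn
  refine tendsto_eLpNorm_of_le (C := C) h fun j p => ?_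
  rw [← sub_smul, norm_smul, mul_comm]
  exact mul_le_mul_of_nonneg_right (hC p (mem_univ p)) (norm_nonneg _)

/-- An integral identity, bilinear in `(v, ∇v)` and `g`, passes to limits in `H₁²` and `L²`. -/
theorem integral_eq_zero_of_tendsto {μ : Measure M} [IsFiniteMeasure μ]
    {v : ℕ → M → ℝ} {G : ℕ → M → EuclideanSpace ℝ (Fin N)} {g : ℕ → M → ℝ} {u g₀ : M → ℝ}
    {X : M → EuclideanSpace ℝ (Fin N)}
    (hv : ∀ j, MemLp (v j) 2 μ) (hG : ∀ j, MemLp (G j) 2 μ) (hg : ∀ j, MemLp (g j) 2 μ)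
    (hu : MemLp u 2 μ) (hX : MemLp X 2 μ) (hg₀ : MemLp g₀ 2 μ)
    (hvl : Tendsto (fun j => eLpNorm (v j - u) 2 μ) atTop (𝓝 0))
    (hGl : Tendsto (fun j => eLpNorm (G j - X) 2 μ) atTop (𝓝 0))
    (hgl : Tendsto (fun j => eLpNorm (g j - g₀) 2 μ) atTop (𝓝 0))
    {Z : M → EuclideanSpace ℝ (Fin N)} {b : M → ℝ} (hZ : Continuous Z) (hb : Continuous b)
    (h : ∀ j, ∫ p, (inner ℝ (G j p) (g j p • Z p) + v j p * (g j p * b p)) ∂μ = 0) :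
    ∫ p, (inner ℝ (X p) (g₀ p • Z p) + u p * (g₀ p * b p)) ∂μ = 0 := by
  have h1 := tendsto_integral_inner hG (fun j => memLp_continuous_smul (hg j) hZ) hX
    (memLp_continuous_smul hg₀ hZ) hGl (tendsto_eLpNorm_smul hZ hgl)
  have h2 := tendsto_integral_inner hv (fun j => memLp_continuous_smul (hg j) hb) hu
    (memLp_continuous_smul hg₀ hb) hvl (tendsto_eLpNorm_smul hb hgl)
  have e : ∀ {G : M → EuclideanSpace ℝ (Fin N)} {g v : M → ℝ} (_ : MemLp G 2 μ) (_ : MemLp g 2 μ)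
      (_ : MemLp v 2 μ), ∫ p, (inner ℝ (G p) (g p • Z p) + v p * (g p * b p)) ∂μ =
        ∫ p, inner ℝ (G p) (g p • Z p) ∂μ + ∫ p, inner ℝ (v p) (g p • b p) ∂μ := by
    intro G g v hG hg hv
    rw [← integral_add (integrable_inner_of_memLp hG (memLp_continuous_smul hg hZ))
      (integrable_inner_of_memLp hv (memLp_continuous_smul hg hb))]
    refine integral_congr_ae (Eventually.of_forall fun p => ?_)
    simp only [smul_eq_mul, RCLike.inner_apply, conj_trivial]
    ring
  have h3 := h1.add h2
  rw [← e hX hg₀ hu] at h3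
  refine tendsto_nhds_unique h3 (tendsto_const_nhds.congr fun j => ?_)
  rw [← h j, e (hG j) (hg j) (hv j)]

/-- The function `1 - |F|²`, which defines the boundary. -/
def boundaryDefect (F : M → EuclideanSpace ℝ (Fin N)) (p : M) : ℝ := 1 - ‖F p‖ ^ 2

/-- An approximation of the indicator function of the interior, vanishing on the boundary. -/
def interiorCutoff (F : M → EuclideanSpace ℝ (Fin N)) (ε : ℝ) (p : M) : ℝ :=
  boundaryDefect F p / (boundaryDefect F p + ε)

/-- A weight on `M` that concentrates on the boundary as `ε → 0`. -/
def boundaryWeight (n : ℕ) [NeZero n] {M : Type*} [TopologicalSpace M]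
    [ChartedSpace (EuclideanHalfSpace n) M] (F : M → EuclideanSpace ℝ (Fin N)) (ε : ℝ) (p : M) :
    ℝ :=
  -inner ℝ (riemannianGradient (n := n) F (interiorCutoff F ε) p) (F p)

theorem contMDiff_boundaryDefect (hF : IsSmoothImmersion (n := n) F) :
    ContMDiff (𝓡∂ n) 𝓘(ℝ, ℝ) ∞ (boundaryDefect F) :=
  contMDiff_const.sub ((contDiff_norm_sq ℝ).contMDiff.comp hF.contMDiff)

theorem IsFreeBoundaryImmersion.boundaryDefect_nonneg (hF : IsFreeBoundaryImmersion (n := n) F)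
    (p : M) : 0 ≤ boundaryDefect F p := by
  have h : ‖F p‖ ≤ 1 := by simpa using hF.mem_ball p
  exact sub_nonneg.2 (pow_le_one₀ (norm_nonneg _) h)

theorem IsFreeBoundaryImmersion.norm_eq_one (hF : IsFreeBoundaryImmersion (n := n) F)
    {p : M} (hp : p ∈ (𝓡∂ n).boundary M) : ‖F p‖ = 1 := by
  rw [← hF.preimage_sphere] at hp; simpa using hp

theorem IsFreeBoundaryImmersion.boundaryDefect_eq_zero (hF : IsFreeBoundaryImmersion (n := n) F)
    {p : M} (hp : p ∈ (𝓡∂ n).boundary M) : boundaryDefect F p = 0 := by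
  rw [boundaryDefect, hF.norm_eq_one hp]; norm_num

theorem IsFreeBoundaryImmersion.boundaryDefect_pos (hF : IsFreeBoundaryImmersion (n := n) F)
    {p : M} (hp : p ∉ (𝓡∂ n).boundary M) : 0 < boundaryDefect F p := by
  refine (hF.boundaryDefect_nonneg p).lt_of_ne fun h => hp ?_
  rw [← hF.preimage_sphere, mem_preimage, mem_sphere_zero_iff_norm]
  rw [boundaryDefect, eq_comm, sub_eq_zero] at h
  exact (pow_eq_one_iff_of_nonneg (norm_nonneg _) two_ne_zero).1 h.symm

theorem contMDiff_interiorCutoff (hF : IsFreeBoundaryImmersion (n := n) F) {ε : ℝ} (hε : 0 < ε) :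
    ContMDiff (𝓡∂ n) 𝓘(ℝ, ℝ) ∞ (interiorCutoff F ε) := by
  have h := contMDiff_boundaryDefect hF.isSmoothImmersion
  exact h.div₀ (h.add contMDiff_const) fun p =>
    (add_pos_of_nonneg_of_pos (hF.boundaryDefect_nonneg p) hε).ne'

theorem inner_gradient_boundaryDefect (hF : IsSmoothImmersion (n := n) F) (p : M) :
    inner ℝ (riemannianGradient (n := n) F (boundaryDefect F) p) (F p) ≤ 0 := by
  obtain ⟨w, hw⟩ := riemannianGradient_mem_range (n := n) (F := F) (boundaryDefect F) p
  rw [ContinuousLinearMap.coe_coe] at hw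
  have h1 := inner_riemannianGradient hF (boundaryDefect F) p w
  have hy := mem_extChartAt_target (I := 𝓡∂ n) p
  have hd : differentialFun (n := n) (boundaryDefect F) p w =
      -(2 * inner ℝ (F p) (differential (n := n) F p w)) := by
    have h2 := (((hasFDerivWithinAt_chart hF.contMDiff p hy).norm_sq).const_sub 1).fderivWithin
      (uniqueDiffWithinAt_of_mem_target hy)
    rw [differentialFun_eq (contMDiff_boundaryDefect hF), differential,
      mfderiv_eq_chartDeriv hF.contMDiff]
    have h3 : chartDeriv (boundaryDefect F) p (extChartAt (𝓡∂ n) p p) = _ := h2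
    rw [h3]
    simp only [Function.comp_apply, extChartAt_to_inv, neg_apply,
      smul_apply, ContinuousLinearMap.comp_apply, innerSL_apply_apply,
      nsmul_eq_mul, Nat.cast_ofNat]
  rw [hd, hw, real_inner_self_eq_norm_sq, real_inner_comm] at h1
  nlinarith [sq_nonneg ‖riemannianGradient (n := n) F (boundaryDefect F) p‖]

theorem boundaryWeight_nonneg (hF : IsFreeBoundaryImmersion (n := n) F) {ε : ℝ} (hε : 0 < ε)
    (p : M) : 0 ≤ boundaryWeight n F ε p := by
  have hρ := hF.boundaryDefect_nonneg p
  have hne : boundaryDefect F p + ε ≠ 0 := by positivity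
  have hd : HasDerivAt (fun t : ℝ => t / (t + ε)) (ε / (boundaryDefect F p + ε) ^ 2)
      (boundaryDefect F p) := by
    have h := (hasDerivAt_id (boundaryDefect F p)).div
      ((hasDerivAt_id (boundaryDefect F p)).add_const ε) hne
    refine h.congr_deriv ?_
    simp
  have h := riemannianGradient_comp (F := F) (contMDiff_boundaryDefect hF.isSmoothImmersion) hd
    (contMDiff_interiorCutoff hF hε)
  have h' : riemannianGradient (n := n) F (interiorCutoff F ε) p = _ := h
  rw [boundaryWeight, h', inner_smul_left, neg_nonneg]
  exact mul_nonpos_of_nonneg_of_nonpos (by simp; positivity)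
    (inner_gradient_boundaryDefect hF.isSmoothImmersion p)

theorem continuous_boundaryWeight (hF : IsFreeBoundaryImmersion (n := n) F) {ε : ℝ} (hε : 0 < ε) :
    Continuous (boundaryWeight n F ε) := by
  have h1 := continuous_riemannianGradient hF.isSmoothImmersion (contMDiff_interiorCutoff hF hε)
  have h2 := hF.contMDiff.continuous
  exact (h1.inner h2).neg

/-- The divergence of `f F`. -/
def positionDivergence (n : ℕ) [NeZero n] {M : Type*} [TopologicalSpace M]
    [ChartedSpace (EuclideanHalfSpace n) M] (F : M → EuclideanSpace ℝ (Fin N)) (f : M → ℝ)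
    (X : M → EuclideanSpace ℝ (Fin N)) (p : M) : ℝ :=
  inner ℝ (X p) (F p) + f p * (n + n * inner ℝ (meanCurvature (n := n) F p) (F p))

theorem integral_positionDivergence (hF : IsFreeBoundaryImmersion (n := n) F) {f : M → ℝ}
    (hf : ContMDiff (𝓡∂ n) 𝓘(ℝ, ℝ) ∞ f) :
    ∫ p, positionDivergence n F f (riemannianGradient (n := n) F f) p ∂volumeM (n := n) F =
      ∫ p, f p ∂boundaryVolume (n := n) F := by
  have h := divergence_theorem hF 0 1 hf
  simp only [zero_add, one_smul, mul_one] at h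
  refine h.trans (integral_congr_ae ?_)
  have hb : ∀ᵐ p ∂boundaryVolume (n := n) F, p ∈ (𝓡∂ n).boundary M := boundaryVolume_compl_boundary
  filter_upwards [hb] with p hp
  rw [real_inner_self_eq_norm_sq, hF.norm_eq_one hp]; ring

theorem continuous_positionDivergence (hF : IsSmoothImmersion (n := n) F) {f : M → ℝ}
    (hf : ContMDiff (𝓡∂ n) 𝓘(ℝ, ℝ) ∞ f) :
    Continuous (positionDivergence n F f (riemannianGradient (n := n) F f)) := by
  have h := continuous_divergence hF 0 1 hf
  simp only [zero_add, one_smul, mul_one] at h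
  exact h

theorem integral_mul_boundaryWeight (hF : IsFreeBoundaryImmersion (n := n) F) {ε : ℝ} (hε : 0 < ε)
    {f : M → ℝ} (hf : ContMDiff (𝓡∂ n) 𝓘(ℝ, ℝ) ∞ f) :
    ∫ p, (interiorCutoff F ε p * positionDivergence n F f (riemannianGradient (n := n) F f) p -
      f p * boundaryWeight n F ε p) ∂volumeM (n := n) F = 0 := by
  have hc := contMDiff_interiorCutoff hF hε
  have h := integral_positionDivergence hF (f := fun p => f p * interiorCutoff F ε p) (hf.mul hc)
  have hb : ∀ᵐ p ∂boundaryVolume (n := n) F, p ∈ (𝓡∂ n).boundary M := boundaryVolume_compl_boundary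
  have h0 : ∫ p, f p * interiorCutoff F ε p ∂boundaryVolume (n := n) F = 0 := by
    refine integral_eq_zero_of_ae ?_
    filter_upwards [hb] with p hp
    simp [interiorCutoff, hF.boundaryDefect_eq_zero hp]
  rw [h0] at h
  rw [← h]
  refine integral_congr_ae (Eventually.of_forall fun p => ?_)
  simp only [positionDivergence, boundaryWeight, riemannianGradient_mul hf hc, inner_add_left,
    inner_smul_left, conj_trivial]
  ring

theorem tendsto_integral_interiorCutoff (hF : IsFreeBoundaryImmersion (n := n) F) {k : M → ℝ}
    (hk : Integrable k (volumeM (n := n) F)) :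
    Tendsto (fun ε => ∫ p, interiorCutoff F ε p * k p ∂volumeM (n := n) F) (𝓝[>] 0)
      (𝓝 (∫ p, k p ∂volumeM (n := n) F)) := by
  have hb : ∀ᵐ p ∂volumeM (n := n) F, p ∉ (𝓡∂ n).boundary M :=
    measure_eq_zero_iff_ae_notMem.1 volumeM_boundary
  refine tendsto_integral_filter_of_dominated_convergence (fun p => ‖k p‖) ?_ ?_ hk.norm ?_
  · filter_upwards [self_mem_nhdsWithin] with ε hε
    exact (contMDiff_interiorCutoff hF hε).continuous.aestronglyMeasurable.mul hk.1
  · filter_upwards [self_mem_nhdsWithin] with ε (hε : 0 < ε)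
    refine Eventually.of_forall fun p => ?_
    have hρ := hF.boundaryDefect_nonneg p
    rw [norm_mul]
    refine mul_le_of_le_one_left (norm_nonneg _) ?_
    rw [interiorCutoff, Real.norm_of_nonneg (by positivity)]
    exact div_le_one_of_le₀ (by linarith) (by positivity)
  · filter_upwards [hb] with p hp
    have hρ := hF.boundaryDefect_pos hp
    have h1 : Tendsto (fun ε => boundaryDefect F p / (boundaryDefect F p + ε)) (𝓝[>] 0)
        (𝓝 (boundaryDefect F p / (boundaryDefect F p + 0))) := by
      refine Tendsto.mono_left ?_ nhdsWithin_le_nhds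
      exact tendsto_const_nhds.div (tendsto_const_nhds.add tendsto_id) (by simpa using hρ.ne')
    rw [add_zero, div_self hρ.ne'] at h1
    simpa [interiorCutoff] using h1.mul_const (k p)

theorem tendsto_integral_boundaryWeight (hF : IsFreeBoundaryImmersion (n := n) F) {f : M → ℝ}
    (hf : ContMDiff (𝓡∂ n) 𝓘(ℝ, ℝ) ∞ f) :
    Tendsto (fun ε => ∫ p, f p * boundaryWeight n F ε p ∂volumeM (n := n) F) (𝓝[>] 0)
      (𝓝 (∫ p, f p ∂boundaryVolume (n := n) F)) := by
  have := isFiniteMeasure_volumeM hF.isSmoothImmersion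
  have hd := continuous_positionDivergence hF.isSmoothImmersion hf
  have h := tendsto_integral_interiorCutoff hF (integrable_of_continuous hd)
  rw [integral_positionDivergence hF hf] at h
  refine h.congr' ?_
  filter_upwards [self_mem_nhdsWithin] with ε hε
  have h1 := integral_mul_boundaryWeight hF hε hf
  have k1 : Integrable (fun p => interiorCutoff F ε p *
      positionDivergence n F f (riemannianGradient (n := n) F f) p) (volumeM (n := n) F) :=
    integrable_of_continuous ((contMDiff_interiorCutoff hF hε).continuous.mul hd)
  have k2 : Integrable (fun p => f p * boundaryWeight n F ε p) (volumeM (n := n) F) :=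
    integrable_of_continuous (hf.continuous.mul (continuous_boundaryWeight hF hε))
  rwa [integral_sub k1 k2, sub_eq_zero] at h1

/-- The weighted measures converge weakly to the boundary measure. -/
theorem eq_integral_boundaryVolume_of_tendsto (hF : IsFreeBoundaryImmersion (n := n) F) {g : M → ℝ}
    (hg : Continuous g) {A : ℝ}
    (h : Tendsto (fun ε => ∫ p, g p * boundaryWeight n F ε p ∂volumeM (n := n) F) (𝓝[>] 0)
      (𝓝 A)) : A = ∫ p, g p ∂boundaryVolume (n := n) F := by
  have := isFiniteMeasure_volumeM hF.isSmoothImmersion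
  have := isFiniteMeasure_boundaryVolume hF.isSmoothImmersion
  set m := (boundaryVolume (n := n) F).real univ with hm
  have hm0 : 0 ≤ m := measureReal_nonneg
  have key : ∀ δ > 0, |A - ∫ p, g p ∂boundaryVolume (n := n) F| ≤ 2 * δ * m := by
    intro δ hδ
    obtain ⟨f, hf⟩ := exists_contMDiffMap_forall_mem_convex_of_local_const (𝓡∂ n) (n := (⊤ : ℕ∞))
      (t := fun p => Metric.ball (g p) δ) (fun p => convex_ball _ _) (fun p => ⟨g p, by
        filter_upwards [hg.continuousAt.eventually (Metric.ball_mem_nhds (g p) hδ)] with q hq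
        rw [Metric.mem_ball, dist_comm]; exact hq⟩)
    have hfg : ∀ p, |g p - f p| ≤ δ := fun p => by
      have := hf p
      rw [Metric.mem_ball, dist_comm, Real.dist_eq] at this
      exact this.le
    have hone := tendsto_integral_boundaryWeight hF (n := n) (F := F) (f := fun _ => (1 : ℝ))
      contMDiff_const
    have hfl := tendsto_integral_boundaryWeight hF f.contMDiff
    have h1 : |A - ∫ p, f p ∂boundaryVolume (n := n) F| ≤ δ * m := by
      have hl := (h.sub hfl).abs
      have hr := hone.const_mul δ
      simp only [integral_const, smul_eq_mul, mul_one, ← hm, one_mul] at hr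
      refine le_of_tendsto_of_tendsto hl hr ?_
      filter_upwards [self_mem_nhdsWithin] with ε hε
      have hw := continuous_boundaryWeight hF hε
      have hw0 := boundaryWeight_nonneg hF hε
      have k1 : Integrable (fun p => g p * boundaryWeight n F ε p) (volumeM (n := n) F) :=
        integrable_of_continuous (hg.mul hw)
      have k2 : Integrable (fun p => f p * boundaryWeight n F ε p) (volumeM (n := n) F) :=
        integrable_of_continuous (f.contMDiff.continuous.mul hw)
      rw [← integral_sub k1 k2, ← integral_const_mul]
      refine (abs_integral_le_integral_abs).trans (integral_mono
        (integrable_of_continuous (by fun_prop)) (integrable_of_continuous (by fun_prop))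
        fun p => ?_)
      simp only
      rw [← sub_mul, abs_mul, abs_of_nonneg (hw0 p)]
      exact mul_le_mul_of_nonneg_right (hfg p) (hw0 p)
    have h2 : |∫ p, f p ∂boundaryVolume (n := n) F - ∫ p, g p ∂boundaryVolume (n := n) F| ≤
        δ * m := by
      rw [← integral_sub (integrable_of_continuous f.contMDiff.continuous)
        (integrable_of_continuous hg), ← Real.norm_eq_abs]
      exact norm_integral_le_of_norm_le_const (Eventually.of_forall fun p => by
        rw [Real.norm_eq_abs, abs_sub_comm]; exact hfg p)
    calc _ ≤ _ := abs_sub_le A (∫ p, f p ∂boundaryVolume (n := n) F) _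
      _ ≤ 2 * δ * m := by linarith
  have h0 : |A - ∫ p, g p ∂boundaryVolume (n := n) F| ≤ 0 := by
    refine le_of_forall_pos_le_add fun e he => ?_
    refine (key (e / (2 * (m + 1))) (by positivity)).trans ?_
    have : 2 * (e / (2 * (m + 1))) * m = e * (m / (m + 1)) := by field_simp
    rw [this, zero_add]
    exact mul_le_of_le_one_right he.le (div_le_one_of_le₀ (by linarith) (by positivity))
  exact sub_eq_zero.1 (abs_nonpos_iff.1 h0)

variable {u : M → ℝ} {X : M → EuclideanSpace ℝ (Fin N)}

theorem HasSobolevGradient.integral_eq_zero (hF : IsSmoothImmersion (n := n) F)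
    (hX : HasSobolevGradient (n := n) F u X) {Z : M → EuclideanSpace ℝ (Fin N)} {b : M → ℝ}
    (hZ : Continuous Z) (hb : Continuous b)
    (h : ∀ v : M → ℝ, ContMDiff (𝓡∂ n) 𝓘(ℝ, ℝ) ∞ v →
      ∫ p, (inner ℝ (riemannianGradient (n := n) F v p) (v p • Z p) + v p * (v p * b p))
        ∂volumeM (n := n) F = 0) :
    ∫ p, (inner ℝ (X p) (u p • Z p) + u p * (u p * b p)) ∂volumeM (n := n) F = 0 := by
  have := isFiniteMeasure_volumeM hF
  obtain ⟨v, hv, hvu, hvX⟩ := hX.approx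
  exact integral_eq_zero_of_tendsto (fun j => memLp_of_continuous (hv j).continuous)
    (fun j => memLp_of_continuous (continuous_riemannianGradient hF (hv j)))
    (fun j => memLp_of_continuous (hv j).continuous) hX.memLp hX.memLp_gradient hX.memLp
    hvu hvX hvu hZ hb fun j => h _ (hv j)

theorem HasSobolevGradient.integral_eq_zero' (hF : IsSmoothImmersion (n := n) F)
    (hX : HasSobolevGradient (n := n) F u X) {Z : M → EuclideanSpace ℝ (Fin N)} {b : M → ℝ}
    (hZ : Continuous Z) (hb : Continuous b)
    (h : ∀ v : M → ℝ, ContMDiff (𝓡∂ n) 𝓘(ℝ, ℝ) ∞ v →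
      ∫ p, (inner ℝ (riemannianGradient (n := n) F v p) (Z p) + v p * b p)
        ∂volumeM (n := n) F = 0) :
    ∫ p, (inner ℝ (X p) (Z p) + u p * b p) ∂volumeM (n := n) F = 0 := by
  have := isFiniteMeasure_volumeM hF
  obtain ⟨v, hv, hvu, hvX⟩ := hX.approx
  have h1 := integral_eq_zero_of_tendsto (g := fun _ _ => 1) (g₀ := fun _ => 1)
    (fun j => memLp_of_continuous (hv j).continuous)
    (fun j => memLp_of_continuous (continuous_riemannianGradient hF (hv j)))
    (fun j => memLp_of_continuous continuous_const) hX.memLp hX.memLp_gradient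
    (memLp_of_continuous continuous_const) hvu hvX (by simp) hZ hb
    fun j => by simpa using h _ (hv j)
  simpa using h1

theorem integral_inner_meanCurvature (hF : IsSmoothImmersion (n := n) F)
    (hX : HasSobolevGradient (n := n) F u X) :
    ∫ p, inner ℝ (X p) (u p • meanCurvature (n := n) F p) ∂volumeM (n := n) F = 0 := by
  have h := hX.integral_eq_zero hF (continuous_meanCurvature hF) (b := fun _ => 0)
    continuous_const fun v _ => by
      simp [inner_smul_right, inner_riemannianGradient_meanCurvature]
  simpa using h

/-- The first variation formula for the field `u² F`. -/
theorem integral_boundary_sq (hF : IsFreeBoundaryImmersion (n := n) F) (hu : Continuous u)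
    (hX : HasSobolevGradient (n := n) F u X) :
    ∫ p, u p ^ 2 ∂boundaryVolume (n := n) F =
      ∫ p, positionDivergence n F (fun q => u q ^ 2) (fun q => (2 * u q) • X q) p
        ∂volumeM (n := n) F := by
  have hF' := hF.isSmoothImmersion
  have := isFiniteMeasure_volumeM hF'
  have hFc := hF.contMDiff.continuous
  have hHc := continuous_meanCurvature hF'
  have hk : Integrable (positionDivergence n F (fun q => u q ^ 2) (fun q => (2 * u q) • X q))
      (volumeM (n := n) F) := by
    refine Integrable.add ?_ (integrable_of_continuous (by fun_prop))
    have h1 := integrable_inner_of_memLp hX.memLp_gradient (memLp_of_continuous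
      (μ := volumeM (n := n) F) (show Continuous fun p => (2 * u p) • F p by fun_prop))
    refine h1.congr (Eventually.of_forall fun p => ?_)
    simp only [inner_smul_left, inner_smul_right, conj_trivial]
  symm
  refine eq_integral_boundaryVolume_of_tendsto hF (g := fun p => u p ^ 2) (hu.pow 2)
    ((tendsto_integral_interiorCutoff hF hk).congr' ?_)
  filter_upwards [self_mem_nhdsWithin] with ε (hε : 0 < ε)
  have hc := (contMDiff_interiorCutoff hF hε).continuous
  have hw := continuous_boundaryWeight hF hε
  have h := hX.integral_eq_zero hF' (Z := fun p => (2 * interiorCutoff F ε p) • F p)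
    (b := fun p => interiorCutoff F ε p *
      (n + n * inner ℝ (meanCurvature (n := n) F p) (F p)) - boundaryWeight n F ε p)
    (by fun_prop) (by fun_prop) fun v hv => by
      rw [← integral_mul_boundaryWeight hF hε (f := fun p => v p * v p) (hv.mul hv)]
      refine integral_congr_ae (Eventually.of_forall fun p => ?_)
      simp only [positionDivergence, riemannianGradient_mul hv hv, inner_add_left,
        inner_smul_left, inner_smul_right, conj_trivial]
      ring
  rw [← sub_eq_zero, ← integral_sub, ← h]
  · refine integral_congr_ae (Eventually.of_forall fun p => ?_)
    simp only [positionDivergence, inner_smul_left, inner_smul_right, conj_trivial]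
    ring
  · refine hk.bdd_mul (c := 1) hc.aestronglyMeasurable (Eventually.of_forall fun p => ?_)
    have hρ := hF.boundaryDefect_nonneg p
    rw [interiorCutoff, Real.norm_of_nonneg (by positivity)]
    exact div_le_one_of_le₀ (by linarith) (by positivity)
  · exact integrable_of_continuous ((hu.pow 2).mul hw)

theorem integrable_continuous_smul {μ : Measure M} {Y : M → EuclideanSpace ℝ (Fin N)}
    (hY : Integrable Y μ) {g : M → ℝ} (hg : Continuous g) : Integrable (fun p => g p • Y p) μ := by
  obtain ⟨C, hC⟩ := isCompact_univ.exists_bound_of_continuousOn hg.continuousOn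
  exact hY.bdd_smul C hg.aestronglyMeasurable (Eventually.of_forall fun p => hC p (mem_univ p))

/-- The first variation formula for `v ψ a` with `a` constant and `ψ = 0` on the boundary. -/
theorem integral_mul_of_eq_zero_on_boundary (hF : IsFreeBoundaryImmersion (n := n) F)
    {v ψ : M → ℝ} (hv : ContMDiff (𝓡∂ n) 𝓘(ℝ, ℝ) ∞ v) (hψ : ContMDiff (𝓡∂ n) 𝓘(ℝ, ℝ) ∞ ψ)
    (h0 : ∀ p ∈ (𝓡∂ n).boundary M, ψ p = 0) (a : EuclideanSpace ℝ (Fin N)) :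
    ∫ p, (inner ℝ (riemannianGradient (n := n) F v p) (ψ p • a) + v p *
      (inner ℝ (riemannianGradient (n := n) F ψ p) a + ψ p *
        (n * inner ℝ (meanCurvature (n := n) F p) a))) ∂volumeM (n := n) F = 0 := by
  have h1 := divergence_theorem hF a 0 (f := fun p => v p * ψ p) (hv.mul hψ)
  have hb : ∀ᵐ p ∂boundaryVolume (n := n) F, p ∈ (𝓡∂ n).boundary M := boundaryVolume_compl_boundary
  have h2 : ∫ p, v p * ψ p * inner ℝ (F p) (a + (0 : ℝ) • F p)
      ∂boundaryVolume (n := n) F = 0 := by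
    refine integral_eq_zero_of_ae ?_
    filter_upwards [hb] with p hp
    simp [h0 p hp]
  rw [h2] at h1
  rw [← h1]
  refine integral_congr_ae (Eventually.of_forall fun p => ?_)
  simp only [riemannianGradient_mul hv hψ, inner_add_left, inner_smul_left, inner_smul_right,
    conj_trivial, zero_smul, add_zero, mul_zero, zero_add]
  ring

theorem HasSobolevGradient.integral_smul_eq_zero (hF : IsFreeBoundaryImmersion (n := n) F)
    (hX : HasSobolevGradient (n := n) F u X) (hu0 : ∀ p, u p = 0)
    {ψ : M → ℝ} (hψ : ContMDiff (𝓡∂ n) 𝓘(ℝ, ℝ) ∞ ψ) (h0 : ∀ p ∈ (𝓡∂ n).boundary M, ψ p = 0) :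
    ∫ p, ψ p • X p ∂volumeM (n := n) F = 0 := by
  have hF' := hF.isSmoothImmersion
  have := isFiniteMeasure_volumeM hF'
  have hHc := continuous_meanCurvature hF'
  have hψc := hψ.continuous
  have hgψ := continuous_riemannianGradient hF' hψ
  have hXint : Integrable X (volumeM (n := n) F) := hX.memLp_gradient.integrable (by norm_num)
  refine ext_inner_left ℝ fun a => ?_
  have h := hX.integral_eq_zero' hF' (Z := fun p => ψ p • a)
    (b := fun p => inner ℝ (riemannianGradient (n := n) F ψ p) a + ψ p *
      (n * inner ℝ (meanCurvature (n := n) F p) a)) (by fun_prop) (by fun_prop)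
    fun v hv => integral_mul_of_eq_zero_on_boundary hF hv hψ h0 a
  rw [inner_zero_right, ← integral_inner (integrable_continuous_smul hXint hψc), ← h]
  refine integral_congr_ae (Eventually.of_forall fun p => ?_)
  simp only [hu0, zero_mul, add_zero, inner_smul_right]
  rw [real_inner_comm]

/-- The gradient of the zero function vanishes. -/
theorem ae_eq_zero_of_hasSobolevGradient_zero (hF : IsFreeBoundaryImmersion (n := n) F)
    (hX : HasSobolevGradient (n := n) F u X) (hu0 : ∀ p, u p = 0) :
    ∀ᵐ p ∂volumeM (n := n) F, X p = 0 := by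
  have := isFiniteMeasure_volumeM hF.isSmoothImmersion
  have hρ := contMDiff_boundaryDefect hF.isSmoothImmersion
  have hXint : Integrable X (volumeM (n := n) F) := hX.memLp_gradient.integrable (by norm_num)
  have hi := integrable_continuous_smul hXint hρ.continuous
  have hzero : ∀ᵐ p ∂volumeM (n := n) F, boundaryDefect F p • X p = 0 := by
    refine ae_eq_zero_of_integral_contMDiff_smul_eq_zero (𝓡∂ n) hi.locallyIntegrable
      fun g hg _ => ?_
    simp only [smul_smul]
    exact hX.integral_smul_eq_zero hF hu0 (hg.mul hρ) fun p hp => by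
      simp [hF.boundaryDefect_eq_zero hp]
  have hb : ∀ᵐ p ∂volumeM (n := n) F, p ∉ (𝓡∂ n).boundary M :=
    measure_eq_zero_iff_ae_notMem.1 volumeM_boundary
  filter_upwards [hzero, hb] with p hp hpb
  exact (smul_eq_zero.1 hp).resolve_left (hF.boundaryDefect_pos hpb).ne'

/-- The difference of the two sides of the inequalities is the integral of a sum of squares. -/
theorem energy_identity (hF : IsFreeBoundaryImmersion (n := n) F) (hu : Continuous u)
    (hX : HasSobolevGradient (n := n) F u X) (s : ℝ) :
    Integrable (fun p =>
      ‖(2 / n : ℝ) • X p + (s * u p) • F p + u p • meanCurvature (n := n) F p‖ ^ 2 + s ^ 2 * u p ^ 2 * boundaryDefect F p) (volumeM (n := n) F) ∧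
    (4 / (n : ℝ) ^ 2 * ∫ p, ‖X p‖ ^ 2 ∂volumeM (n := n) F) +
        (2 * s / n * ∫ p, u p ^ 2 ∂boundaryVolume (n := n) F) -
      ((s * (2 - s) * ∫ p, u p ^ 2 ∂volumeM (n := n) F) -
        ∫ p, ‖meanCurvature (n := n) F p‖ ^ 2 * u p ^ 2 ∂volumeM (n := n) F) =
    ∫ p, (‖(2 / n : ℝ) • X p + (s * u p) • F p + u p • meanCurvature (n := n) F p‖ ^ 2
      + s ^ 2 * u p ^ 2 * boundaryDefect F p) ∂volumeM (n := n) F := by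
  have hF' := hF.isSmoothImmersion
  have := isFiniteMeasure_volumeM hF'
  have hFc := hF.contMDiff.continuous
  have hHc := continuous_meanCurvature hF'
  have hρc := (contMDiff_boundaryDefect hF').continuous
  have hn : (n : ℝ) ≠ 0 := by exact_mod_cast NeZero.ne n
  have i1 : Integrable (fun p => ‖X p‖ ^ 2) (volumeM (n := n) F) :=
    hX.memLp_gradient.integrable_norm_pow (by norm_num)
  have i2 : Integrable (fun p => u p ^ 2) (volumeM (n := n) F) :=
    integrable_of_continuous (by fun_prop)
  have i3 : Integrable (fun p => ‖meanCurvature (n := n) F p‖ ^ 2 * u p ^ 2)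
      (volumeM (n := n) F) := integrable_of_continuous (by fun_prop)
  have i4 : Integrable (fun p => inner ℝ (X p) (u p • meanCurvature (n := n) F p))
      (volumeM (n := n) F) :=
    integrable_inner_of_memLp hX.memLp_gradient (memLp_of_continuous (by fun_prop))
  have i5 : Integrable (positionDivergence n F (fun q => u q ^ 2) (fun q => (2 * u q) • X q))
      (volumeM (n := n) F) := by
    refine Integrable.add ?_ (integrable_of_continuous (by fun_prop))
    have h1 := integrable_inner_of_memLp hX.memLp_gradient (memLp_of_continuous
      (μ := volumeM (n := n) F) (show Continuous fun p => (2 * u p) • F p by fun_prop))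
    refine h1.congr (Eventually.of_forall fun p => ?_)
    simp only [inner_smul_left, inner_smul_right, conj_trivial]
  have e : (fun p => ‖(2 / n : ℝ) • X p + (s * u p) • F p + u p • meanCurvature (n := n) F p‖ ^ 2
      + s ^ 2 * u p ^ 2 * boundaryDefect F p) = fun p => 4 / (n : ℝ) ^ 2 * ‖X p‖ ^ 2 +
      2 * s / n * positionDivergence n F (fun q => u q ^ 2) (fun q => (2 * u q) • X q) p -
      (s * (2 - s) * u p ^ 2 - ‖meanCurvature (n := n) F p‖ ^ 2 * u p ^ 2) +
      4 / n * inner ℝ (X p) (u p • meanCurvature (n := n) F p) := by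
    ext p
    simp only [← real_inner_self_eq_norm_sq, inner_add_left, inner_add_right, inner_smul_left,
      inner_smul_right, conj_trivial, positionDivergence, boundaryDefect]
    rw [real_inner_comm (X p) (F p), real_inner_comm (X p) (meanCurvature (n := n) F p),
      real_inner_comm (meanCurvature (n := n) F p) (F p)]
    field_simp
    ring
  have j1 : Integrable (fun p => 4 / (n : ℝ) ^ 2 * ‖X p‖ ^ 2 + 2 * s / n *
      positionDivergence n F (fun q => u q ^ 2) (fun q => (2 * u q) • X q) p)
      (volumeM (n := n) F) := (i1.const_mul _).add (i5.const_mul _)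
  have j2 : Integrable (fun p => s * (2 - s) * u p ^ 2 -
      ‖meanCurvature (n := n) F p‖ ^ 2 * u p ^ 2) (volumeM (n := n) F) := (i2.const_mul _).sub i3
  have j3 := i4.const_mul (4 / (n : ℝ))
  rw [e]
  refine ⟨(j1.sub j2).add j3, ?_⟩
  rw [integral_boundary_sq hF hu hX, ← integral_const_mul, ← integral_const_mul,
    ← integral_const_mul, ← integral_add (i1.const_mul _) (i5.const_mul _),
    ← integral_sub (i2.const_mul _) i3, ← integral_sub j1 j2]
  refine (Eq.symm ?_)
  refine (integral_add (j1.sub j2) j3).trans ?_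
  rw [integral_const_mul, integral_inner_meanCurvature hF' hX, mul_zero, add_zero]
  rfl

theorem energy_inequality (hF : IsFreeBoundaryImmersion (n := n) F) (hu : Continuous u)
    (hX : HasSobolevGradient (n := n) F u X) {s : ℝ} (hs : s ≠ 0) :
    ((s * (2 - s) * ∫ p, u p ^ 2 ∂volumeM (n := n) F) -
        (∫ p, ‖meanCurvature (n := n) F p‖ ^ 2 * u p ^ 2 ∂volumeM (n := n) F) ≤
      (4 / (n : ℝ) ^ 2 * ∫ p, ‖X p‖ ^ 2 ∂volumeM (n := n) F) +
        (2 * s / n * ∫ p, u p ^ 2 ∂boundaryVolume (n := n) F)) ∧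
    ((s * (2 - s) * ∫ p, u p ^ 2 ∂volumeM (n := n) F) -
        (∫ p, ‖meanCurvature (n := n) F p‖ ^ 2 * u p ^ 2 ∂volumeM (n := n) F) =
      (4 / (n : ℝ) ^ 2 * ∫ p, ‖X p‖ ^ 2 ∂volumeM (n := n) F) +
        (2 * s / n * ∫ p, u p ^ 2 ∂boundaryVolume (n := n) F) ↔ ∀ p, u p = 0) := by
  obtain ⟨hint, hid⟩ := energy_identity hF hu hX s
  have hnn : ∀ p, 0 ≤ ‖(2 / n : ℝ) • X p + (s * u p) • F p + u p • meanCurvature (n := n) F p‖ ^ 2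
      + s ^ 2 * u p ^ 2 * boundaryDefect F p := fun p => by
    have := hF.boundaryDefect_nonneg p
    positivity
  refine ⟨?_, fun heq => ?_, fun hu0 => ?_⟩
  · rw [← sub_nonneg, hid]
    exact integral_nonneg hnn
  · rw [heq, sub_self] at hid
    have hae := (integral_eq_zero_iff_of_nonneg hnn hint).1 hid.symm
    have hb : ∀ᵐ p ∂volumeM (n := n) F, p ∉ (𝓡∂ n).boundary M :=
      measure_eq_zero_iff_ae_notMem.1 volumeM_boundary
    have hu0 : u =ᵐ[volumeM (n := n) F] fun _ => 0 := by
      filter_upwards [hae, hb] with p hp hpb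
      have hρ := hF.boundaryDefect_pos hpb
      simp only [Pi.zero_apply] at hp
      have h1 : 0 ≤ s ^ 2 * u p ^ 2 * boundaryDefect F p := by positivity
      have h2 : s ^ 2 * u p ^ 2 * boundaryDefect F p = 0 := by
        nlinarith [sq_nonneg
          ‖(2 / n : ℝ) • X p + (s * u p) • F p + u p • meanCurvature (n := n) F p‖]
      simpa [hs, hρ.ne'] using h2
    have := isOpenPosMeasure_volumeM hF.isSmoothImmersion
    exact fun p => congrFun ((Continuous.ae_eq_iff_eq _ hu continuous_const).1 hu0) p
  · have hX0 := ae_eq_zero_of_hasSobolevGradient_zero hF hX hu0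
    have h0 : ∫ p, ‖X p‖ ^ 2 ∂volumeM (n := n) F = 0 := by
      refine integral_eq_zero_of_ae ?_
      filter_upwards [hX0] with p hp
      simp [hp]
    simp [hu0, h0]

end Sobolev

end FreeBoundary

end

theorem lemma2p3 {n k : ℕ} [NeZero n] {M : Type*} [TopologicalSpace M] [T2Space M]
    [CompactSpace M] [ChartedSpace (EuclideanHalfSpace n) M] [IsManifold (𝓡∂ n) ∞ M]
    [MeasurableSpace M] [BorelSpace M]
    (F : M → EuclideanSpace ℝ (Fin (n + k)))
    (hF : FreeBoundary.IsFreeBoundaryImmersion (n := n) F)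
    (s : ℝ) (hs : 0 < s)
    (u : M → ℝ) (hu : Continuous u)
    (X : M → EuclideanSpace ℝ (Fin (n + k)))
    (hX : FreeBoundary.HasSobolevGradient (n := n) F u X) :
    (s * (2 - s) * ∫ p, u p ^ 2 ∂FreeBoundary.volumeM (n := n) F)
        - (∫ p, ‖FreeBoundary.meanCurvature (n := n) F p‖ ^ 2 * u p ^ 2
            ∂FreeBoundary.volumeM (n := n) F)
      ≤ (4 / (n : ℝ) ^ 2 * ∫ p, ‖X p‖ ^ 2 ∂FreeBoundary.volumeM (n := n) F)
        + (2 * s / n * ∫ p, u p ^ 2 ∂FreeBoundary.boundaryVolume (n := n) F)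
    ∧ (-s * (2 + s) * ∫ p, u p ^ 2 ∂FreeBoundary.volumeM (n := n) F)
        - (∫ p, ‖FreeBoundary.meanCurvature (n := n) F p‖ ^ 2 * u p ^ 2
            ∂FreeBoundary.volumeM (n := n) F)
      ≤ (4 / (n : ℝ) ^ 2 * ∫ p, ‖X p‖ ^ 2 ∂FreeBoundary.volumeM (n := n) F)
        - (2 * s / n * ∫ p, u p ^ 2 ∂FreeBoundary.boundaryVolume (n := n) F)
    ∧ ((s * (2 - s) * ∫ p, u p ^ 2 ∂FreeBoundary.volumeM (n := n) F)
        - (∫ p, ‖FreeBoundary.meanCurvature (n := n) F p‖ ^ 2 * u p ^ 2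
            ∂FreeBoundary.volumeM (n := n) F)
      = (4 / (n : ℝ) ^ 2 * ∫ p, ‖X p‖ ^ 2 ∂FreeBoundary.volumeM (n := n) F)
        + (2 * s / n * ∫ p, u p ^ 2 ∂FreeBoundary.boundaryVolume (n := n) F)
      ↔ ∀ p, u p = 0)
    ∧ ((-s * (2 + s) * ∫ p, u p ^ 2 ∂FreeBoundary.volumeM (n := n) F)
        - (∫ p, ‖FreeBoundary.meanCurvature (n := n) F p‖ ^ 2 * u p ^ 2
            ∂FreeBoundary.volumeM (n := n) F)
      = (4 / (n : ℝ) ^ 2 * ∫ p, ‖X p‖ ^ 2 ∂FreeBoundary.volumeM (n := n) F)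
        - (2 * s / n * ∫ p, u p ^ 2 ∂FreeBoundary.boundaryVolume (n := n) F)
      ↔ ∀ p, u p = 0) := by
  have h1 := FreeBoundary.energy_inequality hF hu hX hs.ne'
  have h2 := FreeBoundary.energy_inequality hF hu hX (neg_ne_zero.2 hs.ne')
  have e : ∀ a b : ℝ, a + 2 * -s / n * b = a - 2 * s / n * b := fun a b => by ring
  rw [e, sub_neg_eq_add] at h2
  exact ⟨h1.1, h2.1, h1.2, h2.2⟩
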